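/- Let $\widehat W$ be a complex Gaussian white noise on $\mathbb R^2$ with Lebesgue control measure on a probability space, that is, a centred jointly Gaussian family $\widehat W(A)$ indexed by the Borel sets $A$ of finite measure with $\widehat W(-A)=\overline{\widehat W(A)}$ a.s. and $\mathbb E[\widehat W(A)\overline{\widehat W(B)}]=|A\cap B|$; $\int f(\xi)\,\widehat W(d\xi)$ denotes the usual $L^2$ stochastic integral. **Assumptions.** Let $\beta\in\mathbb R$, and let $h:\mathbb R^2\to[0,1]$ and $C:\mathbb R^2\times\mathbb R^2\to\mathbb R_+$ (measurable in its second variable) be such that * $h$ is $\beta$-Hölder on $\mathbb R^2$, i.e. $|h(x)-h(y)|\le\Lambda\|x-y\|^\beta$ for some $\Lambda$ and all $x,y$, with $\inf h>0$, $\sup h<1$ and $\sup h<\beta$; * $C$ is bounded; for every $x$, $\xi\mapsto C(x,\xi)$ is even and homogeneous of degree $0$ ($C(x,\rho\xi)=C(x,\xi)$ for $\rho>0$); for every $\xi$, $x\mapsto C(x,\xi)$ is continuous; * there is $\eta\ge\beta$ such that $A_x=\sup_{z\neq0}\|z\|^{-2\eta}\int_{\mathbb S^1}[C(x+z,\Theta)-C(x,\Theta)]^2\,d\Theta$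 is finite for every $x$ and bounded in $x$ on every compact set. **Claim.** The Generalized Anisotropic Fractional Brownian Field $$X(x)=\int_{\mathbb R^2}\bigl(e^{j\langle x,\xi\rangle}-1\bigr)\frac{C(x,\xi)}{\|\xi\|^{h(x)+1}}\,\widehat W(d\xi),\qquad x\in\mathbb R^2,$$ is well defined and has a real-valued version with continuous sample paths. For every such version $X$ and every $x_0\in\mathbb R^2$: 1. The field $$Y_{x_0}(x)=\int_{\mathbb R^2}\bigl(e^{j\langle x,\xi\rangle}-1\bigr)\frac{C(x_0,\xi)}{\|\xi\|^{h(x_0)+1}}\,\widehat W(d\xi)$$ has a real-valued version with continuous sample paths, and $X$ is $h(x_0)$-localizable at $x_0$ with tangent field $Y_{x_0}$ (any such version): $0<h(x_0)<1$ and, as $\rho\to0^+$, $$\Bigl\{\tfrac{X(x_0+\rho u)-X(x_0)}{\rho^{h(x_0)}}\Bigr\}_{u\in\mathbb R^2}\longrightarrow\{Y_{x_0}(u)\}_{u\in\mathbb R^2}$$ in distribution in the space $C(\mathbb R^2,\mathbb R)$ of continuous functions with the topology of uniform convergence on compact sets. 2. $Y_{x_0}$ is a centred Gaussian field, $h(x_0)$-self-similar,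 with stationary increments, and it has a spectral density equal for $\xi\neq0$ to $\|\xi\|^{-2h(x_0)-2}S(\xi/\|\xi\|)$ with $S(\Theta)=C(x_0,\Theta)^2$ on $\mathbb S^1$, i.e. its anisotropy function is $C(x_0,\cdot)^2$. (A spectral density of $Y$ is a non-negative measurable $f$ with $\int\min(1,\|\xi\|^2)f(\xi)\,d\xi<\infty$ and $\mathbb E[Y(x)Y(y)]=\int(e^{j\langle x,\xi\rangle}-1)(e^{-j\langle y,\xi\rangle}-1)f(\xi)\,d\xi$ for all $x,y$.) 3. $X$ is a centred Gaussian field, and its local anisotropy function at $x_0$, defined as the anisotropy function of its tangent field at $x_0$, is $C(x_0,\cdot)^2$. -/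

import Mathlib

open MeasureTheory ProbabilityTheory Filter
open scoped Topology ENNReal Pointwise ComplexConjugate

universe u

noncomputable section

/-- The Euclidean plane. -/
abbrev Plane : Type := EuclideanSpace ℝ (Fin 2)

/-- Borel sigma-algebra on the space of continuous functions on the plane, for the topology of
uniform convergence on compact sets (the compact-open topology). -/
instance instMeasurableSpacePaths : MeasurableSpace C(Plane, ℝ) := borel _

instance instBorelSpacePaths : BorelSpace C(Plane, ℝ) := ⟨rfl⟩

section WhiteNoise

variable {Ω : Type u} [MeasurableSpace Ω]

/-- `W` is a complex (Hermitian) Gaussian white noise on the plane with Lebesgue control measure: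
a centred jointly Gaussian family of complex random variables indexed by the Borel sets of finite
measure, with `W (-A) = conj (W A)` and `E[W A * conj (W B)] = |A ∩ B|`. -/
structure IsComplexWhiteNoise (P : Measure Ω) (W : Set Plane → Ω → ℂ) : Prop where
  gaussian : IsGaussianProcess
    (fun A : {A : Set Plane // MeasurableSet A ∧ volume A < ∞} => W A.1) P
  centered : ∀ A : Set Plane, MeasurableSet A → volume A < ∞ → ∫ ω, W A ω ∂P = 0
  hermitian : ∀ A : Set Plane, MeasurableSet A → volume A < ∞ →
    ∀ᵐ ω ∂P, W (-A) ω = conj (W A ω)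
  covariance : ∀ A B : Set Plane, MeasurableSet A → volume A < ∞ → MeasurableSet B →
    volume B < ∞ → ∫ ω, W A ω * conj (W B ω) ∂P = ((volume.real (A ∩ B) : ℝ) : ℂ)

/-- The stochastic integral of a simple function, `∑ c, c * W {s = c}`. -/
def simpleWienerIntegral (W : Set Plane → Ω → ℂ) (s : SimpleFunc Plane ℂ) (ω : Ω) : ℂ :=
  ∑ c ∈ s.range, c * W (s ⁻¹' {c}) ω

/-- `Z` is (a version of) the stochastic integral `∫ f(ξ) W(dξ)` of the square integrable
function `f`: the `L²`-limit of the integrals of square integrable simple functions converging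
to `f` in `L²`. -/
def IsWienerIntegral (P : Measure Ω) (W : Set Plane → Ω → ℂ) (f : Plane → ℂ) (Z : Ω → ℂ) : Prop :=
  MemLp f 2 (volume : Measure Plane) ∧ MemLp Z 2 P ∧
    ∀ ε : ℝ≥0∞, 0 < ε → ∃ s : SimpleFunc Plane ℂ, MemLp s 2 (volume : Measure Plane) ∧
      eLpNorm (fun ξ => f ξ - s ξ) 2 (volume : Measure Plane) < ε ∧
      eLpNorm (fun ω => Z ω - simpleWienerIntegral W s ω) 2 P < ε

/-- The integrand `(e^{j⟨x,ξ⟩} - 1) g(ξ)` of a harmonizable representation. -/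
def harmonizableKernel (g : Plane → ℝ) (x ξ : Plane) : ℂ :=
  (Complex.exp (Complex.I * ((inner ℝ x ξ : ℝ) : ℂ)) - 1) * ((g ξ : ℝ) : ℂ)

/-- `f^{1/2}(x,ξ) = C(x,ξ) / ‖ξ‖^{h(x)+1}`. -/
def sqrtDensity (h : Plane → ℝ) (C : Plane → Plane → ℝ) (x ξ : Plane) : ℝ :=
  C x ξ / ‖ξ‖ ^ (h x + 1)

/-- `X` is a version with continuous sample paths of the field
`X(x) = ∫ (e^{j⟨x,ξ⟩} - 1) C(x,ξ) ‖ξ‖^{-h(x)-1} W(dξ)`. -/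
def IsGAFBF (P : Measure Ω) (W : Set Plane → Ω → ℂ) (h : Plane → ℝ) (C : Plane → Plane → ℝ)
    (X : Ω → C(Plane, ℝ)) : Prop :=
  ∀ x : Plane, IsWienerIntegral P W (harmonizableKernel (sqrtDensity h C x) x)
    (fun ω => ((X ω x : ℝ) : ℂ))

/-- `Y` is a version with continuous sample paths of the field
`Y(x) = ∫ (e^{j⟨x,ξ⟩} - 1) g(ξ) W(dξ)`. -/
def IsHarmonizableField (P : Measure Ω) (W : Set Plane → Ω → ℂ) (g : Plane → ℝ)
    (Y : Ω → C(Plane, ℝ)) : Prop :=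
  ∀ x : Plane, IsWienerIntegral P W (harmonizableKernel g x) (fun ω => ((Y ω x : ℝ) : ℂ))

end WhiteNoise

/-- `A_x = sup_{z ≠ 0} ‖z‖^{-2η} ∫_{S¹} (C(x+z,Θ) - C(x,Θ))² dΘ`, as an extended real.
The measure `volume.toSphere` is the arc length on the unit circle. -/
def angularModulus (C : Plane → Plane → ℝ) (η : ℝ) (x : Plane) : ℝ≥0∞ :=
  ⨆ (z : Plane) (_ : z ≠ 0), ENNReal.ofReal (‖z‖ ^ (-(2 * η))) *
    ∫⁻ Θ : Metric.sphere (0 : Plane) 1, ENNReal.ofReal ((C (x + z) Θ - C x Θ) ^ 2)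
      ∂((volume : Measure Plane).toSphere)

/-- The standing assumptions on the Hurst function `h` and on the anisotropy factor `C`. -/
structure GAFBFAssumptions (β : ℝ) (h : Plane → ℝ) (C : Plane → Plane → ℝ) : Prop where
  h_mem : ∀ x, h x ∈ Set.Icc (0 : ℝ) 1
  h_holder : ∃ Λ : ℝ, ∀ x y, |h x - h y| ≤ Λ * ‖x - y‖ ^ β
  iInf_pos : 0 < ⨅ x, h x
  iSup_lt_one : (⨆ x, h x) < 1
  iSup_lt : (⨆ x, h x) < β
  C_nonneg : ∀ x ξ, 0 ≤ C x ξ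
  C_measurable : ∀ x, Measurable (C x)
  C_bounded : ∃ M : ℝ, ∀ x ξ, C x ξ ≤ M
  C_even : ∀ x ξ, C x (-ξ) = C x ξ
  C_homogeneous : ∀ x ξ, ∀ ρ : ℝ, 0 < ρ → C x (ρ • ξ) = C x ξ
  C_continuous : ∀ ξ, Continuous fun x => C x ξ
  C_angular : ∃ η : ℝ, β ≤ η ∧ (∀ x, angularModulus C η x < ∞) ∧
    ∀ K : Set Plane, IsCompact K → ∃ B : ℝ≥0∞, B < ∞ ∧ ∀ x ∈ K, angularModulus C η x ≤ B

/-- The rescaled increment `u ↦ (φ(x₀ + ρ u) - φ(x₀)) / ρ^H` of a continuous path. -/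
def rescaledIncrement (x₀ : Plane) (H ρ : ℝ) (φ : C(Plane, ℝ)) : C(Plane, ℝ) where
  toFun u := (φ (x₀ + ρ • u) - φ x₀) / ρ ^ H
  continuous_toFun := by fun_prop

section Fields

variable {Ω : Type u} [MeasurableSpace Ω] {Ω' : Type u} [MeasurableSpace Ω']

/-- `X` is `H`-localizable at `x₀` with tangent field `Y`: the rescaled increments of `X` at `x₀`
converge in distribution to `Y` as `ρ → 0⁺`, as random continuous functions on the plane
(weak convergence for the topology of uniform convergence on compact sets). -/
def HasTangentField (P : Measure Ω) [IsProbabilityMeasure P] (X : Ω → C(Plane, ℝ))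
    (x₀ : Plane) (H : ℝ) (P' : Measure Ω') [IsProbabilityMeasure P'] (Y : Ω' → C(Plane, ℝ)) :
    Prop :=
  H ∈ Set.Ioo (0 : ℝ) 1 ∧
    TendstoInDistribution (fun ρ : ℝ => fun ω => rescaledIncrement x₀ H ρ (X ω)) (𝓝[>] 0) Y
      (fun _ => P) P'

/-- Equality of all finite dimensional distributions. -/
def FddEq (P : Measure Ω) (U V : Plane → Ω → ℝ) : Prop :=
  ∀ (n : ℕ) (x : Fin n → Plane),
    IdentDistrib (fun ω => fun i => U (x i) ω) (fun ω => fun i => V (x i) ω) P P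

def IsSelfSimilar (P : Measure Ω) (H : ℝ) (Y : Ω → C(Plane, ℝ)) : Prop :=
  ∀ c : ℝ, 0 < c → FddEq P (fun x ω => Y ω (c • x)) (fun x ω => c ^ H * Y ω x)

def HasStationaryIncrements (P : Measure Ω) (Y : Ω → C(Plane, ℝ)) : Prop :=
  ∀ x : Plane, FddEq P (fun u ω => Y ω (x + u) - Y ω x) (fun u ω => Y ω u)

def IsCenteredGaussianField (P : Measure Ω) (Y : Ω → C(Plane, ℝ)) : Prop :=
  IsGaussianProcess (fun x ω => Y ω x) P ∧ ∀ x, ∫ ω, Y ω x ∂P = 0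

/-- `f` is a spectral density of `Y`. -/
structure HasSpectralDensity (P : Measure Ω) (Y : Ω → C(Plane, ℝ)) (f : Plane → ℝ) : Prop where
  measurable : Measurable f
  nonneg : ∀ ξ, 0 ≤ f ξ
  integrable : Integrable (fun ξ => min 1 (‖ξ‖ ^ 2) * f ξ) (volume : Measure Plane)
  covariance : ∀ x y : Plane, ((∫ ω, Y ω x * Y ω y ∂P : ℝ) : ℂ) =
    ∫ ξ : Plane, (Complex.exp (Complex.I * ((inner ℝ x ξ : ℝ) : ℂ)) - 1) *
      (Complex.exp (-(Complex.I * ((inner ℝ y ξ : ℝ) : ℂ))) - 1) * ((f ξ : ℝ) : ℂ)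

/-- `S` is the anisotropy function of `Y`: `Y` is a centred Gaussian `H`-self-similar field with
stationary increments, with spectral density `‖ξ‖^{-2H-2} S(ξ/‖ξ‖)`. -/
structure IsAnisotropyFunction (P : Measure Ω) (Y : Ω → C(Plane, ℝ)) (H : ℝ)
    (S : Metric.sphere (0 : Plane) 1 → ℝ) : Prop where
  mem_Ioo : H ∈ Set.Ioo (0 : ℝ) 1
  gaussian : IsCenteredGaussianField P Y
  selfSimilar : IsSelfSimilar P H Y
  stationaryIncrements : HasStationaryIncrements P Y
  density : ∃ f : Plane → ℝ, HasSpectralDensity P Y f ∧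
    ∀ (r : ℝ) (Θ : Metric.sphere (0 : Plane) 1), 0 < r →
      f (r • (Θ : Plane)) = r ^ (-(2 * H) - 2) * S Θ

/-- `S` is the local anisotropy function at `x₀` of the Gaussian field `X`: the anisotropy function
of a tangent field of `X` at `x₀`. -/
def IsLocalAnisotropyFunction (P : Measure Ω) [IsProbabilityMeasure P] (X : Ω → C(Plane, ℝ))
    (x₀ : Plane) (S : Metric.sphere (0 : Plane) 1 → ℝ) : Prop :=
  IsCenteredGaussianField P X ∧
    ∃ (H : ℝ) (Ω' : Type u) (_ : MeasurableSpace Ω') (P' : Measure Ω')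
      (_ : IsProbabilityMeasure P') (Y : Ω' → C(Plane, ℝ)),
      HasTangentField P X x₀ H P' Y ∧ IsAnisotropyFunction P' Y H S

end Fields

end

/-!
The field `X` and its candidate tangent field `Y` are built from the same white noise, and are
compared directly, without any compactness argument in the path space.

The stochastic integral. The covariance of the white noise gives the polarized Itô isometry for
simple functions (`integral_simpleWienerIntegral_mul_conj`). A map between Hilbert spaces that
preserves inner products is linear, so the integral is a linear isometry between `L²` spaces
(`wienerIsometry`). Functions with Hermitian symmetry have real integrals
(`exists_real_isWienerIntegral`), and these are jointly Gaussian because centred Gaussian variables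
are closed under limits in `L²` (`hasGaussianLaw_of_tendsto`). Every covariance below is therefore
an integral of kernels over the plane of wave vectors.

Continuous versions. With `0 < m ≤ h ≤ M < 1`, `M < β`, the increments of the kernels have squared
`L²` norm `O(‖x - y‖ ^ m)`, locally uniformly (`exists_integral_field_increment_le`). Gaussian
moments of high order satisfy the hypothesis of the Kolmogorov–Chentsov theorem, which is proved by
chaining along dyadic grids (`exists_continuous_modification`). The chaining is deterministic
(`GridBound.abs_sub_le`) and also serves to estimate suprema in probability.

The field `Y`. A translation in space multiplies the kernels of the increments by a factor of
modulus one, and a dilation is absorbed by a change of variables in the covariance, so `Y` has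
stationary increments and is self-similar of order `h x₀`. Since the law on the path space is
determined by the finite dimensional distributions (`map_paths_eq_of_fddEq`), the rescaled
increments of `Y` at `x₀` have exactly the law of `Y`, at every scale (`map_rescaledIncrement_eq`).

The tangent field. It remains to show that the rescaled increments of `X - Y` at `x₀` tend to `0`
in probability, uniformly on compact sets. At a point at distance `ρ` from `x₀` the variance of
`X - Y` is `O(ρ ^ (2 β))`, where the Hölder condition on `h` and the angular condition on `C` enter
(`exists_integral_density_le`), and `β > h x₀`. Interpolating this with the Hölder bound on the
increments gives increments of variance `O(ρ ^ γ ‖u - v‖ ^ α)` with `α, γ > 0` after rescaling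
(`exists_integral_difference_le`), and chaining turns this into uniform smallness in probability
(`tendsto_measure_openSquare`). Slutsky's lemma in the path space concludes
(`tendstoInDistribution_of_close`).
-/

/-! ### The stochastic integral as a linear isometry -/

section WienerIntegral

variable {Ω : Type u} [MeasurableSpace Ω] {P : Measure Ω} {W : Set Plane → Ω → ℂ}

lemma IsComplexWhiteNoise.memLp (hW : IsComplexWhiteNoise P W) {A : Set Plane}
    (hA : MeasurableSet A) (hA' : volume A < ∞) : MemLp (W A) 2 P :=
  (hW.gaussian.hasGaussianLaw_eval ⟨A, hA, hA'⟩).memLp_two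

lemma volume_preimage_lt_top {s : SimpleFunc Plane ℂ} (hs : MemLp s 2 (volume : Measure Plane))
    {c : ℂ} (hc : c ≠ 0) : volume (s ⁻¹' {c}) < ∞ :=
  SimpleFunc.measure_preimage_lt_top_of_memLp (by norm_num) (by norm_num) s hs c hc

lemma memLp_mul_whiteNoise (hW : IsComplexWhiteNoise P W) {s : SimpleFunc Plane ℂ}
    (hs : MemLp s 2 (volume : Measure Plane)) (c : ℂ) :
    MemLp (fun ω => c * W (s ⁻¹' {c}) ω) 2 P := by
  by_cases hc : c = 0
  · simp [hc]
  · exact (hW.memLp (s.measurableSet_fiber c) (volume_preimage_lt_top hs hc)).const_mul c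

lemma memLp_simpleWienerIntegral (hW : IsComplexWhiteNoise P W) {s : SimpleFunc Plane ℂ}
    (hs : MemLp s 2 (volume : Measure Plane)) : MemLp (simpleWienerIntegral W s) 2 P :=
  memLp_finsetSum _ fun c _ => memLp_mul_whiteNoise hW hs c

lemma SimpleFunc.mul_conj_eq_sum (s t : SimpleFunc Plane ℂ) (ξ : Plane) :
    s ξ * conj (t ξ) = ∑ c ∈ s.range, ∑ d ∈ t.range,
      (s ⁻¹' {c} ∩ t ⁻¹' {d}).indicator (fun _ => c * conj d) ξ := by
  rw [Finset.sum_eq_single (s ξ), Finset.sum_eq_single (t ξ)]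
  · rw [Set.indicator_of_mem]; simp
  · intro d _ hd
    rw [Set.indicator_of_notMem]
    rintro ⟨-, h⟩
    exact hd h.symm
  · intro h; exact absurd (SimpleFunc.mem_range_self t ξ) h
  · intro c _ hc
    refine Finset.sum_eq_zero fun d _ => ?_
    rw [Set.indicator_of_notMem]
    rintro ⟨h, -⟩
    exact hc h.symm
  · intro h; exact absurd (SimpleFunc.mem_range_self s ξ) h

/-- The Itô isometry for simple functions, in polarized form. It rests on the covariance of the
white noise alone: additivity of `W` in the set is not needed, and in fact follows from it. -/
lemma integral_simpleWienerIntegral_mul_conj (hW : IsComplexWhiteNoise P W)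
    {s t : SimpleFunc Plane ℂ} (hs : MemLp s 2 (volume : Measure Plane))
    (ht : MemLp t 2 (volume : Measure Plane)) :
    ∫ ω, simpleWienerIntegral W s ω * conj (simpleWienerIntegral W t ω) ∂P =
      ∫ ξ, s ξ * conj (t ξ) := by
  have hint : ∀ c d : ℂ, Integrable
      (fun ω => (c * W (s ⁻¹' {c}) ω) * conj (d * W (t ⁻¹' {d}) ω)) P := fun c d =>
    (memLp_mul_whiteNoise hW hs c).integrable_mul (memLp_mul_whiteNoise hW ht d).star
  have hint' : ∀ c d : ℂ, Integrable
      ((s ⁻¹' {c} ∩ t ⁻¹' {d}).indicator (fun _ => c * conj d)) (volume : Measure Plane) := by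
    intro c d
    by_cases hc : c = 0
    · simp [hc]
    refine (integrable_indicator_iff
      ((s.measurableSet_fiber c).inter (t.measurableSet_fiber d))).2 (integrableOn_const ?_)
    exact ((measure_mono Set.inter_subset_left).trans_lt (volume_preimage_lt_top hs hc)).ne
  have h1 : ∀ ω, simpleWienerIntegral W s ω * conj (simpleWienerIntegral W t ω) =
      ∑ c ∈ s.range, ∑ d ∈ t.range, (c * W (s ⁻¹' {c}) ω) * conj (d * W (t ⁻¹' {d}) ω) := by
    intro ω
    simp only [simpleWienerIntegral, map_sum, Finset.sum_mul_sum]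
  simp_rw [h1, SimpleFunc.mul_conj_eq_sum s t]
  rw [integral_finsetSum _ fun c _ => integrable_finsetSum _ fun d _ => hint c d,
    integral_finsetSum _ fun c _ => integrable_finsetSum _ fun d _ => hint' c d]
  refine Finset.sum_congr rfl fun c _ => ?_
  rw [integral_finsetSum _ fun d _ => hint c d, integral_finsetSum _ fun d _ => hint' c d]
  refine Finset.sum_congr rfl fun d _ => ?_
  by_cases hc : c = 0
  · simp [hc]
  by_cases hd : d = 0
  · simp [hd]
  have h2 : ∀ ω, (c * W (s ⁻¹' {c}) ω) * conj (d * W (t ⁻¹' {d}) ω) =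
      (c * conj d) * (W (s ⁻¹' {c}) ω * conj (W (t ⁻¹' {d}) ω)) := by
    intro ω; rw [map_mul]; ring
  simp_rw [h2]
  rw [integral_const_mul, hW.covariance _ _ (s.measurableSet_fiber c)
    (volume_preimage_lt_top hs hc) (t.measurableSet_fiber d) (volume_preimage_lt_top ht hd),
    integral_indicator_const _ ((s.measurableSet_fiber c).inter (t.measurableSet_fiber d)),
    Complex.real_smul, mul_comm]

lemma inner_toLp_eq {α : Type*} [MeasurableSpace α] {μ : Measure α} {f g : α → ℂ}
    (hf : MemLp f 2 μ) (hg : MemLp g 2 μ) :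
    inner ℂ (hg.toLp g) (hf.toLp f) = ∫ a, f a * conj (g a) ∂μ := by
  rw [L2.inner_def]
  refine integral_congr_ae ?_
  filter_upwards [hf.coeFn_toLp, hg.coeFn_toLp] with a h1 h2
  rw [h1, h2, RCLike.inner_apply]

/-- The definition of the stochastic integral, read in the `L²` spaces: `(f, Z)` lies in the closure
of the graph of the integral on simple functions. -/
lemma isWienerIntegral_iff_edist (hW : IsComplexWhiteNoise P W) {f : Plane → ℂ} {Z : Ω → ℂ}
    (hf : MemLp f 2 (volume : Measure Plane)) (hZ : MemLp Z 2 P) :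
    IsWienerIntegral P W f Z ↔ ∀ ε : ℝ≥0∞, 0 < ε → ∃ (s : SimpleFunc Plane ℂ)
      (hs : MemLp s 2 (volume : Measure Plane)), edist (hf.toLp f) (hs.toLp s) < ε ∧
      edist (hZ.toLp Z) ((memLp_simpleWienerIntegral hW hs).toLp _) < ε := by
  simp only [Lp.edist_toLp_toLp]
  constructor
  · rintro ⟨-, -, h⟩ ε hε
    obtain ⟨s, hs, h1, h2⟩ := h ε hε
    exact ⟨s, hs, h1, h2⟩
  · intro h
    refine ⟨hf, hZ, fun ε hε => ?_⟩
    obtain ⟨s, hs, h1, h2⟩ := h ε hε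
    exact ⟨s, hs, h1, h2⟩

lemma IsWienerIntegral.exists_seq (hW : IsComplexWhiteNoise P W) {f : Plane → ℂ} {Z : Ω → ℂ}
    (h : IsWienerIntegral P W f Z) : ∃ (s : ℕ → SimpleFunc Plane ℂ)
      (hs : ∀ n, MemLp (s n) 2 (volume : Measure Plane)),
      Tendsto (fun n => (hs n).toLp (s n)) atTop (𝓝 (h.1.toLp f)) ∧
      Tendsto (fun n => (memLp_simpleWienerIntegral hW (hs n)).toLp _) atTop
        (𝓝 (h.2.1.toLp Z)) := by
  have h' := (isWienerIntegral_iff_edist hW h.1 h.2.1).1 h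
  choose s hs h1 h2 using fun n : ℕ => h' ((n : ℝ≥0∞) + 1)⁻¹ (by simp)
  have hlim : Tendsto (fun n : ℕ => ((n : ℝ≥0∞) + 1)⁻¹) atTop (𝓝 0) := by
    have := (tendsto_add_atTop_iff_nat 1).2 ENNReal.tendsto_inv_nat_nhds_zero
    simpa using this
  refine ⟨s, hs, ?_, ?_⟩
  · rw [tendsto_iff_edist_tendsto_0]
    exact tendsto_of_tendsto_of_tendsto_of_le_of_le tendsto_const_nhds hlim (fun _ => zero_le)
      fun n => by rw [edist_comm]; exact (h1 n).le
  · rw [tendsto_iff_edist_tendsto_0]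
    exact tendsto_of_tendsto_of_tendsto_of_le_of_le tendsto_const_nhds hlim (fun _ => zero_le)
      fun n => by rw [edist_comm]; exact (h2 n).le

lemma inner_simpleWienerIntegral (hW : IsComplexWhiteNoise P W)
    {s t : SimpleFunc Plane ℂ} (hs : MemLp s 2 (volume : Measure Plane))
    (ht : MemLp t 2 (volume : Measure Plane)) :
    inner ℂ ((memLp_simpleWienerIntegral hW hs).toLp _)
      ((memLp_simpleWienerIntegral hW ht).toLp _) = inner ℂ (hs.toLp s) (ht.toLp t) := by
  rw [inner_toLp_eq, inner_toLp_eq, integral_simpleWienerIntegral_mul_conj hW ht hs]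

/-- The Itô isometry, in polarized form. -/
lemma IsWienerIntegral.inner_toLp (hW : IsComplexWhiteNoise P W) {f g : Plane → ℂ} {Z Z' : Ω → ℂ}
    (h : IsWienerIntegral P W f Z) (h' : IsWienerIntegral P W g Z') :
    inner ℂ (h.2.1.toLp Z) (h'.2.1.toLp Z') = inner ℂ (h.1.toLp f) (h'.1.toLp g) := by
  obtain ⟨s, hs, h1, h2⟩ := h.exists_seq hW
  obtain ⟨t, ht, h3, h4⟩ := h'.exists_seq hW
  exact tendsto_nhds_unique (h2.inner h4)
    ((h1.inner h3).congr fun n => (inner_simpleWienerIntegral hW (hs n) (ht n)).symm)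

lemma edist_eq_of_inner_eq {E F : Type*} [NormedAddCommGroup E] [InnerProductSpace ℂ E]
    [NormedAddCommGroup F] [InnerProductSpace ℂ F] {a b : E} {a' b' : F}
    (h1 : inner ℂ a a = inner ℂ a' a') (h2 : inner ℂ a b = inner ℂ a' b')
    (h3 : inner ℂ b b = inner ℂ b' b') : edist a b = edist a' b' := by
  have e : ‖a - b‖ ^ 2 = ‖a' - b'‖ ^ 2 := by
    rw [@norm_sub_sq ℂ, @norm_sub_sq ℂ, h2, @norm_sq_eq_re_inner ℂ _ _ _ _ a,
      @norm_sq_eq_re_inner ℂ _ _ _ _ b, @norm_sq_eq_re_inner ℂ _ _ _ _ a',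
      @norm_sq_eq_re_inner ℂ _ _ _ _ b', h1, h3]
  rw [edist_dist, edist_dist, dist_eq_norm, dist_eq_norm,
    (sq_eq_sq₀ (norm_nonneg _) (norm_nonneg _)).1 e]

/-- By the isometry, the integrals of approximating simple functions form a Cauchy sequence in
`L²(P)`. -/
lemma exists_isWienerIntegral (hW : IsComplexWhiteNoise P W) {f : Plane → ℂ}
    (hf : MemLp f 2 (volume : Measure Plane)) : ∃ Z, IsWienerIntegral P W f Z := by
  choose s h1 hs using fun n : ℕ => hf.exists_simpleFunc_eLpNorm_sub_lt (by norm_num)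
    (ε := ((n : ℝ≥0∞) + 1)⁻¹) (by simp)
  have hlim : Tendsto (fun n : ℕ => ((n : ℝ≥0∞) + 1)⁻¹) atTop (𝓝 0) := by
    have := (tendsto_add_atTop_iff_nat 1).2 ENNReal.tendsto_inv_nat_nhds_zero
    simpa using this
  have hs1 : Tendsto (fun n => (hs n).toLp (s n)) atTop (𝓝 (hf.toLp f)) := by
    rw [tendsto_iff_edist_tendsto_0]
    refine tendsto_of_tendsto_of_tendsto_of_le_of_le tendsto_const_nhds hlim (fun _ => zero_le)
      fun n => ?_
    rw [edist_comm, Lp.edist_toLp_toLp]; exact (h1 n).le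
  have hc : CauchySeq fun n => (memLp_simpleWienerIntegral hW (hs n)).toLp _ := by
    have := EMetric.cauchySeq_iff.1 hs1.cauchySeq
    refine EMetric.cauchySeq_iff.2 fun ε hε => ?_
    obtain ⟨N, hN⟩ := this ε hε
    refine ⟨N, fun m hm n hn => ?_⟩
    rw [edist_eq_of_inner_eq (inner_simpleWienerIntegral hW (hs m) (hs m))
      (inner_simpleWienerIntegral hW (hs m) (hs n)) (inner_simpleWienerIntegral hW (hs n) (hs n))]
    exact hN m hm n hn
  obtain ⟨Z, hZ⟩ := cauchySeq_tendsto_of_complete hc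
  refine ⟨Z, (isWienerIntegral_iff_edist hW hf (Lp.memLp Z)).2 fun ε hε => ?_⟩
  have e1 := (tendsto_iff_edist_tendsto_0.1 hs1).eventually_lt_const hε
  have e2 := (tendsto_iff_edist_tendsto_0.1 hZ).eventually_lt_const hε
  obtain ⟨n, h3, h4⟩ := (e1.and e2).exists
  refine ⟨s n, hs n, by rwa [edist_comm], ?_⟩
  rw [edist_comm, Lp.toLp_coeFn]
  exact h4

lemma IsWienerIntegral.congr {f g : Plane → ℂ} {Z Z' : Ω → ℂ}
    (h : IsWienerIntegral P W f Z) (hfg : f =ᵐ[volume] g) (hZ : Z =ᵐ[P] Z') :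
    IsWienerIntegral P W g Z' := by
  refine ⟨(memLp_congr_ae hfg).1 h.1, (memLp_congr_ae hZ).1 h.2.1, fun ε hε => ?_⟩
  obtain ⟨s, hs, h1, h2⟩ := h.2.2 ε hε
  refine ⟨s, hs, ?_, ?_⟩
  · rwa [← eLpNorm_congr_ae (f := fun ξ => f ξ - s ξ)]
    filter_upwards [hfg] with ξ hξ; rw [hξ]
  · rwa [← eLpNorm_congr_ae (f := fun ω => Z ω - simpleWienerIntegral W s ω)]
    filter_upwards [hZ] with ω hω; rw [hω]

/-- A map between Hilbert spaces that preserves inner products is automatically linear. -/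
noncomputable def isometryOfInner {E F : Type*} [NormedAddCommGroup E] [InnerProductSpace ℂ E]
    [NormedAddCommGroup F] [InnerProductSpace ℂ F] (T : E → F)
    (hT : ∀ x y, inner ℂ (T x) (T y) = inner ℂ x y) : E →ₗᵢ[ℂ] F :=
  LinearMap.isometryOfInner
    { toFun := T
      map_add' := fun x y => by
        rw [← sub_eq_zero, ← inner_self_eq_zero (𝕜 := ℂ)]
        simp only [inner_sub_left, inner_sub_right, inner_add_left, inner_add_right, hT]
        ring
      map_smul' := fun c x => by
        rw [← sub_eq_zero, ← inner_self_eq_zero (𝕜 := ℂ)]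
        simp only [inner_sub_left, inner_sub_right, inner_smul_left, inner_smul_right, hT,
          RingHom.id_apply]
        ring } hT

/-- The Wiener integral as a linear isometry between `L²` spaces. -/
noncomputable def wienerIsometry (hW : IsComplexWhiteNoise P W) :
    Lp ℂ 2 (volume : Measure Plane) →ₗᵢ[ℂ] Lp ℂ 2 P :=
  isometryOfInner
    (fun f => (exists_isWienerIntegral hW (Lp.memLp f)).choose_spec.2.1.toLp _) fun f g => by
      rw [(exists_isWienerIntegral hW (Lp.memLp f)).choose_spec.inner_toLp hW
        (exists_isWienerIntegral hW (Lp.memLp g)).choose_spec, Lp.toLp_coeFn, Lp.toLp_coeFn]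

lemma IsWienerIntegral.wienerIsometry_eq (hW : IsComplexWhiteNoise P W) {f : Plane → ℂ}
    {Z : Ω → ℂ} (h : IsWienerIntegral P W f Z) :
    wienerIsometry hW (h.1.toLp f) = h.2.1.toLp Z := by
  have h' := (exists_isWienerIntegral hW (Lp.memLp (h.1.toLp f))).choose_spec
  change h'.2.1.toLp _ = _
  have e : h'.1.toLp _ = h.1.toLp f := Lp.toLp_coeFn _ _
  rw [← edist_eq_zero, edist_eq_of_inner_eq (h'.inner_toLp hW h') (h'.inner_toLp hW h)
    (h.inner_toLp hW h), e, edist_self]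

lemma isWienerIntegral_iff (hW : IsComplexWhiteNoise P W) {f : Plane → ℂ} {Z : Ω → ℂ}
    (hf : MemLp f 2 (volume : Measure Plane)) (hZ : MemLp Z 2 P) :
    IsWienerIntegral P W f Z ↔ wienerIsometry hW (hf.toLp f) = hZ.toLp Z := by
  refine ⟨fun h => h.wienerIsometry_eq hW, fun h => ?_⟩
  obtain ⟨Z', hZ'⟩ := exists_isWienerIntegral hW hf
  rw [hZ'.wienerIsometry_eq hW, MemLp.toLp_eq_toLp_iff] at h
  exact hZ'.congr (EventuallyEq.refl _ _) h

lemma IsWienerIntegral.ae_eq (hW : IsComplexWhiteNoise P W) {f : Plane → ℂ} {Z Z' : Ω → ℂ}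
    (h : IsWienerIntegral P W f Z) (h' : IsWienerIntegral P W f Z') : Z =ᵐ[P] Z' := by
  rw [← MemLp.toLp_eq_toLp_iff h.2.1 h'.2.1, ← h.wienerIsometry_eq hW, ← h'.wienerIsometry_eq hW]

lemma IsWienerIntegral.sub (hW : IsComplexWhiteNoise P W) {f g : Plane → ℂ} {Z Z' : Ω → ℂ}
    (h : IsWienerIntegral P W f Z) (h' : IsWienerIntegral P W g Z') :
    IsWienerIntegral P W (fun ξ => f ξ - g ξ) (fun ω => Z ω - Z' ω) := by
  refine (isWienerIntegral_iff hW (h.1.sub h'.1) (h.2.1.sub h'.2.1)).2 ?_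
  have e : MemLp.toLp _ (h.1.sub h'.1) = h.1.toLp f - h'.1.toLp g := rfl
  rw [e, map_sub, h.wienerIsometry_eq hW, h'.wienerIsometry_eq hW]
  rfl

lemma IsWienerIntegral.const_mul (hW : IsComplexWhiteNoise P W) {f : Plane → ℂ} {Z : Ω → ℂ}
    (h : IsWienerIntegral P W f Z) (c : ℂ) :
    IsWienerIntegral P W (fun ξ => c * f ξ) (fun ω => c * Z ω) := by
  refine (isWienerIntegral_iff hW (h.1.const_mul c) (h.2.1.const_mul c)).2 ?_
  have e : MemLp.toLp _ (h.1.const_mul c) = c • h.1.toLp f := rfl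
  rw [e, map_smul, h.wienerIsometry_eq hW]
  rfl

lemma IsWienerIntegral.sum (hW : IsComplexWhiteNoise P W) {ι : Type*} {f : ι → Plane → ℂ}
    {Z : ι → Ω → ℂ} (h : ∀ i, IsWienerIntegral P W (f i) (Z i)) (t : Finset ι) :
    IsWienerIntegral P W (fun ξ => ∑ i ∈ t, f i ξ) (fun ω => ∑ i ∈ t, Z i ω) := by
  classical
  induction t using Finset.induction_on with
  | empty =>
    refine (isWienerIntegral_iff hW (by simp) (by simp)).2 ?_
    exact map_zero _
  | insert a t ha ih =>
    have := (h a).sub hW (ih.const_mul hW (-1))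
    simpa [Finset.sum_insert ha] using this

/-- The Itô isometry. -/
lemma IsWienerIntegral.integral_mul_conj (hW : IsComplexWhiteNoise P W) {f g : Plane → ℂ}
    {Z Z' : Ω → ℂ} (h : IsWienerIntegral P W f Z) (h' : IsWienerIntegral P W g Z') :
    ∫ ω, Z ω * conj (Z' ω) ∂P = ∫ ξ, f ξ * conj (g ξ) := by
  rw [← inner_toLp_eq h.2.1 h'.2.1, ← inner_toLp_eq h.1 h'.1, h'.inner_toLp hW h]

end WienerIntegral

/-! ### Real-valued stochastic integrals and Gaussianity -/

section RealIntegral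

variable {Ω : Type u} [MeasurableSpace Ω] {P : Measure Ω} {W : Set Plane → Ω → ℂ}

/-- The simple function `ξ ↦ conj (s (-ξ))`. -/
noncomputable def conjReflect (s : SimpleFunc Plane ℂ) : SimpleFunc Plane ℂ :=
  (s.comp (fun ξ => -ξ) measurable_neg).map conj

lemma conjReflect_apply (s : SimpleFunc Plane ℂ) (ξ : Plane) :
    conjReflect s ξ = conj (s (-ξ)) := rfl

lemma eLpNorm_conj_neg {f : Plane → ℂ} (hf : AEStronglyMeasurable f (volume : Measure Plane)) :
    eLpNorm (fun ξ => conj (f (-ξ))) 2 (volume : Measure Plane) = eLpNorm f 2 volume := by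
  have h1 : eLpNorm (fun ξ => conj (f (-ξ))) 2 (volume : Measure Plane) =
      eLpNorm (f ∘ fun ξ => -ξ) 2 volume :=
    eLpNorm_congr_norm_ae (ae_of_all _ fun ξ => by simp)
  rw [h1, eLpNorm_comp_measurePreserving hf (Measure.measurePreserving_neg _)]

lemma memLp_conj_neg {f : Plane → ℂ} (hf : MemLp f 2 (volume : Measure Plane)) :
    MemLp (fun ξ => conj (f (-ξ))) 2 (volume : Measure Plane) :=
  (hf.comp_measurePreserving (Measure.measurePreserving_neg _)).star

lemma simpleWienerIntegral_conjReflect (hW : IsComplexWhiteNoise P W) {s : SimpleFunc Plane ℂ}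
    (hs : MemLp s 2 (volume : Measure Plane)) :
    ∀ᵐ ω ∂P, simpleWienerIntegral W (conjReflect s) ω = conj (simpleWienerIntegral W s ω) := by
  have hae : ∀ᵐ ω ∂P, ∀ c : s.range, (c : ℂ) ≠ 0 →
      W (-(s ⁻¹' {(c : ℂ)})) ω = conj (W (s ⁻¹' {(c : ℂ)}) ω) := by
    refine ae_all_iff.2 fun c => ?_
    by_cases hc : (c : ℂ) = 0
    · simp [hc]
    · filter_upwards [hW.hermitian _ (s.measurableSet_fiber c) (volume_preimage_lt_top hs hc)]
        with ω hω _ using hω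
  have hrange : (conjReflect s).range = s.range.map (starRingAut (R := ℂ)).toEquiv.toEmbedding := by
    ext z
    simp only [SimpleFunc.mem_range, Set.mem_range, Finset.mem_map, conjReflect_apply]
    constructor
    · rintro ⟨ξ, rfl⟩
      exact ⟨s (-ξ), ⟨-ξ, rfl⟩, rfl⟩
    · rintro ⟨_, ⟨ξ, rfl⟩, rfl⟩
      exact ⟨-ξ, by rw [neg_neg]; rfl⟩
  filter_upwards [hae] with ω hω
  simp only [simpleWienerIntegral, map_sum, map_mul]
  rw [hrange, Finset.sum_map]
  refine Finset.sum_congr rfl fun c hc => ?_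
  change conj c * W (conjReflect s ⁻¹' {conj c}) ω = _
  have hpre : conjReflect s ⁻¹' {conj c} = -(s ⁻¹' {c}) := by
    ext ξ
    simp [conjReflect_apply, (starRingEnd ℂ).injective.eq_iff]
  by_cases h0 : c = 0
  · simp [h0]
  rw [hpre, hω ⟨c, hc⟩ h0]

/-- Complex conjugation of a Wiener integral corresponds to `f ↦ conj (f (-·))`: this is where the
Hermitian symmetry of the noise enters. -/
lemma IsWienerIntegral.conj_neg (hW : IsComplexWhiteNoise P W) {f : Plane → ℂ} {Z : Ω → ℂ}
    (h : IsWienerIntegral P W f Z) :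
    IsWienerIntegral P W (fun ξ => conj (f (-ξ))) (fun ω => conj (Z ω)) := by
  refine ⟨memLp_conj_neg h.1, h.2.1.star, fun ε hε => ?_⟩
  obtain ⟨s, hs, h1, h2⟩ := h.2.2 ε hε
  refine ⟨conjReflect s, memLp_conj_neg hs, ?_, ?_⟩
  · have := eLpNorm_conj_neg (h.1.sub hs).1
    simp only [Pi.sub_apply, map_sub] at this
    simp only [conjReflect_apply]
    rw [this]; exact h1
  · rwa [eLpNorm_congr_norm_ae (g := fun ω => Z ω - simpleWienerIntegral W s ω)]
    filter_upwards [simpleWienerIntegral_conjReflect hW hs] with ω hω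
    rw [hω, ← map_sub, RCLike.norm_conj]

/-- The stochastic integral of a function with Hermitian symmetry has a real version. -/
lemma exists_real_isWienerIntegral (hW : IsComplexWhiteNoise P W) {f : Plane → ℂ}
    (hf : MemLp f 2 (volume : Measure Plane)) (hsymm : ∀ ξ, conj (f (-ξ)) = f ξ) :
    ∃ R : Ω → ℝ, IsWienerIntegral P W f fun ω => (R ω : ℂ) := by
  obtain ⟨Z, hZ⟩ := exists_isWienerIntegral hW hf
  have h2 := hZ.conj_neg hW
  simp_rw [hsymm] at h2
  refine ⟨fun ω => (Z ω).re, hZ.congr (EventuallyEq.refl _ _) ?_⟩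
  filter_upwards [hZ.ae_eq hW h2] with ω hω
  exact (Complex.conj_eq_iff_re.1 hω.symm).symm

lemma MemLp.of_ofReal {R : Ω → ℝ} {p : ℝ≥0∞} (h : MemLp (fun ω => (R ω : ℂ)) p P) :
    MemLp R p P := by simpa using h.re

/-- A limit in `L²` of centred Gaussian variables is centred Gaussian: the characteristic functions
`exp (-t² σ² / 2)` pass to the limit together with the variances. -/
lemma hasGaussianLaw_of_tendsto [IsProbabilityMeasure P] {U : ℕ → Ω → ℝ} {R : Ω → ℝ}
    (hU : ∀ n, HasGaussianLaw (U n) P) (hU0 : ∀ n, ∫ ω, U n ω ∂P = 0) (hR : MemLp R 2 P)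
    (hlim : Tendsto (fun n => eLpNorm (fun ω => R ω - U n ω) 2 P) atTop (𝓝 0)) :
    HasGaussianLaw R P ∧ ∫ ω, R ω ∂P = 0 := by
  have hU2 : ∀ n, MemLp (U n) 2 P := fun n => (hU n).memLp_two
  have hLp : Tendsto (fun n => (hU2 n).toLp (U n)) atTop (𝓝 (hR.toLp R)) := by
    rw [tendsto_iff_edist_tendsto_0]
    refine hlim.congr fun n => ?_
    rw [edist_comm, Lp.edist_toLp_toLp]; rfl
  have hsq : Tendsto (fun n => ∫ ω, U n ω ^ 2 ∂P) atTop (𝓝 (∫ ω, R ω ^ 2 ∂P)) := by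
    have key : ∀ {V : Ω → ℝ} (hV : MemLp V 2 P),
        inner ℝ (hV.toLp V) (hV.toLp V) = ∫ ω, V ω ^ 2 ∂P := by
      intro V hV
      rw [L2.inner_def]
      refine integral_congr_ae ?_
      filter_upwards [hV.coeFn_toLp] with ω hω
      rw [hω]; simp [sq]
    have := hLp.inner (𝕜 := ℝ) hLp
    rw [key] at this
    exact this.congr fun n => key _
  have hL1 : Tendsto (fun n => ∫ ω, |R ω - U n ω| ∂P) atTop (𝓝 0) := by
    have h1 : ∀ n, ∫ ω, |R ω - U n ω| ∂P ≤ (eLpNorm (fun ω => R ω - U n ω) 2 P).toReal := by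
      intro n
      have h2 : MemLp (fun ω => R ω - U n ω) 2 P := hR.sub (hU2 n)
      have h3 : ∫ ω, |R ω - U n ω| ∂P = (eLpNorm (fun ω => R ω - U n ω) 1 P).toReal := by
        rw [eLpNorm_one_eq_lintegral_enorm, ← integral_norm_eq_lintegral_enorm h2.1]
        rfl
      rw [h3]
      exact ENNReal.toReal_mono h2.2.ne
        (eLpNorm_le_eLpNorm_of_exponent_le (by norm_num) h2.1)
    have h2 := (ENNReal.tendsto_toReal ENNReal.zero_ne_top).comp hlim
    exact squeeze_zero (fun n => integral_nonneg fun ω => abs_nonneg _) h1 h2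
  have hRi : Integrable R P := hR.integrable (by norm_num)
  have hUi : ∀ n, Integrable (U n) P := fun n => (hU2 n).integrable (by norm_num)
  have hmean : ∫ ω, R ω ∂P = 0 := by
    refine abs_eq_zero.1 (le_antisymm ?_ (abs_nonneg _))
    refine ge_of_tendsto' hL1 fun n => ?_
    have : ∫ ω, R ω ∂P = ∫ ω, (R ω - U n ω) ∂P := by
      rw [integral_sub hRi (hUi n), hU0, sub_zero]
    rw [this]
    exact abs_integral_le_integral_abs
  refine ⟨?_, hmean⟩
  rw [hasGaussianLaw_iff_charFun_map_eq hR.1.aemeasurable]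
  intro t
  have hint : ∀ {V : Ω → ℝ}, AEMeasurable V P →
      Integrable (fun ω => Complex.exp ((t * V ω : ℝ) * Complex.I)) P := by
    intro V hV
    refine Integrable.of_bound (C := 1) (by fun_prop) (ae_of_all _ fun ω => ?_)
    rw [Complex.norm_exp_ofReal_mul_I]
  have hcf : ∀ {V : Ω → ℝ}, AEMeasurable V P →
      charFun (P.map V) t = ∫ ω, Complex.exp ((t * V ω : ℝ) * Complex.I) ∂P := by
    intro V hV
    rw [charFun_apply_real, integral_map hV (by fun_prop)]
    push_cast
    rfl
  have hvar : ∀ {V : Ω → ℝ}, MemLp V 2 P → ∫ ω, V ω ∂P = 0 →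
      Complex.exp (((P[fun ω => inner ℝ t (V ω)] : ℝ) : ℂ) * Complex.I -
        (Var[fun ω => inner ℝ t (V ω); P] : ℝ) / 2) =
      Complex.exp (((-(t ^ 2 * ∫ ω, V ω ^ 2 ∂P) / 2 : ℝ) : ℂ)) := by
    intro V hV h0
    have e1 : (fun ω => inner ℝ t (V ω)) = fun ω => t * V ω := by
      ext ω; simp [mul_comm]
    rw [e1, variance_const_mul, variance_of_integral_eq_zero hV.1.aemeasurable h0,
      integral_const_mul, h0]
    congr 1
    push_cast
    simp
    ring
  rw [hvar hR hmean, hcf hR.1.aemeasurable]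
  have t1 : Tendsto (fun n => charFun (P.map (U n)) t) atTop
      (𝓝 (Complex.exp (((-(t ^ 2 * ∫ ω, R ω ^ 2 ∂P) / 2 : ℝ) : ℂ)))) := by
    have : ∀ n, charFun (P.map (U n)) t =
        Complex.exp (((-(t ^ 2 * ∫ ω, U n ω ^ 2 ∂P) / 2 : ℝ) : ℂ)) := by
      intro n
      rw [(hU n).charFun_map_eq, hvar (hU2 n) (hU0 n)]
    simp_rw [this]
    exact (Complex.continuous_exp.tendsto _).comp
      ((Complex.continuous_ofReal.tendsto _).comp (((hsq.const_mul _).neg).div_const _))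
  refine tendsto_nhds_unique ?_ t1
  rw [tendsto_iff_norm_sub_tendsto_zero]
  refine squeeze_zero (fun n => norm_nonneg _) (fun n => ?_)
    (by simpa using hL1.const_mul |t|)
  rw [hcf (hU2 n).1.aemeasurable, ← integral_sub (hint (hU2 n).1.aemeasurable)
    (hint hR.1.aemeasurable), ← integral_const_mul]
  refine norm_integral_le_of_norm_le ((hRi.sub (hUi n)).abs.const_mul _) (ae_of_all _ fun ω => ?_)
  have h1 : Complex.exp ((t * U n ω : ℝ) * Complex.I) - Complex.exp ((t * R ω : ℝ) * Complex.I) =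
      Complex.exp ((t * R ω : ℝ) * Complex.I) *
        (Complex.exp (Complex.I * ((t * U n ω - t * R ω : ℝ) : ℂ)) - 1) := by
    rw [mul_sub, ← Complex.exp_add, mul_one]
    congr 2
    push_cast; ring
  rw [h1, norm_mul, Complex.norm_exp_ofReal_mul_I, one_mul]
  refine (Real.norm_exp_I_mul_ofReal_sub_one_le).trans ?_
  rw [← mul_sub, norm_mul, Real.norm_eq_abs, Real.norm_eq_abs, abs_sub_comm]

lemma hasGaussianLaw_re_simpleWienerIntegral (hW : IsComplexWhiteNoise P W)
    {s : SimpleFunc Plane ℂ} (hs : MemLp s 2 (volume : Measure Plane)) :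
    HasGaussianLaw (fun ω => (simpleWienerIntegral W s ω).re) P := by
  classical
  let D : Finset ℂ := s.range.filter (· ≠ 0)
  let A : D → {A : Set Plane // MeasurableSet A ∧ volume A < ∞} := fun c =>
    ⟨s ⁻¹' {c.1}, s.measurableSet_fiber _, volume_preimage_lt_top hs (Finset.mem_filter.1 c.2).2⟩
  let J : Finset {A : Set Plane // MeasurableSet A ∧ volume A < ∞} := Finset.univ.image A
  let L : (J → ℂ) →L[ℝ] ℝ := ∑ c : D, (Complex.reCLM.comp
    ((ContinuousLinearMap.mul ℝ ℂ c.1).comp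
      (ContinuousLinearMap.proj (R := ℝ) (φ := fun _ : J => ℂ) ⟨A c, by simp [J]⟩)))
  refine ((hW.gaussian.hasGaussianLaw J).map_fun L).congr (ae_of_all _ fun ω => ?_)
  have h1 : simpleWienerIntegral W s ω = ∑ c : D, c.1 * W (s ⁻¹' {c.1}) ω := by
    rw [Finset.sum_coe_sort D (fun c => c * W (s ⁻¹' {c}) ω), simpleWienerIntegral,
      Finset.sum_filter_of_ne]
    intro c _ h h0
    simp [h0] at h
  beta_reduce
  rw [h1, Complex.re_sum]
  simp only [L, _root_.sum_apply]
  rfl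

lemma integral_simpleWienerIntegral (hW : IsComplexWhiteNoise P W)
    [IsProbabilityMeasure P] {s : SimpleFunc Plane ℂ} (hs : MemLp s 2 (volume : Measure Plane)) :
    ∫ ω, simpleWienerIntegral W s ω ∂P = 0 := by
  simp only [simpleWienerIntegral]
  rw [integral_finsetSum _ fun c _ => (memLp_mul_whiteNoise hW hs c).integrable (by norm_num)]
  refine Finset.sum_eq_zero fun c _ => ?_
  by_cases hc : c = 0
  · simp [hc]
  rw [integral_const_mul, hW.centered _ (s.measurableSet_fiber c) (volume_preimage_lt_top hs hc),
    mul_zero]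

lemma IsWienerIntegral.hasGaussianLaw [IsProbabilityMeasure P] (hW : IsComplexWhiteNoise P W)
    {f : Plane → ℂ} {R : Ω → ℝ} (h : IsWienerIntegral P W f fun ω => (R ω : ℂ)) :
    HasGaussianLaw R P ∧ ∫ ω, R ω ∂P = 0 := by
  obtain ⟨s, hs, -, h2⟩ := h.exists_seq hW
  refine hasGaussianLaw_of_tendsto (U := fun n ω => (simpleWienerIntegral W (s n) ω).re)
    (fun n => hasGaussianLaw_re_simpleWienerIntegral hW (hs n)) (fun n => ?_)
    (MemLp.of_ofReal h.2.1) ?_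
  · have := integral_re (𝕜 := ℂ)
      ((memLp_simpleWienerIntegral hW (hs n)).integrable (by norm_num))
    rw [integral_simpleWienerIntegral hW (hs n)] at this
    simpa using this
  · refine tendsto_of_tendsto_of_tendsto_of_le_of_le tendsto_const_nhds
      (tendsto_iff_edist_tendsto_0.1 h2) (fun _ => zero_le) fun n => ?_
    rw [edist_comm, Lp.edist_toLp_toLp]
    refine eLpNorm_mono fun ω => ?_
    have : R ω - (simpleWienerIntegral W (s n) ω).re =
      ((R ω : ℂ) - simpleWienerIntegral W (s n) ω).re := by simp
    rw [this]
    exact Complex.abs_re_le_norm _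

/-- Real-valued Wiener integrals are jointly Gaussian: every linear combination of them is again
one. -/
lemma isGaussianProcess_of_isWienerIntegral [IsProbabilityMeasure P]
    (hW : IsComplexWhiteNoise P W) {T : Type*} {f : T → Plane → ℂ} {R : T → Ω → ℝ}
    (h : ∀ i, IsWienerIntegral P W (f i) fun ω => (R i ω : ℂ)) : IsGaussianProcess R P where
  hasGaussianLaw I := by
    have hm : AEMeasurable (fun ω => I.restrict (R · ω)) P :=
      aemeasurable_pi_lambda _ fun i => (MemLp.of_ofReal (h i).2.1).1.aemeasurable
    refine ⟨isGaussian_of_isGaussian_map fun L => ?_⟩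
    rw [AEMeasurable.map_map_of_aemeasurable (by fun_prop) hm]
    classical
    have h1 := IsWienerIntegral.sum hW (fun i : I =>
      (h i).const_mul hW ((L (Pi.single i 1) : ℝ) : ℂ)) Finset.univ
    have h2 : (L ∘ fun ω => I.restrict (R · ω)) =
        fun ω => ∑ i : I, L (Pi.single i 1) * R i ω := by
      ext ω
      simp only [Function.comp]
      conv_lhs => rw [← ContinuousLinearMap.coe_coe, LinearMap.pi_apply_eq_sum_univ]
      refine Finset.sum_congr rfl fun i _ => ?_
      rw [smul_eq_mul, mul_comm]
      have : (fun j => if i = j then (1 : ℝ) else 0) = Pi.single i 1 := by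
        ext j; simp [Pi.single_apply, eq_comm]
      rw [this]
      rfl
    rw [h2]
    have h3 : IsWienerIntegral P W (fun ξ => ∑ i : I, ((L (Pi.single i 1) : ℝ) : ℂ) * f i ξ)
        fun ω => ((∑ i : I, L (Pi.single i 1) * R i ω : ℝ) : ℂ) := by
      convert h1 using 2 with ω
      push_cast; rfl
    exact (h3.hasGaussianLaw hW).1.isGaussian_map

/-- The covariance of real Wiener integrals. -/
lemma IsWienerIntegral.integral_mul (hW : IsComplexWhiteNoise P W) {f g : Plane → ℂ}
    {R R' : Ω → ℝ} (h : IsWienerIntegral P W f fun ω => (R ω : ℂ))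
    (h' : IsWienerIntegral P W g fun ω => (R' ω : ℂ)) :
    ((∫ ω, R ω * R' ω ∂P : ℝ) : ℂ) = ∫ ξ, f ξ * conj (g ξ) := by
  rw [← h.integral_mul_conj hW h', ← integral_complex_ofReal]
  simp

/-- The variance of a real Wiener integral. -/
lemma IsWienerIntegral.integral_sq (hW : IsComplexWhiteNoise P W) {f : Plane → ℂ}
    {R : Ω → ℝ} (h : IsWienerIntegral P W f fun ω => (R ω : ℂ)) :
    ∫ ω, R ω ^ 2 ∂P = ∫ ξ, ‖f ξ‖ ^ 2 := by
  have h1 := h.integral_mul hW h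
  simp_rw [Complex.mul_conj'] at h1
  have h2 : ∫ ξ, ((‖f ξ‖ : ℂ)) ^ 2 = ((∫ ξ, ‖f ξ‖ ^ 2 : ℝ) : ℂ) := by
    rw [← integral_complex_ofReal]; simp
  rw [h2] at h1
  simpa [sq] using Complex.ofReal_injective h1

end RealIntegral

/-! ### Laws on the path space -/

section PathSpace

/-- The Borel sigma-algebra of the path space is generated by the evaluations. -/
lemma measurableSpace_paths_eq :
    instMeasurableSpacePaths = ⨆ x : Plane, MeasurableSpace.comap (fun φ : C(Plane, ℝ) => φ x)
      inferInstance := by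
  apply le_antisymm
  · refine (borel_eq_generateFrom_of_subbasis
      (ContinuousMap.compactOpen_eq (X := Plane) (Y := ℝ))).trans_le ?_
    refine MeasurableSpace.generateFrom_le ?_
    rintro _ ⟨K, hK, U, hU, rfl⟩
    replace hK : IsCompact K := hK
    replace hU : IsOpen U := hU
    beta_reduce
    obtain ⟨D, hDc, hDd⟩ := TopologicalSpace.exists_countable_dense K
    rcases K.eq_empty_or_nonempty with rfl | hne
    · convert MeasurableSet.univ
      ext φ
      simp [Set.mapsTo_empty]
    rcases Set.eq_empty_or_nonempty Uᶜ with hUe | hUne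
    · rw [Set.compl_empty_iff] at hUe
      subst hUe
      convert MeasurableSet.univ
      ext φ
      simp
    -- By compactness, `φ` maps `K` into `U` iff its distance to the complement of `U` is bounded
    -- below on `K`, which can be tested on a countable dense subset.
    have hset : {φ : C(Plane, ℝ) | Set.MapsTo φ K U} =
        ⋃ n : ℕ, ⋂ d ∈ D, (fun φ : C(Plane, ℝ) => φ (d : Plane)) ⁻¹'
          {y | ((n : ℝ) + 1)⁻¹ ≤ Metric.infDist y Uᶜ} := by
      ext φ
      simp only [Set.mem_iUnion, Set.mem_iInter, Set.mem_preimage]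
      constructor
      · intro hφ
        obtain ⟨x, hx, hmin⟩ := hK.exists_isMinOn hne
          ((Metric.continuous_infDist_pt Uᶜ).comp φ.continuous).continuousOn
        have hpos : 0 < Metric.infDist (φ x) Uᶜ :=
          (hU.isClosed_compl.notMem_iff_infDist_pos hUne).1 (fun h => h (hφ hx))
        obtain ⟨n, hn⟩ := exists_nat_one_div_lt hpos
        refine ⟨n, fun d _ => ?_⟩
        rw [one_div] at hn
        exact hn.le.trans (hmin d.2)
      · rintro ⟨n, hn⟩ x hx
        have hcl : IsClosed {d : K | ((n : ℝ) + 1)⁻¹ ≤ Metric.infDist (φ d) Uᶜ} :=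
          isClosed_le continuous_const
            ((Metric.continuous_infDist_pt Uᶜ).comp (φ.continuous.comp continuous_subtype_val))
        have hall : ∀ d : K, ((n : ℝ) + 1)⁻¹ ≤ Metric.infDist (φ d) Uᶜ := fun d =>
          hcl.closure_subset_iff.2 (fun d hd => hn d hd) (hDd d)
        have hpos : 0 < Metric.infDist (φ x) Uᶜ :=
          lt_of_lt_of_le (by positivity) (hall ⟨x, hx⟩)
        exact Set.notMem_compl_iff.1
          ((hU.isClosed_compl.notMem_iff_infDist_pos hUne).2 hpos)
    rw [hset]
    refine MeasurableSet.iUnion fun n => MeasurableSet.biInter hDc fun d _ => ?_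
    refine (le_iSup (fun x : Plane => MeasurableSpace.comap (fun φ : C(Plane, ℝ) => φ x)
      inferInstance) (d : Plane)) _ ⟨_, ?_, rfl⟩
    exact measurableSet_le measurable_const (Metric.continuous_infDist_pt _).measurable
  · refine iSup_le fun x => ?_
    rw [← measurable_iff_comap_le]
    exact (continuous_eval_const x).measurable

lemma measurable_path_eval (x : Plane) : Measurable fun φ : C(Plane, ℝ) => φ x :=
  (continuous_eval_const x).measurable

lemma measurable_paths_iff {α : Type*} [MeasurableSpace α] {X : α → C(Plane, ℝ)} :
    Measurable X ↔ ∀ x, Measurable fun a => X a x := by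
  refine ⟨fun h x => (measurable_path_eval x).comp h, fun h => ?_⟩
  rw [measurable_iff_comap_le, measurableSpace_paths_eq, MeasurableSpace.comap_iSup]
  refine iSup_le fun x => ?_
  rw [MeasurableSpace.comap_comp, ← measurable_iff_comap_le]
  exact h x

/-- A random continuous function all of whose evaluations are a.e.-measurable is itself
a.e.-measurable: outside a null set, it is measurable on a countable dense set of points. -/
lemma aemeasurable_paths {α : Type*} [MeasurableSpace α] {μ : Measure α} {X : α → C(Plane, ℝ)}
    (h : ∀ x, AEMeasurable (fun a => X a x) μ) : AEMeasurable X μ := by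
  classical
  obtain ⟨D, hDc, hDd⟩ := TopologicalSpace.exists_countable_dense Plane
  have : Countable D := hDc.to_subtype
  have hae : ∀ᵐ a ∂μ, ∀ d : D, X a d = (h d).mk _ a := ae_all_iff.2 fun d => (h d).ae_eq_mk
  let N : Set α := toMeasurable μ {a | ¬ ∀ d : D, X a d = (h d).mk _ a}
  have hN : MeasurableSet N := measurableSet_toMeasurable _ _
  have hN0 : μ N = 0 := by rw [measure_toMeasurable]; exact hae
  have hXN : ∀ a ∉ N, ∀ d : D, X a d = (h d).mk _ a := fun a ha => by
    by_contra hcon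
    exact ha (subset_toMeasurable _ _ hcon)
  refine ⟨fun a => if a ∈ N then 0 else X a, measurable_paths_iff.2 fun x => ?_, ?_⟩
  · have hD : ∀ d : D, Measurable fun a => (if a ∈ N then (0 : C(Plane, ℝ)) else X a) d := by
      intro d
      have : (fun a => (if a ∈ N then (0 : C(Plane, ℝ)) else X a) d) =
          fun a => if a ∈ N then 0 else (h d).mk _ a := by
        ext a
        split_ifs with ha
        · rfl
        · exact hXN a ha d
      rw [this]
      exact Measurable.ite hN measurable_const (h d).measurable_mk
    obtain ⟨u, hu, hux⟩ := mem_closure_iff_seq_limit.1 (hDd x)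
    refine measurable_of_tendsto_metrizable (fun n => hD ⟨u n, hu n⟩)
      (tendsto_pi_nhds.2 fun a => ?_)
    exact ((map_continuous _).tendsto x).comp hux
  · have : ∀ᵐ a ∂μ, a ∉ N := measure_eq_zero_iff_ae_notMem.1 hN0
    filter_upwards [this] with a ha
    simp [ha]

variable {Ω : Type u} [MeasurableSpace Ω] {P : Measure Ω}

/-- The law of a random continuous function is determined by its finite dimensional
distributions. -/
lemma map_paths_eq_of_fddEq [IsProbabilityMeasure P] {U V : Ω → C(Plane, ℝ)}
    (hU : AEMeasurable U P) (hV : AEMeasurable V P)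
    (h : FddEq P (fun x ω => U ω x) (fun x ω => V ω x)) : P.map U = P.map V := by
  have hev : Measurable fun (φ : C(Plane, ℝ)) (x : Plane) => φ x :=
    measurable_pi_lambda _ measurable_path_eval
  have hcomap : instMeasurableSpacePaths =
      MeasurableSpace.comap (fun (φ : C(Plane, ℝ)) (x : Plane) => φ x) MeasurableSpace.pi := by
    rw [measurableSpace_paths_eq, MeasurableSpace.pi, MeasurableSpace.comap_iSup]
    simp_rw [MeasurableSpace.comap_comp]
    rfl
  have key : P.map (fun ω x => U ω x) = P.map (fun ω x => V ω x) := by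
    refine (map_eq_iff_forall_finset_map_restrict_eq (X := fun x ω => U ω x)
      (Y := fun x ω => V ω x) (hev.comp_aemeasurable hU) (hev.comp_aemeasurable hV)).2 fun I => ?_
    have h1 := h I.card (fun i => (I.equivFin.symm i : Plane))
    have h2 := h1.comp (u := fun v (x : I) => v (I.equivFin x))
      (measurable_pi_lambda _ fun x => measurable_pi_apply _)
    have h3 := h2.map_eq
    simpa [Function.comp_def, Finset.restrict_def] using h3
  have hmap : ∀ {T : Ω → C(Plane, ℝ)}, AEMeasurable T P → P.map (fun ω x => T ω x) =
      (P.map T).map (fun (φ : C(Plane, ℝ)) (x : Plane) => φ x) := fun hT =>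
    (AEMeasurable.map_map_of_aemeasurable hev.aemeasurable hT).symm
  rw [hmap hU, hmap hV] at key
  ext s hs
  rw [hcomap] at hs
  obtain ⟨t, ht, rfl⟩ := hs
  rw [← Measure.map_apply hev ht, ← Measure.map_apply hev ht, key]

/-- Centred Gaussian vectors with the same covariances have the same law. -/
lemma map_eq_of_gaussian {ι : Type*} [Fintype ι] {A B : Ω → ι → ℝ}
    (hA : HasGaussianLaw A P) (hB : HasGaussianLaw B P) (hA0 : ∀ i, ∫ ω, A ω i ∂P = 0)
    (hB0 : ∀ i, ∫ ω, B ω i ∂P = 0)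
    (hcov : ∀ i j, ∫ ω, A ω i * A ω j ∂P = ∫ ω, B ω i * B ω j ∂P) : P.map A = P.map B := by
  classical
  have := hA.isProbabilityMeasure
  have := hA.isGaussian_map
  have := hB.isGaussian_map
  refine Measure.ext_of_charFunDual (funext fun L => ?_)
  have hL : ∀ v : ι → ℝ, L v = ∑ i, L (Pi.single i 1) * v i := by
    intro v
    conv_lhs => rw [← ContinuousLinearMap.coe_coe, LinearMap.pi_apply_eq_sum_univ]
    refine Finset.sum_congr rfl fun i _ => ?_
    have : (fun j => if i = j then (1 : ℝ) else 0) = Pi.single i 1 := by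
      ext j; simp [Pi.single_apply, eq_comm]
    rw [smul_eq_mul, mul_comm, this]
    rfl
  have hmean : ∀ {A : Ω → ι → ℝ}, HasGaussianLaw A P → (∀ i, ∫ ω, A ω i ∂P = 0) →
      ∫ ω, L (A ω) ∂P = 0 := by
    intro A hA h0
    rw [integral_congr_ae (ae_of_all _ fun ω => hL (A ω)),
      integral_finsetSum _ fun i _ => (hA.eval i).integrable.const_mul _]
    exact Finset.sum_eq_zero fun i _ => by rw [integral_const_mul, h0, mul_zero]
  have hvar : ∀ {A : Ω → ι → ℝ}, HasGaussianLaw A P → (∀ i, ∫ ω, A ω i ∂P = 0) →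
      Var[fun ω => L (A ω); P] =
        ∑ i, ∑ j, L (Pi.single i 1) * L (Pi.single j 1) * ∫ ω, A ω i * A ω j ∂P := by
    intro A hA h0
    rw [variance_of_integral_eq_zero (hA.map_fun L).aemeasurable (hmean hA h0)]
    have hint : ∀ i j, Integrable (fun ω => L (Pi.single i 1) * L (Pi.single j 1) *
        (A ω i * A ω j)) P := fun i j =>
      ((hA.eval i).memLp_two.integrable_mul (hA.eval j).memLp_two).const_mul _
    have : ∀ ω, L (A ω) ^ 2 = ∑ i, ∑ j, L (Pi.single i 1) * L (Pi.single j 1) *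
        (A ω i * A ω j) := by
      intro ω
      rw [hL, sq, Finset.sum_mul_sum]
      refine Finset.sum_congr rfl fun i _ => Finset.sum_congr rfl fun j _ => by ring
    simp_rw [this]
    rw [integral_finsetSum _ fun i _ => integrable_finsetSum _ fun j _ => hint i j]
    refine Finset.sum_congr rfl fun i _ => ?_
    rw [integral_finsetSum _ fun j _ => hint i j]
    exact Finset.sum_congr rfl fun j _ => integral_const_mul _ _
  rw [hA.charFunDual_map_eq_fun, hB.charFunDual_map_eq_fun, hmean hA hA0, hmean hB hB0,
    hvar hA hA0, hvar hB hB0]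
  simp_rw [hcov]

lemma IsGaussianProcess.hasGaussianLaw_vector {T : Type*} {U : T → Ω → ℝ}
    (hU : IsGaussianProcess U P) {ι : Type*} [Fintype ι] (x : ι → T) :
    HasGaussianLaw (fun ω i => U (x i) ω) P := by
  classical
  let J : Finset T := Finset.univ.image x
  let L : (J → ℝ) →L[ℝ] (ι → ℝ) := ContinuousLinearMap.pi fun i =>
    ContinuousLinearMap.proj (R := ℝ) (φ := fun _ : J => ℝ) ⟨x i, by simp [J]⟩
  exact (hU.hasGaussianLaw J).map_fun L

/-- Centred Gaussian fields with the same covariance have the same finite dimensional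
distributions. -/
lemma fddEq_of_gaussian {U V : Plane → Ω → ℝ} (hU : IsGaussianProcess U P)
    (hV : IsGaussianProcess V P) (hU0 : ∀ x, ∫ ω, U x ω ∂P = 0) (hV0 : ∀ x, ∫ ω, V x ω ∂P = 0)
    (hcov : ∀ x y, ∫ ω, U x ω * U y ω ∂P = ∫ ω, V x ω * V y ω ∂P) : FddEq P U V := by
  intro n x
  have hA := IsGaussianProcess.hasGaussianLaw_vector hU x
  have hB := IsGaussianProcess.hasGaussianLaw_vector hV x
  exact ⟨hA.aemeasurable, hB.aemeasurable, map_eq_of_gaussian hA hB (fun i => hU0 _)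
    (fun i => hV0 _) fun i j => hcov _ _⟩

end PathSpace

/-! ### Chaining along dyadic grids -/

section Chaining

/-- The point `k / 2 ^ n` of the dyadic grid of mesh `2 ^ (-n)`. -/
noncomputable def gridPoint (n : ℕ) (k : Fin 2 → ℤ) : Plane :=
  WithLp.toLp 2 fun i => (k i : ℝ) / 2 ^ n

/-- The indices of the points of the grid of mesh `2 ^ (-n)` in the square `[-N, N]²`. -/
noncomputable def gridBox (N n : ℕ) : Finset (Fin 2 → ℤ) :=
  Fintype.piFinset fun _ => Finset.Icc (-(N * 2 ^ n : ℤ)) (N * 2 ^ n)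

/-- The steps from a point of the grid to itself and to its eight neighbours. -/
noncomputable def gridSteps : Finset (Fin 2 → ℤ) := Fintype.piFinset fun _ => Finset.Icc (-1) 1

/-- The index of the lower left corner of the cell of mesh `2 ^ (-n)` containing `x`. -/
noncomputable def gridFloor (n : ℕ) (x : Plane) : Fin 2 → ℤ := fun i => ⌊2 ^ n * x i⌋

/-- The increments of `v` between neighbours of the grid of mesh `2 ^ (-n)` starting in `[-N, N]²`
decay geometrically in `n`. -/
def GridBound (v : Plane → ℝ) (N : ℕ) (τ r : ℝ) : Prop :=
  ∀ n, ∀ k ∈ gridBox N n, ∀ e ∈ gridSteps,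
    |v (gridPoint n k) - v (gridPoint n (k + e))| ≤ τ * r ^ n

/-- The open square `(-N, N)²`. -/
def openSquare (N : ℕ) : Set Plane := {x | ∀ i, |x i| < N}

lemma gridPoint_apply (n : ℕ) (k : Fin 2 → ℤ) (i : Fin 2) :
    gridPoint n k i = (k i : ℝ) / 2 ^ n := rfl

lemma gridFloor_mem {N : ℕ} {x : Plane} (hx : x ∈ openSquare N) (n : ℕ) :
    gridFloor n x ∈ gridBox N n := by
  refine Fintype.mem_piFinset.2 fun i => Finset.mem_Icc.2 ?_
  have hx' := abs_lt.1 (hx i)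
  have h2 : (0 : ℝ) < 2 ^ n := by positivity
  constructor
  · refine Int.le_floor.2 ?_
    push_cast
    nlinarith
  · refine Int.cast_le.1 ((Int.floor_le (2 ^ n * x i)).trans ?_ : (⌊2 ^ n * x i⌋ : ℝ) ≤ _)
    push_cast
    nlinarith

/-- The corner of the cell of mesh `2 ^ (-n)` containing `x` is, in the next grid, equal or adjacent
to the corner of the subcell containing `x`. -/
lemma gridPoint_parent (n : ℕ) (x : Plane) : ∃ e ∈ gridSteps,
    gridPoint n (gridFloor n x) = gridPoint (n + 1) (gridFloor (n + 1) x + e) := by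
  refine ⟨fun i => 2 * gridFloor n x i - gridFloor (n + 1) x i,
    Fintype.mem_piFinset.2 fun i => Finset.mem_Icc.2 ?_, ?_⟩
  · simp only [gridFloor]
    have h1 := Int.floor_le (2 ^ n * x i)
    have h2 := Int.lt_floor_add_one (2 ^ n * x i)
    have h3 := Int.floor_le (2 ^ (n + 1) * x i)
    have h4 := Int.lt_floor_add_one (2 ^ (n + 1) * x i)
    rw [pow_succ] at h3 h4 ⊢
    have e1 : (⌊2 ^ n * 2 * x i⌋ : ℝ) < 2 * ⌊2 ^ n * x i⌋ + 2 := by linarith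
    have e2 : (2 * ⌊2 ^ n * x i⌋ : ℝ) < ⌊2 ^ n * 2 * x i⌋ + 1 := by linarith
    have e3 : ⌊2 ^ n * 2 * x i⌋ < 2 * ⌊2 ^ n * x i⌋ + 2 := by exact_mod_cast e1
    have e4 : 2 * ⌊2 ^ n * x i⌋ < ⌊2 ^ n * 2 * x i⌋ + 1 := by exact_mod_cast e2
    omega
  · ext i
    simp only [gridPoint_apply, Pi.add_apply]
    push_cast
    rw [pow_succ]
    field_simp
    ring

lemma floor_sub_floor_mem_Icc {a b : ℝ} (h : |a - b| < 1) : -1 ≤ ⌊b⌋ - ⌊a⌋ ∧ ⌊b⌋ - ⌊a⌋ ≤ 1 := by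
  have h6 := abs_lt.1 h
  have h1 := Int.floor_le a
  have h2 := Int.lt_floor_add_one a
  have h3 := Int.floor_le b
  have h4 := Int.lt_floor_add_one b
  have e1 : (⌊a⌋ : ℝ) < ⌊b⌋ + 2 := by linarith
  have e2 : (⌊b⌋ : ℝ) < ⌊a⌋ + 2 := by linarith
  have e3 : ⌊a⌋ < ⌊b⌋ + 2 := by exact_mod_cast e1
  have e4 : ⌊b⌋ < ⌊a⌋ + 2 := by exact_mod_cast e2
  omega

lemma gridFloor_neighbour {n : ℕ} {x y : Plane} (hxy : ‖x - y‖ < (2 ^ n)⁻¹) :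
    ∃ e ∈ gridSteps, gridFloor n y = gridFloor n x + e := by
  refine ⟨fun i => gridFloor n y i - gridFloor n x i,
    Fintype.mem_piFinset.2 fun i => Finset.mem_Icc.2 ?_, by ext i; simp⟩
  have h0 : |x i - y i| < (2 ^ n)⁻¹ :=
    lt_of_le_of_lt (by simpa using PiLp.norm_apply_le (x - y) i) hxy
  have h2 : (0 : ℝ) < 2 ^ n := by positivity
  have h5 : |2 ^ n * x i - 2 ^ n * y i| < 1 := by
    rw [← mul_sub, abs_mul, abs_of_pos h2]
    calc 2 ^ n * |x i - y i| < 2 ^ n * (2 ^ n)⁻¹ := by gcongr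
      _ = 1 := mul_inv_cancel₀ h2.ne'
  exact floor_sub_floor_mem_Icc h5

lemma plane_norm_le (x : Plane) {b : ℝ} (hb : ∀ i, |x i| ≤ b) : ‖x‖ ≤ 2 * b := by
  have hb0 : 0 ≤ b := (abs_nonneg _).trans (hb 0)
  rw [EuclideanSpace.norm_eq, Fin.sum_univ_two]
  refine Real.sqrt_le_iff.2 ⟨by positivity, ?_⟩
  have h0 := pow_le_pow_left₀ (abs_nonneg _) (hb 0) 2
  have h1 := pow_le_pow_left₀ (abs_nonneg _) (hb 1) 2
  simp only [Real.norm_eq_abs]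
  nlinarith

lemma norm_gridPoint_sub_le (n : ℕ) (k : Fin 2 → ℤ) {e : Fin 2 → ℤ} (he : e ∈ gridSteps) :
    ‖gridPoint n k - gridPoint n (k + e)‖ ≤ 2 * (2 ^ n)⁻¹ := by
  refine plane_norm_le _ fun i => ?_
  have h1 := Finset.mem_Icc.1 (Fintype.mem_piFinset.1 he i)
  have h2 : |(e i : ℝ)| ≤ 1 := by
    rw [abs_le]; exact ⟨by exact_mod_cast h1.1, by exact_mod_cast h1.2⟩
  have h3 : (gridPoint n k - gridPoint n (k + e)) i = -((e i : ℝ) / 2 ^ n) := by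
    rw [PiLp.sub_apply, gridPoint_apply, gridPoint_apply, Pi.add_apply]; push_cast; ring
  rw [h3, abs_neg, abs_div, abs_of_pos (by positivity : (0 : ℝ) < 2 ^ n), div_eq_mul_inv]
  exact mul_le_of_le_one_left (by positivity) h2

lemma norm_gridPoint_le {N n : ℕ} {k : Fin 2 → ℤ} (hk : k ∈ gridBox N n) :
    ‖gridPoint n k‖ ≤ 2 * N := by
  refine plane_norm_le _ fun i => ?_
  have h1 := Finset.mem_Icc.1 (Fintype.mem_piFinset.1 hk i)
  have h2 : |(k i : ℝ)| ≤ N * 2 ^ n := by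
    rw [abs_le]; exact ⟨by exact_mod_cast h1.1, by exact_mod_cast h1.2⟩
  rw [gridPoint_apply, abs_div, abs_of_pos (by positivity : (0 : ℝ) < 2 ^ n),
    div_le_iff₀ (by positivity)]
  exact h2

lemma norm_gridPoint_add_le {N n : ℕ} {k e : Fin 2 → ℤ} (hk : k ∈ gridBox N n)
    (he : e ∈ gridSteps) : ‖gridPoint n (k + e)‖ ≤ 2 * N + 2 := by
  have h1 := norm_gridPoint_le hk
  have h2 := norm_gridPoint_sub_le n k he
  have h3 : ((2 : ℝ) ^ n)⁻¹ ≤ 1 := inv_le_one_of_one_le₀ (one_le_pow₀ (by norm_num))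
  have h4 := norm_sub_norm_le (gridPoint n (k + e)) (gridPoint n k)
  rw [norm_sub_rev] at h4
  linarith

lemma tendsto_gridPoint_gridFloor (x : Plane) :
    Tendsto (fun n => gridPoint n (gridFloor n x)) atTop (𝓝 x) := by
  rw [tendsto_iff_norm_sub_tendsto_zero]
  have hlim : Tendsto (fun n : ℕ => 2 * (1 / 2 : ℝ) ^ n) atTop (𝓝 0) := by
    simpa using (tendsto_pow_atTop_nhds_zero_of_lt_one (by norm_num : (0 : ℝ) ≤ 1 / 2)
      (by norm_num)).const_mul 2
  refine squeeze_zero (fun _ => norm_nonneg _) (fun n => plane_norm_le _ fun i => ?_) hlim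
  have h2 : (0 : ℝ) < 2 ^ n := by positivity
  have h3 := Int.floor_le (2 ^ n * x i)
  have h4 := Int.lt_floor_add_one (2 ^ n * x i)
  rw [PiLp.sub_apply, gridPoint_apply, gridFloor, one_div, inv_pow,
    show (⌊2 ^ n * x i⌋ : ℝ) / 2 ^ n - x i = (⌊2 ^ n * x i⌋ - 2 ^ n * x i) * (2 ^ n)⁻¹ by
      field_simp, abs_mul, abs_of_pos (inv_pos.2 h2)]
  refine mul_le_of_le_one_left (by positivity) ?_
  rw [abs_le]; constructor <;> linarith

lemma GridBound.dist_succ_le {v : Plane → ℝ} {N : ℕ} {τ r : ℝ} (h : GridBound v N τ r)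
    (hτ : 0 ≤ τ) (hr0 : 0 ≤ r) (hr1 : r < 1) {x : Plane} (hx : x ∈ openSquare N) (n : ℕ) :
    dist (v (gridPoint n (gridFloor n x))) (v (gridPoint (n + 1) (gridFloor (n + 1) x))) ≤
      τ * r ^ n := by
  obtain ⟨e, he, h1⟩ := gridPoint_parent n x
  rw [dist_comm, Real.dist_eq, h1]
  refine (h (n + 1) _ (gridFloor_mem hx _) e he).trans ?_
  gcongr ?_ * ?_
  exact pow_le_pow_of_le_one hr0 hr1.le (Nat.le_succ n)

lemma GridBound.exists_tendsto {v : Plane → ℝ} {N : ℕ} {τ r : ℝ} (h : GridBound v N τ r)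
    (hτ : 0 ≤ τ) (hr0 : 0 ≤ r) (hr1 : r < 1) {x : Plane} (hx : x ∈ openSquare N) :
    ∃ l, Tendsto (fun n => v (gridPoint n (gridFloor n x))) atTop (𝓝 l) :=
  cauchySeq_tendsto_of_complete
    (cauchySeq_of_le_geometric r τ hr1 (h.dist_succ_le hτ hr0 hr1 hx))

/-- The chaining bound: summing the geometric series of grid increments controls a continuous
function on the whole square. -/
lemma GridBound.abs_sub_le {v : Plane → ℝ} {N : ℕ} {τ r : ℝ} (h : GridBound v N τ r)
    (hτ : 0 ≤ τ) (hr0 : 0 ≤ r) (hr1 : r < 1) (h0 : ∀ k ∈ gridBox N 0, |v (gridPoint 0 k) - v 0| ≤ τ)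
    (hv : Continuous v) {x : Plane} (hx : x ∈ openSquare N) :
    |v x - v 0| ≤ τ * (1 + (1 - r)⁻¹) := by
  have h1 := dist_le_of_le_geometric_of_tendsto r τ hr1 (h.dist_succ_le hτ hr0 hr1 hx)
    ((hv.tendsto x).comp (tendsto_gridPoint_gridFloor x)) 0
  have h2 := h0 _ (gridFloor_mem hx 0)
  rw [pow_zero, mul_one, Real.dist_eq] at h1
  have h3 := _root_.abs_sub_le (v x) (v (gridPoint 0 (gridFloor 0 x))) (v 0)
  rw [abs_sub_comm (v x) (v (gridPoint 0 _))] at h3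
  rw [mul_add, mul_one, ← div_eq_mul_inv]
  linarith

/-- The limit along the grids of a function with geometrically decaying grid increments is
continuous. -/
lemma GridBound.continuousOn_lim {v l : Plane → ℝ} {N : ℕ} {τ r : ℝ} (h : GridBound v N τ r)
    (hτ : 0 ≤ τ) (hr0 : 0 ≤ r) (hr1 : r < 1)
    (hl : ∀ x ∈ openSquare N,
      Tendsto (fun n => v (gridPoint n (gridFloor n x))) atTop (𝓝 (l x))) :
    ContinuousOn l (openSquare N) := by
  intro x hx
  rw [Metric.continuousWithinAt_iff]
  intro ε hε
  have hlim : Tendsto (fun n : ℕ => τ * r ^ n * (1 + 2 / (1 - r))) atTop (𝓝 0) := by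
    simpa using ((tendsto_pow_atTop_nhds_zero_of_lt_one hr0 hr1).const_mul τ).mul_const
      (1 + 2 / (1 - r))
  obtain ⟨n, hn⟩ := (hlim.eventually_lt_const hε).exists
  refine ⟨(2 ^ n)⁻¹, by positivity, fun y hy hyx => ?_⟩
  rw [dist_eq_norm, norm_sub_rev] at hyx
  obtain ⟨e, he, h1⟩ := gridFloor_neighbour hyx
  have h2 := h n _ (gridFloor_mem hx n) e he
  rw [← h1] at h2
  have h3 := dist_le_of_le_geometric_of_tendsto r τ hr1 (h.dist_succ_le hτ hr0 hr1 hx) (hl x hx) n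
  have h4 := dist_le_of_le_geometric_of_tendsto r τ hr1 (h.dist_succ_le hτ hr0 hr1 hy) (hl y hy) n
  refine lt_of_le_of_lt ?_ hn
  rw [dist_comm]
  rw [← Real.dist_eq] at h2
  calc dist (l x) (l y) ≤ dist (l x) (v (gridPoint n (gridFloor n x))) +
        dist (v (gridPoint n (gridFloor n x))) (v (gridPoint n (gridFloor n y))) +
        dist (v (gridPoint n (gridFloor n y))) (l y) := dist_triangle4 _ _ _ _
    _ ≤ τ * r ^ n / (1 - r) + τ * r ^ n + τ * r ^ n / (1 - r) := by
        rw [dist_comm (l x)]; gcongr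
    _ = _ := by ring

/-- The weighted sum of the `p`-th powers of the grid increments of `v` over `[-N, N]²`. The weight
`2 ^ n` makes its finiteness control the increments geometrically. -/
noncomputable def chainingSum (v : Plane → ℝ) (p N : ℕ) : ℝ≥0∞ :=
  ∑ k ∈ gridBox N 0, ‖v (gridPoint 0 k) - v 0‖ₑ ^ p +
    ∑' n : ℕ, 2 ^ n * ∑ k ∈ gridBox N n, ∑ e ∈ gridSteps,
      ‖v (gridPoint n k) - v (gridPoint n (k + e))‖ₑ ^ p

lemma abs_le_of_enorm_pow_le {a τ : ℝ} (hτ : 0 ≤ τ) {p : ℕ} (hp : p ≠ 0)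
    (h : ‖a‖ₑ ^ p ≤ ENNReal.ofReal (τ ^ p)) : |a| ≤ τ := by
  rw [← ofReal_norm, ← ENNReal.ofReal_pow (norm_nonneg _),
    ENNReal.ofReal_le_ofReal_iff (by positivity)] at h
  exact (pow_le_pow_iff_left₀ (abs_nonneg _) hτ hp).1 h

/-- The ratio `r = 2 ^ (-1/p)` is the one for which the weight `2 ^ n` in `chainingSum` turns into
the factor `r ^ n` after taking `p`-th roots. -/
lemma gridBound_of_chainingSum_le {v : Plane → ℝ} {p N : ℕ} {τ r : ℝ} (hp : p ≠ 0) (hτ : 0 ≤ τ)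
    (hr0 : 0 ≤ r) (hr : r ^ p = 1 / 2) (h : chainingSum v p N ≤ ENNReal.ofReal (τ ^ p)) :
    GridBound v N τ r ∧ ∀ k ∈ gridBox N 0, |v (gridPoint 0 k) - v 0| ≤ τ := by
  constructor
  · intro n k hk e he
    refine abs_le_of_enorm_pow_le (by positivity) hp ?_
    have h1 : 2 ^ n * ‖v (gridPoint n k) - v (gridPoint n (k + e))‖ₑ ^ p ≤
        ENNReal.ofReal (τ ^ p) := by
      refine le_trans ?_ (le_add_self.trans h)
      refine le_trans ?_ (ENNReal.le_tsum n)
      gcongr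
      refine le_trans ?_ (Finset.single_le_sum (fun _ _ => zero_le) hk)
      exact Finset.single_le_sum (f := fun e =>
        ‖v (gridPoint n k) - v (gridPoint n (k + e))‖ₑ ^ p) (fun _ _ => zero_le) he
    have h2 : (τ * r ^ n) ^ p = τ ^ p * (2 ^ n)⁻¹ := by
      rw [mul_pow, ← pow_mul, mul_comm n p, pow_mul, hr, one_div, inv_pow]
    rw [h2, ENNReal.ofReal_mul (by positivity), ENNReal.ofReal_inv_of_pos (by positivity),
      ENNReal.ofReal_pow (by norm_num) n, ← div_eq_mul_inv, ENNReal.le_div_iff_mul_le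
        (Or.inl (by simp)) (Or.inl (by simp)), mul_comm]
    simpa using h1
  · intro k hk
    refine abs_le_of_enorm_pow_le hτ hp (le_trans ?_ (le_self_add.trans h))
    exact Finset.single_le_sum (f := fun k => ‖v (gridPoint 0 k) - v 0‖ₑ ^ p)
      (fun _ _ => zero_le) hk

lemma card_gridBox_le (N n : ℕ) : (gridBox N n).card ≤ (2 * N + 1) ^ 2 * 4 ^ n := by
  have h1 : (gridBox N n).card = (2 * (N * 2 ^ n) + 1) ^ 2 := by
    rw [gridBox, Fintype.card_piFinset]
    simp only [Int.card_Icc, Finset.prod_const, Finset.card_univ, Fintype.card_fin]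
    congr 1
    have : ((N : ℤ) * 2 ^ n + 1 - -(N * 2 ^ n)) = ((2 * (N * 2 ^ n) + 1 : ℕ) : ℤ) := by
      push_cast; ring
    rw [this, Int.toNat_natCast]
  rw [h1, show 4 ^ n = (2 ^ n) ^ 2 by rw [← pow_mul, mul_comm, pow_mul]; norm_num, ← mul_pow]
  refine Nat.pow_le_pow_left ?_ 2
  have : 1 ≤ 2 ^ n := Nat.one_le_two_pow
  nlinarith

lemma card_gridSteps : gridSteps.card = 9 := by
  rw [gridSteps, Fintype.card_piFinset]; simp

end Chaining

/-! ### Continuous modifications -/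

section ContinuousModification

variable {Ω : Type u} [MeasurableSpace Ω] {P : Measure Ω}

/-- At scale `2 ^ (-n)` there are of order `4 ^ n` increments, each with `p`-th moment of order
`16 ^ (-n)`; with the weight `2 ^ n` the series is geometric of ratio `1/2`. Neighbours of grid
points may leave the square `[-N, N]²`, whence the radius `2 N + 2`. -/
lemma lintegral_chainingSum_le {V : Plane → Ω → ℝ} (hV : ∀ x, AEMeasurable (V x) P) {p N : ℕ}
    {K : ℝ≥0∞} (hK : ∀ s t : Plane, ‖s‖ ≤ 2 * N + 2 → ‖t‖ ≤ 2 * N + 2 →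
      ∫⁻ ω, ‖V s ω - V t ω‖ₑ ^ p ∂P ≤ K * ‖s - t‖ₑ ^ 4) :
    ∫⁻ ω, chainingSum (fun x => V x ω) p N ∂P ≤
      K * ((2 * N + 1) ^ 2 * ((2 * N) ^ 4 + 288) : ℕ) := by
  have hm : ∀ s t, AEMeasurable (fun ω => ‖V s ω - V t ω‖ₑ ^ p) P := fun s t =>
    ((hV s).sub (hV t)).enorm.pow_const p
  have hms : ∀ n : ℕ, AEMeasurable (fun ω => 2 ^ n * ∑ k ∈ gridBox N n, ∑ e ∈ gridSteps,
      ‖V (gridPoint n k) ω - V (gridPoint n (k + e)) ω‖ₑ ^ p) P := fun n =>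
    (Finset.aemeasurable_fun_sum _ fun k _ => Finset.aemeasurable_fun_sum _ fun e _ =>
      hm _ _).const_mul _
  have hle : ∀ {a b : ℝ}, a ≤ b → ENNReal.ofReal a ≤ ENNReal.ofReal b :=
    fun h => ENNReal.ofReal_le_ofReal h
  have h0 : ∑ k ∈ gridBox N 0, ∫⁻ ω, ‖V (gridPoint 0 k) ω - V 0 ω‖ₑ ^ p ∂P ≤
      K * ((2 * N + 1) ^ 2 * (2 * N) ^ 4 : ℕ) := by
    have h1 : ∀ k ∈ gridBox N 0, ∫⁻ ω, ‖V (gridPoint 0 k) ω - V 0 ω‖ₑ ^ p ∂P ≤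
        K * ((2 * N) ^ 4 : ℕ) := by
      intro k hk
      have h2 := norm_gridPoint_le hk
      refine (hK _ _ (h2.trans (by linarith)) (by rw [norm_zero]; positivity)).trans ?_
      gcongr
      rw [sub_zero, ← ofReal_norm, ← ENNReal.ofReal_pow (norm_nonneg _)]
      refine (hle (pow_le_pow_left₀ (norm_nonneg _) h2 4)).trans ?_
      rw [← ENNReal.ofReal_natCast]
      exact hle (by push_cast; exact le_rfl)
    refine (Finset.sum_le_card_nsmul _ _ _ h1).trans ?_
    rw [nsmul_eq_mul, mul_left_comm, Nat.cast_mul]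
    gcongr
    have := card_gridBox_le N 0
    simpa using this
  have hn : ∀ n : ℕ, ∫⁻ ω, 2 ^ n * ∑ k ∈ gridBox N n, ∑ e ∈ gridSteps,
      ‖V (gridPoint n k) ω - V (gridPoint n (k + e)) ω‖ₑ ^ p ∂P ≤
      K * ((2 * N + 1) ^ 2 * 144 : ℕ) * 2⁻¹ ^ n := by
    intro n
    rw [lintegral_const_mul'' _ (Finset.aemeasurable_fun_sum _ fun k _ =>
      Finset.aemeasurable_fun_sum _ fun e _ => hm _ _),
      lintegral_finsetSum' _ fun k _ => Finset.aemeasurable_fun_sum _ fun e _ => hm _ _]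
    have h1 : ∀ k ∈ gridBox N n, ∫⁻ ω, ∑ e ∈ gridSteps,
        ‖V (gridPoint n k) ω - V (gridPoint n (k + e)) ω‖ₑ ^ p ∂P ≤
          9 * (K * ENNReal.ofReal (16 * (16 ^ n)⁻¹)) := by
      intro k hk
      rw [lintegral_finsetSum' _ fun e _ => hm _ _]
      have h2 : ∀ e ∈ gridSteps, ∫⁻ ω, ‖V (gridPoint n k) ω - V (gridPoint n (k + e)) ω‖ₑ ^ p ∂P ≤
          K * ENNReal.ofReal (16 * (16 ^ n)⁻¹) := by
        intro e he
        refine (hK _ _ ((norm_gridPoint_le hk).trans (by linarith))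
          (norm_gridPoint_add_le hk he)).trans ?_
        gcongr
        rw [← ofReal_norm, ← ENNReal.ofReal_pow (norm_nonneg _)]
        refine hle ((pow_le_pow_left₀ (norm_nonneg _) (norm_gridPoint_sub_le n k he) 4).trans ?_)
        rw [mul_pow, inv_pow, ← pow_mul, mul_comm n 4, pow_mul]
        norm_num
      refine (Finset.sum_le_card_nsmul _ _ _ h2).trans ?_
      rw [card_gridSteps, nsmul_eq_mul]
      norm_num
    have h3 : ((gridBox N n).card : ℝ) ≤ (2 * N + 1) ^ 2 * 4 ^ n := by
      exact_mod_cast card_gridBox_le N n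
    calc (2 : ℝ≥0∞) ^ n * ∑ k ∈ gridBox N n, ∫⁻ ω, ∑ e ∈ gridSteps,
          ‖V (gridPoint n k) ω - V (gridPoint n (k + e)) ω‖ₑ ^ p ∂P
        ≤ 2 ^ n * ((gridBox N n).card * (9 * (K * ENNReal.ofReal (16 * (16 ^ n)⁻¹)))) := by
          gcongr
          refine (Finset.sum_le_card_nsmul _ _ _ h1).trans ?_
          rw [nsmul_eq_mul]
      _ = K * ENNReal.ofReal (2 ^ n * ((gridBox N n).card * (9 * (16 * (16 ^ n)⁻¹)))) := by
          rw [ENNReal.ofReal_mul (p := 2 ^ n) (by positivity),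
            ENNReal.ofReal_mul (p := ((gridBox N n).card : ℝ)) (by positivity),
            ENNReal.ofReal_mul (p := 9) (by positivity), ENNReal.ofReal_pow (by norm_num),
            ENNReal.ofReal_natCast]
          norm_num
          ring
      _ ≤ K * ENNReal.ofReal ((((2 * N + 1) ^ 2 * 144 : ℕ) : ℝ) * 2⁻¹ ^ n) := by
          gcongr K * ENNReal.ofReal ?_
          push_cast
          calc (2 : ℝ) ^ n * ((gridBox N n).card * (9 * (16 * (16 ^ n)⁻¹)))
              ≤ 2 ^ n * (((2 * N + 1) ^ 2 * 4 ^ n) * (9 * (16 * (16 ^ n)⁻¹))) := by gcongr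
            _ = (2 * N + 1) ^ 2 * 144 * (2 ^ n * 4 ^ n * (16 ^ n)⁻¹) := by ring
            _ = _ := by
              rw [← mul_pow, ← inv_pow, ← mul_pow]; norm_num
      _ = _ := by
          rw [ENNReal.ofReal_mul (by positivity), ENNReal.ofReal_natCast,
            ENNReal.ofReal_pow (by norm_num), ENNReal.ofReal_inv_of_pos (by norm_num), mul_assoc]
          norm_num
  unfold chainingSum
  rw [lintegral_add_left' (Finset.aemeasurable_fun_sum _ fun k _ => hm _ _),
    lintegral_finsetSum' _ fun k _ => hm _ _, lintegral_tsum hms]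
  calc _ ≤ K * ((2 * N + 1) ^ 2 * (2 * N) ^ 4 : ℕ) +
        ∑' n : ℕ, K * ((2 * N + 1) ^ 2 * 144 : ℕ) * 2⁻¹ ^ n :=
        add_le_add h0 (ENNReal.tsum_le_tsum hn)
    _ = _ := by
        rw [ENNReal.tsum_mul_left, ENNReal.tsum_geometric, ENNReal.one_sub_inv_two, inv_inv,
          mul_assoc, ← mul_add]
        congr 1
        push_cast
        ring

lemma exists_pow_eq_half {p : ℕ} (hp : p ≠ 0) : ∃ r : ℝ, 0 ≤ r ∧ r < 1 ∧ r ^ p = 1 / 2 := by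
  refine ⟨(1 / 2 : ℝ) ^ (p : ℝ)⁻¹, by positivity, ?_, ?_⟩
  · exact Real.rpow_lt_one (by norm_num) (by norm_num) (by positivity)
  · exact Real.rpow_inv_natCast_pow (by norm_num) hp

lemma exists_gridBound {v : Plane → ℝ} {p N : ℕ} (hp : p ≠ 0) (h : chainingSum v p N < ∞)
    {r : ℝ} (hr0 : 0 ≤ r) (hr : r ^ p = 1 / 2) : ∃ τ, 0 ≤ τ ∧ GridBound v N τ r := by
  refine ⟨(chainingSum v p N).toReal ^ (p : ℝ)⁻¹, by positivity,
    (gridBound_of_chainingSum_le hp (by positivity) hr0 hr ?_).1⟩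
  rw [Real.rpow_inv_natCast_pow ENNReal.toReal_nonneg hp, ENNReal.ofReal_toReal h.ne]

lemma isOpen_openSquare (N : ℕ) : IsOpen (openSquare N) := by
  simp only [openSquare, Set.ofPred_forall]
  exact isOpen_iInter_of_finite fun i => isOpen_lt (by fun_prop) continuous_const

lemma mem_openSquare {x : Plane} {N : ℕ} (h : ‖x‖ < N) : x ∈ openSquare N := fun i =>
  lt_of_le_of_lt (by simpa using PiLp.norm_apply_le x i) h

/-- The Kolmogorov–Chentsov theorem on the plane. The exponent `4` exceeds the dimension `2`, and
leaves room for a crude choice of weights in `chainingSum`. -/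
theorem exists_continuous_modification {V : Plane → Ω → ℝ} (hV : ∀ x, AEMeasurable (V x) P)
    {p : ℕ} (hp : p ≠ 0) (hK : ∀ N : ℕ, ∃ K : ℝ≥0∞, K ≠ ∞ ∧ ∀ s t : Plane, ‖s‖ ≤ 2 * N + 2 →
      ‖t‖ ≤ 2 * N + 2 → ∫⁻ ω, ‖V s ω - V t ω‖ₑ ^ p ∂P ≤ K * ‖s - t‖ₑ ^ 4) :
    ∃ X : Ω → C(Plane, ℝ), ∀ x, (fun ω => X ω x) =ᵐ[P] V x := by
  classical
  obtain ⟨r, hr0, hr1, hr⟩ := exists_pow_eq_half hp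
  have hfin : ∀ᵐ ω ∂P, ∀ N : ℕ, chainingSum (fun x => V x ω) p N < ∞ := by
    refine ae_all_iff.2 fun N => ?_
    obtain ⟨K, hK1, hK2⟩ := hK N
    have hm : AEMeasurable (fun ω => chainingSum (fun x => V x ω) p N) P := by
      have hm : ∀ s t, AEMeasurable (fun ω => ‖V s ω - V t ω‖ₑ ^ p) P := fun s t =>
        ((hV s).sub (hV t)).enorm.pow_const p
      exact (Finset.aemeasurable_fun_sum _ fun k _ => hm _ _).add
        (AEMeasurable.tsum fun n => (Finset.aemeasurable_fun_sum _ fun k _ =>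
          Finset.aemeasurable_fun_sum _ fun e _ => hm _ _).const_mul _)
    refine ae_lt_top' hm (ne_top_of_le_ne_top ?_ (lintegral_chainingSum_le hV hK2))
    exact ENNReal.mul_ne_top hK1 (ENNReal.natCast_ne_top _)
  -- The candidate path is the limit of the grid values, a junk value on a null set of `ω`.
  let l : Ω → Plane → ℝ := fun ω x =>
    limUnder atTop fun n => V (gridPoint n (gridFloor n x)) ω
  have hl : ∀ ω, (∀ N : ℕ, chainingSum (fun x => V x ω) p N < ∞) →
      (∀ x, Tendsto (fun n => V (gridPoint n (gridFloor n x)) ω) atTop (𝓝 (l ω x))) ∧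
      Continuous (l ω) := by
    intro ω hω
    have ht : ∀ x, Tendsto (fun n => V (gridPoint n (gridFloor n x)) ω) atTop (𝓝 (l ω x)) := by
      intro x
      obtain ⟨N, hN⟩ := exists_nat_gt ‖x‖
      obtain ⟨τ, hτ, hb⟩ := exists_gridBound hp (hω N) hr0 hr
      exact tendsto_nhds_limUnder (hb.exists_tendsto hτ hr0 hr1 (mem_openSquare hN))
    refine ⟨ht, continuous_iff_continuousAt.2 fun x => ?_⟩
    obtain ⟨N, hN⟩ := exists_nat_gt ‖x‖
    obtain ⟨τ, hτ, hb⟩ := exists_gridBound hp (hω N) hr0 hr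
    exact (hb.continuousOn_lim hτ hr0 hr1 fun x _ => ht x).continuousAt
      ((isOpen_openSquare N).mem_nhds (mem_openSquare hN))
  refine ⟨fun ω => if h : Continuous (l ω) then ⟨l ω, h⟩ else 0, fun x => ?_⟩
  have hXl : (fun ω => (if h : Continuous (l ω) then (⟨l ω, h⟩ : C(Plane, ℝ)) else 0) x) =ᵐ[P]
      fun ω => l ω x := by
    filter_upwards [hfin] with ω hω
    rw [dif_pos (hl ω hω).2]; rfl
  refine hXl.trans ?_
  have hlim : ∀ᵐ ω ∂P, Tendsto (fun n => V (gridPoint n (gridFloor n x)) ω) atTop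
      (𝓝 (l ω x)) := by
    filter_upwards [hfin] with ω hω using (hl ω hω).1 x
  have hlm : AEMeasurable (fun ω => l ω x) P :=
    aemeasurable_of_tendsto_metrizable_ae atTop (fun n => hV _) hlim
  -- The grid values converge to `V x` in `L^p`, and almost surely to `l · x`.
  have hzero : ∫⁻ ω, ‖l ω x - V x ω‖ₑ ^ p ∂P = 0 := by
    obtain ⟨N, hN⟩ := exists_nat_gt ‖x‖
    obtain ⟨K, hK1, hK2⟩ := hK N
    have h1 : ∀ n, ∫⁻ ω, ‖V (gridPoint n (gridFloor n x)) ω - V x ω‖ₑ ^ p ∂P ≤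
        K * ‖gridPoint n (gridFloor n x) - x‖ₑ ^ 4 := fun n =>
      hK2 _ _ ((norm_gridPoint_le (gridFloor_mem (mem_openSquare hN) n)).trans (by linarith))
        (by linarith [(Nat.cast_nonneg N : (0 : ℝ) ≤ N)])
    have h2 : Tendsto (fun n => K * ‖gridPoint n (gridFloor n x) - x‖ₑ ^ 4) atTop (𝓝 0) := by
      have h3 : Tendsto (fun n => gridPoint n (gridFloor n x) - x) atTop (𝓝 0) := by
        simpa using (tendsto_gridPoint_gridFloor x).sub_const x
      have h4 := ((ENNReal.continuous_pow 4).tendsto _).comp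
        ((continuous_enorm.tendsto (0 : Plane)).comp h3)
      have h5 := ENNReal.Tendsto.const_mul (a := K) h4 (Or.inr hK1)
      simpa using h5
    have h3 : Tendsto (fun n => ∫⁻ ω, ‖V (gridPoint n (gridFloor n x)) ω - V x ω‖ₑ ^ p ∂P) atTop
        (𝓝 0) :=
      tendsto_of_tendsto_of_tendsto_of_le_of_le tendsto_const_nhds h2 (fun _ => zero_le) h1
    have h4 := lintegral_liminf_le' (μ := P) (u := atTop)
      (f := fun n ω => ‖V (gridPoint n (gridFloor n x)) ω - V x ω‖ₑ ^ p)
      fun n => ((hV _).sub (hV x)).enorm.pow_const p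
    rw [h3.liminf_eq, nonpos_iff_eq_zero] at h4
    rw [← h4]
    refine lintegral_congr_ae ?_
    filter_upwards [hlim] with ω hω
    have h5 : Tendsto (fun n => ‖V (gridPoint n (gridFloor n x)) ω - V x ω‖ₑ ^ p) atTop
        (𝓝 (‖l ω x - V x ω‖ₑ ^ p)) :=
      ((ENNReal.continuous_pow p).tendsto _).comp
        ((continuous_enorm.tendsto _).comp (hω.sub_const (V x ω)))
    exact h5.liminf_eq.symm
  replace hzero := (lintegral_eq_zero_iff' ((hlm.sub (hV x)).enorm.pow_const p)).1 hzero
  filter_upwards [hzero] with ω hω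
  have h6 : ‖l ω x - V x ω‖ₑ = 0 := by simpa [hp] using hω
  rw [enorm_eq_zero, sub_eq_zero] at h6
  exact h6

/-- The absolute moment of order `2 q` of the standard Gaussian law. -/
noncomputable def gaussMoment (q : ℕ) : ℝ≥0∞ := ∫⁻ x, ‖x‖ₑ ^ (2 * q) ∂(gaussianReal 0 1)

lemma gaussMoment_ne_top (q : ℕ) : gaussMoment q ≠ ∞ := by
  rcases Nat.eq_zero_or_pos q with rfl | hq
  · simp [gaussMoment]
  have h := (memLp_id_gaussianReal (μ := 0) (v := 1) ((2 * q : ℕ) : NNReal)).2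
  have h2 := lintegral_rpow_enorm_lt_top_of_eLpNorm_lt_top (by simp; omega) ENNReal.coe_ne_top h
  simpa [gaussMoment, ← ENNReal.rpow_natCast] using h2.ne

/-- The moments of a centred Gaussian variable are controlled by its variance. -/
lemma lintegral_enorm_pow_le_of_gaussian {U : Ω → ℝ} (hU : HasGaussianLaw U P)
    (h0 : ∫ ω, U ω ∂P = 0) {σ : ℝ} (hσ : ∫ ω, U ω ^ 2 ∂P ≤ σ) (q : ℕ) :
    ∫⁻ ω, ‖U ω‖ₑ ^ (2 * q) ∂P ≤ gaussMoment q * ENNReal.ofReal (σ ^ q) := by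
  have hv0 : 0 ≤ ∫ ω, U ω ^ 2 ∂P := integral_nonneg fun ω => sq_nonneg _
  have hmap : P.map U = (gaussianReal 0 1).map (Real.sqrt (∫ ω, U ω ^ 2 ∂P) * ·) := by
    rw [hU.map_eq_gaussianReal, gaussianReal_map_const_mul, h0,
      variance_of_integral_eq_zero hU.aemeasurable h0]
    congr 1
    · simp
    · ext
      simp [Real.sq_sqrt hv0, Real.coe_toNNReal _ hv0]
  calc ∫⁻ ω, ‖U ω‖ₑ ^ (2 * q) ∂P = ∫⁻ x, ‖x‖ₑ ^ (2 * q) ∂(P.map U) := by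
        rw [lintegral_map' (by fun_prop) hU.aemeasurable]
    _ = ∫⁻ x, ENNReal.ofReal ((∫ ω, U ω ^ 2 ∂P) ^ q) * ‖x‖ₑ ^ (2 * q) ∂(gaussianReal 0 1) := by
        rw [hmap, lintegral_map (by fun_prop) (by fun_prop)]
        refine lintegral_congr fun x => ?_
        rw [enorm_mul, mul_pow]
        congr 1
        rw [Real.enorm_of_nonneg (Real.sqrt_nonneg _), ← ENNReal.ofReal_pow (Real.sqrt_nonneg _),
          pow_mul, Real.sq_sqrt hv0]
    _ = ENNReal.ofReal ((∫ ω, U ω ^ 2 ∂P) ^ q) * gaussMoment q :=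
        lintegral_const_mul _ (by fun_prop)
    _ ≤ _ := by
        rw [mul_comm]
        gcongr

/-- For a Gaussian increment, a Hölder bound on the variance gives, through a moment of high order,
the moment bound needed for chaining in the plane. -/
lemma lintegral_enorm_pow_le_of_variance_le {U : Ω → ℝ} (hU : HasGaussianLaw U P)
    (h0 : ∫ ω, U ω ∂P = 0) {κ α d D : ℝ} (hκ : 0 ≤ κ) (hd : 0 ≤ d) (hD : d ≤ D)
    (hvar : ∫ ω, U ω ^ 2 ∂P ≤ κ * d ^ α) {q : ℕ} (hq : 4 < α * q) :
    ∫⁻ ω, ‖U ω‖ₑ ^ (2 * q) ∂P ≤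
      gaussMoment q * ENNReal.ofReal (κ ^ q * D ^ (α * q - 4)) * ENNReal.ofReal d ^ 4 := by
  refine (lintegral_enorm_pow_le_of_gaussian hU h0 hvar q).trans ?_
  rw [mul_assoc]
  gcongr
  rw [← ENNReal.ofReal_pow hd, ← ENNReal.ofReal_mul (by have := hd.trans hD; positivity)]
  refine ENNReal.ofReal_le_ofReal ?_
  have h1 : (d ^ α) ^ q = d ^ (α * q - 4) * d ^ 4 := by
    rw [← Real.rpow_mul_natCast hd, ← Real.rpow_natCast d 4,
      ← Real.rpow_add' hd (by push_cast; linarith)]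
    congr 1; push_cast; ring
  rw [mul_pow, h1, mul_assoc]
  gcongr

end ContinuousModification

/-! ### Radial weight and pointwise bounds -/

section Weight

/-- The radial weight dominating all the spectral integrals: `r ^ (-2M)` for `r ≤ 1` and
`r ^ (-2-m)` for `r > 1`. It is integrable in the plane when `0 < m` and `M < 1`. -/
noncomputable def spectralWeight (m M r : ℝ) : ℝ :=
  if r ≤ 1 then r ^ (-(2 * M)) else r ^ (-2 - m)

lemma spectralWeight_nonneg {m M r : ℝ} (hr : 0 ≤ r) : 0 ≤ spectralWeight m M r := by
  unfold spectralWeight; split_ifs <;> positivity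

lemma measurable_spectralWeight (m M : ℝ) : Measurable (spectralWeight m M) :=
  Measurable.ite measurableSet_Iic (by fun_prop) (by fun_prop)

lemma integrable_spectralWeight {m M : ℝ} (hm : 0 < m) (hM : M < 1) :
    Integrable (fun ξ : Plane => spectralWeight m M ‖ξ‖) := by
  rw [integrable_fun_norm_addHaar (volume : Measure Plane) (f := spectralWeight m M),
    ← Set.Ioc_union_Ioi_eq_Ioi (zero_le_one' ℝ), integrableOn_union]
  have hdim : Module.finrank ℝ Plane - 1 = 1 := by simp
  rw [hdim]
  constructor
  · have h1 : IntegrableOn (fun r : ℝ => r ^ (1 - 2 * M)) (Set.Ioc 0 1) := by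
      rw [← intervalIntegrable_iff_integrableOn_Ioc_of_le zero_le_one]
      exact intervalIntegral.intervalIntegrable_rpow' (by linarith)
    refine h1.congr_fun (fun r hr => ?_) measurableSet_Ioc
    simp only [spectralWeight, if_pos hr.2, smul_eq_mul, pow_one]
    rw [sub_eq_add_neg, Real.rpow_add hr.1, Real.rpow_one]
  · have h1 : IntegrableOn (fun r : ℝ => r ^ (-1 - m)) (Set.Ioi 1) :=
      integrableOn_Ioi_rpow_of_lt (by linarith) one_pos
    refine h1.congr_fun (fun r hr => ?_) measurableSet_Ioi
    have hr' : (1 : ℝ) < r := hr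
    simp only [spectralWeight, if_neg (not_le.2 hr'), smul_eq_mul, pow_one]
    rw [show -1 - m = 1 + (-2 - m) by ring, Real.rpow_add (by linarith), Real.rpow_one]

/-- Integration in polar coordinates of the product of a function homogeneous of degree `0` and a
radial function. -/
lemma lintegral_homogeneous_mul_radial {D : Plane → ℝ≥0∞} (hD : Measurable D)
    (hhom : ∀ ξ, ∀ ρ : ℝ, 0 < ρ → D (ρ • ξ) = D ξ) {w : ℝ → ℝ≥0∞} (hw : Measurable w) :
    ∫⁻ ξ, D ξ * w ‖ξ‖ =
      (∫⁻ Θ : Metric.sphere (0 : Plane) 1, D Θ ∂((volume : Measure Plane).toSphere)) *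
        ∫⁻ r : Set.Ioi (0 : ℝ), w r ∂(Measure.volumeIoiPow (Module.finrank ℝ Plane - 1)) := by
  have h1 : ∫⁻ ξ, D ξ * w ‖ξ‖ = ∫⁻ ξ : ({0}ᶜ : Set Plane), D ξ * w ‖(ξ : Plane)‖
      ∂((volume : Measure Plane).comap (↑)) := by
    rw [lintegral_subtype_comap (measurableSet_singleton _).compl fun ξ => D ξ * w ‖ξ‖,
      restrict_compl_singleton]
  have h2 := lintegral_prod_mul (μ := (volume : Measure Plane).toSphere)
    (ν := Measure.volumeIoiPow (Module.finrank ℝ Plane - 1))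
    (hD.comp measurable_subtype_coe).aemeasurable (hw.comp measurable_subtype_coe).aemeasurable
  simp only [Function.comp] at h2
  rw [h1, ← h2,
    ← (volume : Measure Plane).measurePreserving_homeomorphUnitSphereProd.lintegral_comp_emb
      (Homeomorph.measurableEmbedding _)]
  refine lintegral_congr fun ξ => ?_
  have hξ : 0 < ‖(ξ : Plane)‖ := norm_pos_iff.2 ξ.2
  simp only [homeomorphUnitSphereProd_apply_snd_coe, homeomorphUnitSphereProd_apply_fst_coe]
  rw [hhom _ _ (inv_pos.2 hξ)]

/-- An integral over the plane against the radial weight is controlled by an integral over the unit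
circle: this is how the angular condition on `C` is used. -/
lemma integral_homogeneous_mul_spectralWeight_le {m M : ℝ} (hm : 0 < m) (hM : M < 1) :
    ∃ c : ℝ, 0 ≤ c ∧ ∀ (D : Plane → ℝ), Measurable D → (∀ ξ, 0 ≤ D ξ) →
      (∀ ξ, ∀ ρ : ℝ, 0 < ρ → D (ρ • ξ) = D ξ) → ∀ b : ℝ, 0 ≤ b →
      ∫⁻ Θ : Metric.sphere (0 : Plane) 1, ENNReal.ofReal (D Θ)
        ∂((volume : Measure Plane).toSphere) ≤ ENNReal.ofReal b →
      ∫ ξ, D ξ * spectralWeight m M ‖ξ‖ ≤ c * b := by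
  set I : ℝ≥0∞ := ∫⁻ r : Set.Ioi (0 : ℝ), ENNReal.ofReal (spectralWeight m M r)
    ∂(Measure.volumeIoiPow (Module.finrank ℝ Plane - 1)) with hI
  have hwm : Measurable fun r => ENNReal.ofReal (spectralWeight m M r) :=
    (measurable_spectralWeight m M).ennreal_ofReal
  have hIfin : I ≠ ∞ := by
    have h1 := lintegral_homogeneous_mul_radial (D := fun _ => 1) measurable_const
      (fun _ _ _ => rfl) hwm
    have h2 : ∫⁻ ξ : Plane, 1 * ENNReal.ofReal (spectralWeight m M ‖ξ‖) ≠ ∞ := by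
      simp_rw [one_mul]
      exact (integrable_spectralWeight hm hM).lintegral_lt_top.ne
    rw [h1, ← hI] at h2
    intro hcon
    rw [hcon, ENNReal.mul_top] at h2
    · exact h2 rfl
    · rw [lintegral_one, Measure.measure_univ_ne_zero]
      exact Measure.toSphere_ne_zero _
  refine ⟨I.toReal, ENNReal.toReal_nonneg, fun D hD hD0 hhom b hb hle => ?_⟩
  rw [integral_eq_lintegral_of_nonneg_ae
    (ae_of_all _ fun ξ => mul_nonneg (hD0 _) (spectralWeight_nonneg (norm_nonneg _)))
    (hD.mul ((measurable_spectralWeight m M).comp measurable_norm)).aestronglyMeasurable]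
  refine ENNReal.toReal_le_of_le_ofReal (by positivity) ?_
  simp_rw [fun ξ => ENNReal.ofReal_mul (q := spectralWeight m M ‖ξ‖) (hD0 ξ)]
  rw [lintegral_homogeneous_mul_radial hD.ennreal_ofReal (fun ξ ρ hρ => by rw [hhom ξ ρ hρ]) hwm,
    ENNReal.ofReal_mul ENNReal.toReal_nonneg, ENNReal.ofReal_toReal hIfin, mul_comm]
  gcongr

end Weight

section PointwiseBounds

lemma abs_exp_sub_exp_le (a b : ℝ) :
    |Real.exp a - Real.exp b| ≤ |a - b| * max (Real.exp a) (Real.exp b) := by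
  wlog hab : a ≤ b generalizing a b
  · rw [abs_sub_comm, abs_sub_comm a, max_comm]
    exact this b a (le_of_not_ge hab)
  rw [max_eq_right (Real.exp_le_exp.2 hab), abs_sub_comm, abs_sub_comm a,
    abs_of_nonneg (sub_nonneg.2 hab), abs_of_nonneg (sub_nonneg.2 (Real.exp_le_exp.2 hab))]
  have h1 := Real.add_one_le_exp (a - b)
  have h2 : Real.exp a = Real.exp b * Real.exp (a - b) := by rw [← Real.exp_add]; ring_nf
  rw [h2]
  nlinarith [Real.exp_pos b]

lemma abs_rpow_neg_sub_le {r : ℝ} (hr : 0 < r) (s t : ℝ) :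
    |r ^ (-s) - r ^ (-t)| ≤ |s - t| * |Real.log r| * max (r ^ (-s)) (r ^ (-t)) := by
  rw [Real.rpow_def_of_pos hr, Real.rpow_def_of_pos hr]
  refine (abs_exp_sub_exp_le _ _).trans_eq ?_
  rw [← mul_sub, abs_mul, show -s - -t = -(s - t) by ring, abs_neg, mul_comm |Real.log r|]

/-- Bound for `‖e - 1‖² r^(-2s-2)`, where `E` stands for `‖e - 1‖ ≤ min (2, d r)`. -/
lemma sq_mul_rpow_le {m s M r d E : ℝ} (hm : 0 < m) (hms : m ≤ s) (hsM : s ≤ M) (hM : M < 1)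
    (hr : 0 < r) (hd : 0 ≤ d) (hE0 : 0 ≤ E) (hE2 : E ≤ 2) (hE : E ≤ d * r) :
    E ^ 2 * (r ^ (-s - 1)) ^ 2 ≤ 4 * (d ^ 2 + d ^ m) * spectralWeight m M r := by
  have hdm : 0 ≤ d ^ m := by positivity
  unfold spectralWeight
  split_ifs with h
  · have h1 : E ^ 2 ≤ d ^ 2 * r ^ 2 := by
      rw [← mul_pow]; exact pow_le_pow_left₀ hE0 hE 2
    have h2 : r ^ 2 * (r ^ (-s - 1)) ^ 2 = r ^ (-(2 * s)) := by
      rw [← mul_pow, ← Real.rpow_one_add' hr.le (by linarith), ← Real.rpow_mul_natCast hr.le]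
      congr 1; push_cast; ring
    have h3 : r ^ (-(2 * s)) ≤ r ^ (-(2 * M)) :=
      Real.rpow_le_rpow_of_exponent_ge hr h (by linarith)
    calc E ^ 2 * (r ^ (-s - 1)) ^ 2 ≤ d ^ 2 * r ^ 2 * (r ^ (-s - 1)) ^ 2 := by gcongr
      _ = d ^ 2 * r ^ (-(2 * s)) := by rw [mul_assoc, h2]
      _ ≤ 4 * (d ^ 2 + d ^ m) * r ^ (-(2 * M)) := by
        gcongr
        nlinarith [sq_nonneg d]
  · rw [not_le] at h
    have h1 : E ^ 2 ≤ 4 * (d * r) ^ m := by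
      rcases le_total 1 (d * r) with h1 | h1
      · have := Real.one_le_rpow h1 hm.le
        nlinarith
      · have h2 : E ^ 2 ≤ (d * r) ^ 2 := pow_le_pow_left₀ hE0 hE 2
        have h3 : (d * r) ^ (2 : ℝ) ≤ (d * r) ^ m :=
          Real.rpow_le_rpow_of_exponent_ge_of_imp (by positivity) h1 (by linarith)
            fun _ h0 => absurd h0 two_ne_zero
        rw [Real.rpow_two] at h3
        have : 0 ≤ (d * r) ^ m := by positivity
        linarith
    have h2 : r ^ m * (r ^ (-s - 1)) ^ 2 = r ^ (m - 2 * s - 2) := by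
      rw [← Real.rpow_mul_natCast hr.le, ← Real.rpow_add hr]
      congr 1; push_cast; ring
    have h3 : r ^ (m - 2 * s - 2) ≤ r ^ (-2 - m) :=
      Real.rpow_le_rpow_of_exponent_le h.le (by linarith)
    calc E ^ 2 * (r ^ (-s - 1)) ^ 2 ≤ 4 * (d * r) ^ m * (r ^ (-s - 1)) ^ 2 := by gcongr
      _ = 4 * d ^ m * r ^ (m - 2 * s - 2) := by rw [Real.mul_rpow hd hr.le, ← h2]; ring
      _ ≤ 4 * (d ^ 2 + d ^ m) * r ^ (-2 - m) := by
        gcongr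
        nlinarith [sq_nonneg d]

/-- Bound for the effect of a change of the exponent: the logarithm that appears costs an
arbitrarily small power, at infinity and at the origin. -/
lemma sq_mul_rpow_sub_le {m s t M₁ δ r d E : ℝ} (hm : 0 < m) (hms : m ≤ s) (hmt : m ≤ t)
    (hs : s ≤ M₁) (ht : t ≤ M₁) (hδ : 0 < δ) (hr : 0 < r) (hE0 : 0 ≤ E) (hE2 : E ≤ 2)
    (hE : E ≤ d * r) :
    E ^ 2 * (r ^ (-s - 1) - r ^ (-t - 1)) ^ 2 ≤
      4 * (1 + d ^ 2) * (δ⁻¹ + (m / 2)⁻¹) ^ 2 * (s - t) ^ 2 *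
        spectralWeight m (M₁ + δ) r := by
  have hsplit : r ^ (-s - 1) - r ^ (-t - 1) = r⁻¹ * (r ^ (-s) - r ^ (-t)) := by
    rw [Real.rpow_sub_one hr.ne', Real.rpow_sub_one hr.ne']; field_simp
  have hmain := abs_rpow_neg_sub_le hr s t
  have hc1 : δ⁻¹ ≤ δ⁻¹ + (m / 2)⁻¹ := le_add_of_nonneg_right (by positivity)
  have hc2 : (m / 2)⁻¹ ≤ δ⁻¹ + (m / 2)⁻¹ := le_add_of_nonneg_left (by positivity)
  set c := δ⁻¹ + (m / 2)⁻¹ with hc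
  have hc0 : 0 ≤ c := by positivity
  rw [hsplit, mul_pow, ← sq_abs (r ^ (-s) - r ^ (-t)), ← sq_abs (s - t)]
  unfold spectralWeight
  split_ifs with h
  · have hlog : |Real.log r| ≤ c * r ^ (-δ) := by
      rw [abs_of_nonpos (Real.log_nonpos hr.le h), ← Real.log_inv]
      refine (Real.log_le_rpow_div (inv_nonneg.2 hr.le) hδ).trans ?_
      rw [Real.inv_rpow hr.le, ← Real.rpow_neg hr.le, div_eq_mul_inv, mul_comm]
      gcongr
    have hmax : max (r ^ (-s)) (r ^ (-t)) ≤ r ^ (-M₁) :=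
      max_le (Real.rpow_le_rpow_of_exponent_ge hr h (by linarith))
        (Real.rpow_le_rpow_of_exponent_ge hr h (by linarith))
    have h1 : |r ^ (-s) - r ^ (-t)| ≤ |s - t| * c * r ^ (-(M₁ + δ)) := by
      refine hmain.trans ?_
      calc _ ≤ |s - t| * (c * r ^ (-δ)) * r ^ (-M₁) := by gcongr
        _ = |s - t| * c * (r ^ (-δ) * r ^ (-M₁)) := by ring
        _ = _ := by rw [← Real.rpow_add hr]; ring_nf
    have h2 : E ^ 2 * r⁻¹ ^ 2 ≤ d ^ 2 := by
      rw [← mul_pow]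
      refine pow_le_pow_left₀ (by positivity) ?_ 2
      rw [← div_eq_mul_inv, div_le_iff₀ hr]; exact hE
    have h3 : r ^ (-(2 * (M₁ + δ))) = (r ^ (-(M₁ + δ))) ^ 2 := by
      rw [← Real.rpow_mul_natCast hr.le]; congr 1; push_cast; ring
    rw [h3, ← mul_assoc]
    calc _ ≤ d ^ 2 * (|s - t| * c * r ^ (-(M₁ + δ))) ^ 2 := by gcongr
      _ ≤ (4 * (1 + d ^ 2)) * (|s - t| * c * r ^ (-(M₁ + δ))) ^ 2 := by
        gcongr; nlinarith [sq_nonneg d]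
      _ = _ := by ring
  · rw [not_le] at h
    have hlog : |Real.log r| ≤ c * r ^ (m / 2) := by
      rw [abs_of_nonneg (Real.log_nonneg h.le)]
      refine (Real.log_le_rpow_div hr.le (half_pos hm)).trans ?_
      rw [div_eq_mul_inv, mul_comm]
      gcongr
    have hmax : max (r ^ (-s)) (r ^ (-t)) ≤ r ^ (-m) :=
      max_le (Real.rpow_le_rpow_of_exponent_le h.le (by linarith))
        (Real.rpow_le_rpow_of_exponent_le h.le (by linarith))
    have h1 : |r ^ (-s) - r ^ (-t)| ≤ |s - t| * c * r ^ (-(m / 2)) := by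
      refine hmain.trans ?_
      calc _ ≤ |s - t| * (c * r ^ (m / 2)) * r ^ (-m) := by gcongr
        _ = |s - t| * c * (r ^ (m / 2) * r ^ (-m)) := by ring
        _ = _ := by rw [← Real.rpow_add hr]; ring_nf
    have h2 : r ^ (-2 - m) = r⁻¹ ^ 2 * (r ^ (-(m / 2))) ^ 2 := by
      rw [← Real.rpow_neg_one, ← Real.rpow_mul_natCast hr.le, ← Real.rpow_mul_natCast hr.le,
        ← Real.rpow_add hr]
      congr 1; push_cast; ring
    have h3 : E ^ 2 ≤ 4 := by nlinarith
    rw [h2]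
    calc _ ≤ 4 * (r⁻¹ ^ 2 * (|s - t| * c * r ^ (-(m / 2))) ^ 2) := by gcongr
      _ ≤ (4 * (1 + d ^ 2)) * (r⁻¹ ^ 2 * (|s - t| * c * r ^ (-(m / 2))) ^ 2) := by
        gcongr; nlinarith [sq_nonneg d]
      _ = _ := by ring

end PointwiseBounds

/-! ### Estimates of the harmonizable kernels -/

section KernelEstimates

/-- The character `ξ ↦ e^{j⟨x,ξ⟩}`. -/
noncomputable def planeWave (x ξ : Plane) : ℂ :=
  Complex.exp (Complex.I * ((inner ℝ x ξ : ℝ) : ℂ))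

lemma harmonizableKernel_eq (g : Plane → ℝ) (x ξ : Plane) :
    harmonizableKernel g x ξ = (planeWave x ξ - 1) * (g ξ : ℂ) := rfl

lemma planeWave_add (x y ξ : Plane) :
    planeWave (x + y) ξ = planeWave x ξ * planeWave y ξ := by
  rw [planeWave, planeWave, planeWave, ← Complex.exp_add, inner_add_left]
  push_cast; ring_nf

lemma norm_planeWave (x ξ : Plane) : ‖planeWave x ξ‖ = 1 := by
  rw [planeWave, mul_comm, Complex.norm_exp_ofReal_mul_I]

lemma conj_planeWave (x ξ : Plane) : conj (planeWave x ξ) = planeWave (-x) ξ := by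
  rw [planeWave, planeWave, ← Complex.exp_conj]
  simp

lemma planeWave_neg_right (x ξ : Plane) : planeWave x (-ξ) = planeWave (-x) ξ := by
  simp [planeWave]

lemma norm_planeWave_sub_one_le_two (x ξ : Plane) : ‖planeWave x ξ - 1‖ ≤ 2 := by
  refine (norm_sub_le _ _).trans ?_
  rw [norm_planeWave, norm_one]; norm_num

lemma norm_planeWave_sub_one_le (x ξ : Plane) : ‖planeWave x ξ - 1‖ ≤ ‖x‖ * ‖ξ‖ :=
  Real.norm_exp_I_mul_ofReal_sub_one_le.trans (norm_inner_le_norm _ _)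

lemma norm_planeWave_sub (x y ξ : Plane) :
    ‖planeWave x ξ - planeWave y ξ‖ = ‖planeWave (x - y) ξ - 1‖ := by
  have h : planeWave x ξ - planeWave y ξ = planeWave y ξ * (planeWave (x - y) ξ - 1) := by
    rw [mul_sub, ← planeWave_add, mul_one, add_sub_cancel]
  rw [h, norm_mul, norm_planeWave, one_mul]

lemma measurable_harmonizableKernel {g : Plane → ℝ} (hg : Measurable g) (x : Plane) :
    Measurable (harmonizableKernel g x) := by
  unfold harmonizableKernel
  fun_prop

/-- Hermitian symmetry of the kernel of an even function, the reason why the field is real. -/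
lemma conj_harmonizableKernel_neg {g : Plane → ℝ} (hg : ∀ ξ, g (-ξ) = g ξ) (x ξ : Plane) :
    conj (harmonizableKernel g x (-ξ)) = harmonizableKernel g x ξ := by
  rw [harmonizableKernel_eq, harmonizableKernel_eq, map_mul, map_sub, conj_planeWave,
    planeWave_neg_right, neg_neg, map_one, Complex.conj_ofReal, hg]

variable {β : ℝ} {h : Plane → ℝ} {C : Plane → Plane → ℝ}

lemma sqrtDensity_eq (h : Plane → ℝ) (C : Plane → Plane → ℝ) (x ξ : Plane) :
    sqrtDensity h C x ξ = C x ξ * ‖ξ‖ ^ (-(h x) - 1) := by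
  rw [sqrtDensity, show -(h x) - 1 = -(h x + 1) by ring, Real.rpow_neg (norm_nonneg _),
    div_eq_mul_inv]

lemma measurable_sqrtDensity (hC : GAFBFAssumptions β h C) (x : Plane) :
    Measurable (sqrtDensity h C x) := by
  unfold sqrtDensity
  exact (hC.C_measurable x).div (by fun_prop)

lemma sqrtDensity_neg (hC : GAFBFAssumptions β h C) (x ξ : Plane) :
    sqrtDensity h C x (-ξ) = sqrtDensity h C x ξ := by
  rw [sqrtDensity, sqrtDensity, hC.C_even, norm_neg]

lemma GAFBFAssumptions.exists_h_bounds (hC : GAFBFAssumptions β h C) :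
    ∃ m M : ℝ, 0 < m ∧ M < 1 ∧ M < β ∧ (∀ x, m ≤ h x) ∧ ∀ x, h x ≤ M :=
  ⟨⨅ x, h x, ⨆ x, h x, hC.iInf_pos, hC.iSup_lt_one, hC.iSup_lt,
    fun x => ciInf_le ⟨0, by rintro _ ⟨y, rfl⟩; exact (hC.h_mem y).1⟩ x,
    fun x => le_ciSup ⟨1, by rintro _ ⟨y, rfl⟩; exact (hC.h_mem y).2⟩ x⟩

lemma GAFBFAssumptions.exists_C_bound (hC : GAFBFAssumptions β h C) :
    ∃ B : ℝ, 0 ≤ B ∧ ∀ x ξ, C x ξ ≤ B := by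
  obtain ⟨B, hB⟩ := hC.C_bounded
  exact ⟨B, (hC.C_nonneg 0 0).trans (hB 0 0), hB⟩

/-- The angular variation of `C` over a ball, in terms of `‖x - y‖ ^ (2 β)`. -/
lemma GAFBFAssumptions.exists_angular_bound (hC : GAFBFAssumptions β h C) (R : ℝ) (hR : 0 ≤ R) :
    ∃ A : ℝ, 0 ≤ A ∧ ∀ x y : Plane, ‖x‖ ≤ R → ‖y‖ ≤ R →
      ∫⁻ Θ : Metric.sphere (0 : Plane) 1, ENNReal.ofReal ((C x Θ - C y Θ) ^ 2)
        ∂((volume : Measure Plane).toSphere) ≤ ENNReal.ofReal (A * ‖x - y‖ ^ (2 * β)) := by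
  obtain ⟨η, hη, -, hK⟩ := hC.C_angular
  obtain ⟨A, hA, hbound⟩ := hK (Metric.closedBall 0 R) (isCompact_closedBall 0 R)
  refine ⟨A.toReal * (2 * R) ^ (2 * η - 2 * β), by positivity, fun x y hx hy => ?_⟩
  rcases eq_or_ne x y with rfl | hxy
  · simp
  have hd : 0 < ‖x - y‖ := norm_pos_iff.2 (sub_ne_zero.2 hxy)
  have hd2 : ‖x - y‖ ≤ 2 * R := (norm_sub_le _ _).trans (by linarith)
  have h1 := le_trans (le_iSup₂ (f := fun (z : Plane) (_ : z ≠ 0) =>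
    ENNReal.ofReal (‖z‖ ^ (-(2 * η))) * ∫⁻ Θ : Metric.sphere (0 : Plane) 1,
      ENNReal.ofReal ((C (y + z) Θ - C y Θ) ^ 2) ∂((volume : Measure Plane).toSphere))
    (x - y) (sub_ne_zero.2 hxy)) (hbound y (by simpa using hy))
  rw [add_sub_cancel, Real.rpow_neg hd.le, ENNReal.ofReal_inv_of_pos (by positivity), mul_comm,
    ← div_eq_mul_inv, ENNReal.div_le_iff (by simpa using Real.rpow_pos_of_pos hd _) (by simp),
    ← ENNReal.ofReal_toReal hA.ne, ← ENNReal.ofReal_mul (by positivity)] at h1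
  refine h1.trans (ENNReal.ofReal_le_ofReal ?_)
  rw [mul_assoc]
  gcongr
  have h2 : ‖x - y‖ ^ (2 * η) = ‖x - y‖ ^ (2 * η - 2 * β) * ‖x - y‖ ^ (2 * β) := by
    rw [← Real.rpow_add hd]; ring_nf
  rw [h2]
  gcongr
  linarith

lemma norm_harmonizableKernel_sq (g : Plane → ℝ) (x ξ : Plane) :
    ‖harmonizableKernel g x ξ‖ ^ 2 = ‖planeWave x ξ - 1‖ ^ 2 * g ξ ^ 2 := by
  rw [harmonizableKernel_eq, norm_mul, mul_pow, Complex.norm_real, Real.norm_eq_abs, sq_abs]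

/-- Domination of the spectral integrand by the radial weight; the exponent `(1 + M) / 2` lies
strictly between `M` and `1`. -/
lemma norm_planeWave_sub_one_sq_mul_le (hC : GAFBFAssumptions β h C) {m M B : ℝ} (hm : 0 < m)
    (hM : M < 1) (hhm : ∀ x, m ≤ h x) (hhM : ∀ x, h x ≤ M) (hB : ∀ x ξ, C x ξ ≤ B)
    (x p : Plane) {ξ : Plane} (hξ : ξ ≠ 0) :
    ‖planeWave p ξ - 1‖ ^ 2 * sqrtDensity h C x ξ ^ 2 ≤
      B ^ 2 * (4 * (‖p‖ ^ 2 + ‖p‖ ^ m) * spectralWeight m ((1 + M) / 2) ‖ξ‖) := by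
  have h1 := sq_mul_rpow_le hm (hhm x) (M := (1 + M) / 2) (by linarith [hhM x]) (by linarith)
    (norm_pos_iff.2 hξ) (norm_nonneg p) (norm_nonneg _) (norm_planeWave_sub_one_le_two p ξ)
    (norm_planeWave_sub_one_le p ξ)
  have h2 : C x ξ ^ 2 ≤ B ^ 2 := pow_le_pow_left₀ (hC.C_nonneg x ξ) (hB x ξ) 2
  rw [sqrtDensity_eq, mul_pow, mul_left_comm]
  exact mul_le_mul h2 h1 (by positivity) (by positivity)

lemma ae_ne_zero : ∀ᵐ ξ : Plane, ξ ≠ 0 := by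
  simp [ae_iff]

/-- The kernels are square integrable, so that the fields are well defined. -/
lemma memLp_harmonizableKernel (hC : GAFBFAssumptions β h C) (x p : Plane) :
    MemLp (harmonizableKernel (sqrtDensity h C x) p) 2 (volume : Measure Plane) := by
  obtain ⟨m, M, hm, hM, -, hhm, hhM⟩ := hC.exists_h_bounds
  obtain ⟨B, -, hB⟩ := hC.exists_C_bound
  have hmeas := (measurable_harmonizableKernel (measurable_sqrtDensity hC x) p).aestronglyMeasurable
    (μ := volume)
  rw [memLp_two_iff_integrable_sq_norm hmeas]
  refine Integrable.mono' (((integrable_spectralWeight hm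
    (by linarith : (1 + M) / 2 < 1)).const_mul (4 * (‖p‖ ^ 2 + ‖p‖ ^ m))).const_mul (B ^ 2))
    (hmeas.norm.pow 2) ?_
  filter_upwards [ae_ne_zero] with ξ hξ
  rw [Real.norm_of_nonneg (by positivity), norm_harmonizableKernel_sq]
  exact norm_planeWave_sub_one_sq_mul_le hC hm hM hhm hhM hB x p hξ

/-- Increments in the wave vector variable: `∫ |e^{j⟨x,ξ⟩} - e^{j⟨y,ξ⟩}|² f(p,ξ) dξ` is of
order `‖x - y‖ ^ m` at most, locally uniformly. -/
lemma exists_integral_increment_le (hC : GAFBFAssumptions β h C) {m M : ℝ} (hm : 0 < m)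
    (hM : M < 1) (hhm : ∀ x, m ≤ h x) (hhM : ∀ x, h x ≤ M) (R : ℝ) (hR : 0 ≤ R) :
    ∃ K : ℝ, 0 ≤ K ∧ ∀ p x y : Plane, ‖x‖ ≤ R → ‖y‖ ≤ R →
      ∫ ξ, ‖harmonizableKernel (sqrtDensity h C p) x ξ -
        harmonizableKernel (sqrtDensity h C p) y ξ‖ ^ 2 ≤ K * ‖x - y‖ ^ m := by
  obtain ⟨B, hB0, hB⟩ := hC.exists_C_bound
  set W := ∫ ξ : Plane, spectralWeight m ((1 + M) / 2) ‖ξ‖ with hWdef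
  have hW0 : 0 ≤ W := integral_nonneg fun ξ => spectralWeight_nonneg (norm_nonneg _)
  have hm2 : m ≤ 1 := by linarith [hhm 0, hhM 0]
  refine ⟨B ^ 2 * (4 * ((2 * R) ^ (2 - m) + 1)) * W, by positivity, fun p x y hx hy => ?_⟩
  have hd2 : ‖x - y‖ ≤ 2 * R := (norm_sub_le _ _).trans (by linarith)
  have h1 : ∫ ξ, ‖harmonizableKernel (sqrtDensity h C p) x ξ -
      harmonizableKernel (sqrtDensity h C p) y ξ‖ ^ 2 ≤
      ∫ ξ : Plane, B ^ 2 *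
        (4 * (‖x - y‖ ^ 2 + ‖x - y‖ ^ m) * spectralWeight m ((1 + M) / 2) ‖ξ‖) := by
    refine integral_mono_of_nonneg (ae_of_all _ fun ξ => by positivity)
      (((integrable_spectralWeight hm (by linarith)).const_mul _).const_mul _) ?_
    filter_upwards [ae_ne_zero] with ξ hξ
    have h2 : harmonizableKernel (sqrtDensity h C p) x ξ -
        harmonizableKernel (sqrtDensity h C p) y ξ =
        (planeWave x ξ - planeWave y ξ) * (sqrtDensity h C p ξ : ℂ) := by
      rw [harmonizableKernel_eq, harmonizableKernel_eq]; ring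
    rw [h2, norm_mul, norm_planeWave_sub, mul_pow, Complex.norm_real, Real.norm_eq_abs, sq_abs]
    exact norm_planeWave_sub_one_sq_mul_le hC hm hM hhm hhM hB p (x - y) hξ
  refine h1.trans ?_
  rw [integral_const_mul, integral_const_mul, ← hWdef]
  have h3 : ‖x - y‖ ^ 2 ≤ (2 * R) ^ (2 - m) * ‖x - y‖ ^ m := by
    have : ‖x - y‖ ^ 2 = ‖x - y‖ ^ (2 - m) * ‖x - y‖ ^ m := by
      rw [← Real.rpow_add' (norm_nonneg _) (by norm_num)]
      norm_num
    rw [this]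
    gcongr
    linarith
  calc _ ≤ B ^ 2 * (4 * ((2 * R) ^ (2 - m) * ‖x - y‖ ^ m + ‖x - y‖ ^ m) * W) := by gcongr
    _ = _ := by ring

/-- Variation of the spectral density with the space variable:
`∫ |e^{j⟨p,ξ⟩} - 1|² (f^{1/2}(x,ξ) - f^{1/2}(y,ξ))² dξ` is of order `‖x - y‖ ^ (2 β)` at most,
locally uniformly. The variation of `C` is handled by the angular condition, that of the exponent by
the Hölder condition on `h`. -/
lemma exists_integral_density_le (hC : GAFBFAssumptions β h C) {m M : ℝ} (hm : 0 < m)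
    (hM : M < 1) (hhm : ∀ x, m ≤ h x) (hhM : ∀ x, h x ≤ M) (R : ℝ) (hR : 0 ≤ R) :
    ∃ K : ℝ, 0 ≤ K ∧ ∀ p x y : Plane, ‖p‖ ≤ R → ‖x‖ ≤ R → ‖y‖ ≤ R →
      ∫ ξ, ‖harmonizableKernel (sqrtDensity h C x) p ξ -
        harmonizableKernel (sqrtDensity h C y) p ξ‖ ^ 2 ≤ K * ‖x - y‖ ^ (2 * β) := by
  obtain ⟨B, hB0, hB⟩ := hC.exists_C_bound
  obtain ⟨Λ, hΛ⟩ := hC.h_holder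
  obtain ⟨A, hA0, hA⟩ := hC.exists_angular_bound R hR
  obtain ⟨c, hc0, hc⟩ := integral_homogeneous_mul_spectralWeight_le hm
    (by linarith : (1 + M) / 2 < 1)
  set w : Plane → ℝ := fun ξ => spectralWeight m ((1 + M) / 2) ‖ξ‖ with hw
  have hwi : Integrable w := integrable_spectralWeight hm (by linarith)
  have hwn : ∀ ξ, 0 ≤ w ξ := fun ξ => spectralWeight_nonneg (norm_nonneg _)
  set W := ∫ ξ, w ξ with hWdef
  have hW0 : 0 ≤ W := integral_nonneg hwn
  set a := 4 * (1 + R ^ 2) * (((1 - M) / 2)⁻¹ + (m / 2)⁻¹) ^ 2 with ha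
  have ha0 : 0 ≤ a := by positivity
  refine ⟨2 * (4 * (R ^ 2 + R ^ m)) * (c * A) + 2 * B ^ 2 * a * Λ ^ 2 * W, by positivity,
    fun p x y hp hx hy => ?_⟩
  have hmeasC : Measurable fun ξ => (C x ξ - C y ξ) ^ 2 :=
    ((hC.C_measurable x).sub (hC.C_measurable y)).pow_const 2
  have hint1 : Integrable fun ξ => (C x ξ - C y ξ) ^ 2 * w ξ := by
    refine hwi.bdd_mul (c := B ^ 2) hmeasC.aestronglyMeasurable (ae_of_all _ fun ξ => ?_)
    rw [Real.norm_of_nonneg (sq_nonneg _), ← sq_abs]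
    refine pow_le_pow_left₀ (abs_nonneg _) ?_ 2
    have h1 := hB x ξ
    have h2 := hB y ξ
    have h3 := hC.C_nonneg x ξ
    have h4 := hC.C_nonneg y ξ
    rw [abs_le]; constructor <;> linarith
  have h1 : ∫ ξ, ‖harmonizableKernel (sqrtDensity h C x) p ξ -
      harmonizableKernel (sqrtDensity h C y) p ξ‖ ^ 2 ≤
      ∫ ξ, (2 * (4 * (R ^ 2 + R ^ m)) * ((C x ξ - C y ξ) ^ 2 * w ξ) +
        2 * B ^ 2 * a * (h x - h y) ^ 2 * w ξ) := by
    refine integral_mono_of_nonneg (ae_of_all _ fun ξ => by positivity)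
      ((hint1.const_mul _).add (hwi.const_mul _)) ?_
    filter_upwards [ae_ne_zero] with ξ hξ
    have hr : 0 < ‖ξ‖ := norm_pos_iff.2 hξ
    have e1 : harmonizableKernel (sqrtDensity h C x) p ξ -
        harmonizableKernel (sqrtDensity h C y) p ξ =
        (planeWave p ξ - 1) * ((sqrtDensity h C x ξ - sqrtDensity h C y ξ : ℝ) : ℂ) := by
      rw [harmonizableKernel_eq, harmonizableKernel_eq]; push_cast; ring
    have e2 : sqrtDensity h C x ξ - sqrtDensity h C y ξ =
        (C x ξ - C y ξ) * ‖ξ‖ ^ (-(h x) - 1) +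
          C y ξ * (‖ξ‖ ^ (-(h x) - 1) - ‖ξ‖ ^ (-(h y) - 1)) := by
      rw [sqrtDensity_eq, sqrtDensity_eq]; ring
    rw [e1, norm_mul, mul_pow, Complex.norm_real, Real.norm_eq_abs, sq_abs, e2]
    have b1 := sq_mul_rpow_le hm (hhm x) (M := (1 + M) / 2) (by linarith [hhM x]) (by linarith)
      hr (norm_nonneg p) (norm_nonneg _) (norm_planeWave_sub_one_le_two p ξ)
      (norm_planeWave_sub_one_le p ξ)
    have b2 := sq_mul_rpow_sub_le hm (hhm x) (hhm y) (hhM x) (hhM y)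
      (by linarith : 0 < (1 - M) / 2) hr (norm_nonneg _) (norm_planeWave_sub_one_le_two p ξ)
      (norm_planeWave_sub_one_le p ξ)
    rw [show M + (1 - M) / 2 = (1 + M) / 2 by ring] at b2
    change _ ≤ _ * w ξ at b1
    change _ ≤ _ * w ξ at b2
    have hCy : C y ξ ^ 2 ≤ B ^ 2 := pow_le_pow_left₀ (hC.C_nonneg y ξ) (hB y ξ) 2
    set E := ‖planeWave p ξ - 1‖
    set u := ‖ξ‖ ^ (-(h x) - 1)
    set v := ‖ξ‖ ^ (-(h y) - 1)
    have b1' : E ^ 2 * u ^ 2 ≤ 4 * (R ^ 2 + R ^ m) * w ξ := by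
      refine b1.trans ?_
      have := hwn ξ
      gcongr
    have b2' : E ^ 2 * (u - v) ^ 2 ≤ a * (h x - h y) ^ 2 * w ξ := by
      refine b2.trans ?_
      have := hwn ξ
      rw [ha]
      gcongr
    calc E ^ 2 * ((C x ξ - C y ξ) * u + C y ξ * (u - v)) ^ 2
        ≤ E ^ 2 * (2 * ((C x ξ - C y ξ) * u) ^ 2 + 2 * (C y ξ * (u - v)) ^ 2) := by
          gcongr
          nlinarith [sq_nonneg ((C x ξ - C y ξ) * u - C y ξ * (u - v))]
      _ = 2 * (C x ξ - C y ξ) ^ 2 * (E ^ 2 * u ^ 2) + 2 * C y ξ ^ 2 * (E ^ 2 * (u - v) ^ 2) := by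
          ring
      _ ≤ 2 * (C x ξ - C y ξ) ^ 2 * (4 * (R ^ 2 + R ^ m) * w ξ) +
          2 * B ^ 2 * (a * (h x - h y) ^ 2 * w ξ) := by gcongr
      _ = _ := by ring
  refine h1.trans ?_
  rw [integral_add (hint1.const_mul _) (hwi.const_mul _), integral_const_mul, integral_const_mul,
    ← hWdef]
  have h2 : ∫ ξ, (C x ξ - C y ξ) ^ 2 * w ξ ≤ c * (A * ‖x - y‖ ^ (2 * β)) :=
    hc _ hmeasC (fun ξ => sq_nonneg _)
      (fun ξ ρ hρ => by rw [hC.C_homogeneous x ξ ρ hρ, hC.C_homogeneous y ξ ρ hρ]) _ (by positivity)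
      (hA x y hx hy)
  have h3 : (h x - h y) ^ 2 ≤ Λ ^ 2 * ‖x - y‖ ^ (2 * β) := by
    rw [← sq_abs, mul_comm 2 β, Real.rpow_mul (norm_nonneg _), Real.rpow_two, ← mul_pow]
    exact pow_le_pow_left₀ (abs_nonneg _) (hΛ x y) 2
  calc _ ≤ 2 * (4 * (R ^ 2 + R ^ m)) * (c * (A * ‖x - y‖ ^ (2 * β))) +
        2 * B ^ 2 * a * (Λ ^ 2 * ‖x - y‖ ^ (2 * β)) * W := by gcongr
    _ = _ := by ring

lemma integral_norm_add_sq_le {α : Type*} [MeasurableSpace α] {μ : Measure α} {f g : α → ℂ}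
    (hf : MemLp f 2 μ) (hg : MemLp g 2 μ) :
    ∫ a, ‖f a + g a‖ ^ 2 ∂μ ≤ 2 * ∫ a, ‖f a‖ ^ 2 ∂μ + 2 * ∫ a, ‖g a‖ ^ 2 ∂μ := by
  have h1 : Integrable (fun a => ‖f a‖ ^ 2) μ := (memLp_two_iff_integrable_sq_norm hf.1).1 hf
  have h2 : Integrable (fun a => ‖g a‖ ^ 2) μ := (memLp_two_iff_integrable_sq_norm hg.1).1 hg
  rw [← integral_const_mul, ← integral_const_mul, ← integral_add (h1.const_mul _) (h2.const_mul _)]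
  refine integral_mono_of_nonneg (ae_of_all _ fun a => by positivity)
    ((h1.const_mul _).add (h2.const_mul _)) (ae_of_all _ fun a => ?_)
  have h3 := pow_le_pow_left₀ (norm_nonneg _) (norm_add_le (f a) (g a)) 2
  simp only
  nlinarith [sq_nonneg (‖f a‖ - ‖g a‖)]

/-- Increments of the kernel of the field `X`, whose spectral density varies with the point. -/
lemma exists_integral_field_increment_le (hC : GAFBFAssumptions β h C) {m M : ℝ} (hm : 0 < m)
    (hM : M < 1) (hMβ : M < β) (hhm : ∀ x, m ≤ h x) (hhM : ∀ x, h x ≤ M) (R : ℝ) (hR : 0 ≤ R) :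
    ∃ K : ℝ, 0 ≤ K ∧ ∀ x y : Plane, ‖x‖ ≤ R → ‖y‖ ≤ R →
      ∫ ξ, ‖harmonizableKernel (sqrtDensity h C x) x ξ -
        harmonizableKernel (sqrtDensity h C y) y ξ‖ ^ 2 ≤ K * ‖x - y‖ ^ m := by
  obtain ⟨K₁, hK₁, h1⟩ := exists_integral_increment_le hC hm hM hhm hhM R hR
  obtain ⟨K₂, hK₂, h2⟩ := exists_integral_density_le hC hm hM hhm hhM R hR
  have hmM : m ≤ M := (hhm 0).trans (hhM 0)
  refine ⟨2 * K₁ + 2 * (K₂ * (2 * R) ^ (2 * β - m)), by positivity, fun x y hx hy => ?_⟩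
  have hd2 : ‖x - y‖ ≤ 2 * R := (norm_sub_le _ _).trans (by linarith)
  have e := integral_norm_add_sq_le
    ((memLp_harmonizableKernel hC x x).sub (memLp_harmonizableKernel hC x y))
    ((memLp_harmonizableKernel hC x y).sub (memLp_harmonizableKernel hC y y))
  simp only [Pi.sub_apply, sub_add_sub_cancel] at e
  have h3 : ‖x - y‖ ^ (2 * β) ≤ (2 * R) ^ (2 * β - m) * ‖x - y‖ ^ m := by
    have : ‖x - y‖ ^ (2 * β) = ‖x - y‖ ^ (2 * β - m) * ‖x - y‖ ^ m := by
      rw [← Real.rpow_add' (norm_nonneg _) (by linarith)]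
      ring_nf
    rw [this]
    gcongr
    linarith
  calc _ ≤ 2 * (K₁ * ‖x - y‖ ^ m) + 2 * (K₂ * ‖x - y‖ ^ (2 * β)) :=
        e.trans (by gcongr; exacts [h1 x x y hx hy, h2 y x y hy hx hy])
    _ ≤ 2 * (K₁ * ‖x - y‖ ^ m) + 2 * (K₂ * ((2 * R) ^ (2 * β - m) * ‖x - y‖ ^ m)) := by gcongr
    _ = _ := by ring

end KernelEstimates

/-! ### Existence and invariance properties of the fields -/

section Fields

variable {Ω : Type u} [MeasurableSpace Ω] {P : Measure Ω}
  {W : Set Plane → Ω → ℂ} {β : ℝ} {h : Plane → ℝ} {C : Plane → Plane → ℝ}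

lemma IsWienerIntegral.real_sub (hW : IsComplexWhiteNoise P W) {f g : Plane → ℂ} {R R' : Ω → ℝ}
    (hR : IsWienerIntegral P W f fun ω => (R ω : ℂ))
    (hR' : IsWienerIntegral P W g fun ω => (R' ω : ℂ)) :
    IsWienerIntegral P W (fun ξ => f ξ - g ξ) fun ω => ((R ω - R' ω : ℝ) : ℂ) := by
  simpa using hR.sub hW hR'

lemma IsWienerIntegral.real_const_mul (hW : IsComplexWhiteNoise P W) {f : Plane → ℂ} {R : Ω → ℝ}
    (hR : IsWienerIntegral P W f fun ω => (R ω : ℂ)) (c : ℝ) :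
    IsWienerIntegral P W (fun ξ => (c : ℂ) * f ξ) fun ω => ((c * R ω : ℝ) : ℂ) := by
  simpa using hR.const_mul hW (c : ℂ)

lemma aemeasurable_of_isWienerIntegral {f : Plane → ℂ} {R : Ω → ℝ}
    (hR : IsWienerIntegral P W f fun ω => (R ω : ℂ)) : AEMeasurable R P :=
  (MemLp.of_ofReal hR.2.1).1.aemeasurable

/-- The spectral density of the tangent field is the square of its kernel. -/
lemma hasSpectralDensity_of_isHarmonizableField (hW : IsComplexWhiteNoise P W)
    (hC : GAFBFAssumptions β h C) {x₀ : Plane} {Y : Ω → C(Plane, ℝ)}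
    (hY : IsHarmonizableField P W (sqrtDensity h C x₀) Y) :
    HasSpectralDensity P Y fun ξ => sqrtDensity h C x₀ ξ ^ 2 where
  measurable := (measurable_sqrtDensity hC x₀).pow_const 2
  nonneg ξ := sq_nonneg _
  integrable := by
    obtain ⟨m, M, hm, hM, -, hhm, hhM⟩ := hC.exists_h_bounds
    obtain ⟨B, -, hB⟩ := hC.exists_C_bound
    refine Integrable.mono' (((integrable_spectralWeight hm
      (by linarith : (1 + M) / 2 < 1)).const_mul (4 * (1 ^ 2 + 1 ^ m))).const_mul (B ^ 2))
      ((measurable_const.min (measurable_norm.pow_const 2)).mul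
        ((measurable_sqrtDensity hC x₀).pow_const 2)).aestronglyMeasurable ?_
    filter_upwards [ae_ne_zero] with ξ hξ
    rw [Real.norm_of_nonneg (by positivity), sqrtDensity_eq, mul_pow, mul_left_comm]
    have h1 := sq_mul_rpow_le hm (hhm x₀) (M := (1 + M) / 2) (by linarith [hhM x₀]) (by linarith)
      (norm_pos_iff.2 hξ) zero_le_one (E := min 1 ‖ξ‖) (by positivity)
      ((min_le_left _ _).trans one_le_two) ((min_le_right _ _).trans_eq (one_mul _).symm)
    have h2 : C x₀ ξ ^ 2 ≤ B ^ 2 := pow_le_pow_left₀ (hC.C_nonneg x₀ ξ) (hB x₀ ξ) 2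
    have h3 : min 1 (‖ξ‖ ^ 2) = min 1 ‖ξ‖ ^ 2 := by
      rcases le_total 1 ‖ξ‖ with h | h
      · rw [min_eq_left h, min_eq_left (one_le_pow₀ h), one_pow]
      · rw [min_eq_right h, min_eq_right (pow_le_one₀ (norm_nonneg _) h)]
    rw [h3]
    exact mul_le_mul h2 h1 (by positivity) (by positivity)
  covariance x y := by
    rw [(hY x).integral_mul hW (hY y)]
    refine integral_congr_ae (ae_of_all _ fun ξ => ?_)
    simp only [harmonizableKernel_eq, map_mul, map_sub, conj_planeWave, map_one,
      Complex.conj_ofReal]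
    have h1 : planeWave (-y) ξ = Complex.exp (-(Complex.I * ((inner ℝ y ξ : ℝ) : ℂ))) := by
      simp [planeWave]
    rw [h1, planeWave]
    push_cast
    ring

lemma aemeasurable_of_isWienerIntegral_paths {k : Plane → Plane → ℂ} {X : Ω → C(Plane, ℝ)}
    (hX : ∀ x, IsWienerIntegral P W (k x) fun ω => ((X ω x : ℝ) : ℂ)) : AEMeasurable X P :=
  aemeasurable_paths fun x => aemeasurable_of_isWienerIntegral (hX x)

variable [IsProbabilityMeasure P]

/-- A family of real Wiener integrals whose kernels satisfy a local Hölder condition in `L²` has a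
continuous modification. -/
lemma exists_continuous_isWienerIntegral (hW : IsComplexWhiteNoise P W) {k : Plane → Plane → ℂ}
    (hk : ∀ x, MemLp (k x) 2 (volume : Measure Plane))
    (hsymm : ∀ x ξ, conj (k x (-ξ)) = k x ξ) {m : ℝ} (hm : 0 < m)
    (hK : ∀ R : ℝ, 0 ≤ R → ∃ K : ℝ, 0 ≤ K ∧ ∀ x y : Plane, ‖x‖ ≤ R → ‖y‖ ≤ R →
      ∫ ξ, ‖k x ξ - k y ξ‖ ^ 2 ≤ K * ‖x - y‖ ^ m) :
    ∃ X : Ω → C(Plane, ℝ), ∀ x, IsWienerIntegral P W (k x) fun ω => ((X ω x : ℝ) : ℂ) := by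
  choose V hV using fun x => exists_real_isWienerIntegral hW (hk x) (hsymm x)
  -- A Gaussian moment of order `2 q` with `m q > 4` has the order of smallness needed for chaining.
  obtain ⟨q, hq⟩ := exists_nat_gt (4 / m)
  have hq' : 4 < m * q := by rwa [div_lt_iff₀ hm, mul_comm] at hq
  have hq0 : q ≠ 0 := by rintro rfl; norm_num at hq'
  obtain ⟨X, hX⟩ := exists_continuous_modification (P := P) (V := V)
    (fun x => aemeasurable_of_isWienerIntegral (hV x)) (p := 2 * q) (by omega) (by
      intro N
      obtain ⟨K, hK0, hK⟩ := hK (2 * N + 2) (by positivity)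
      refine ⟨gaussMoment q * ENNReal.ofReal (K ^ q * (2 * (2 * N + 2)) ^ (m * q - 4)),
        ENNReal.mul_ne_top (gaussMoment_ne_top q) ENNReal.ofReal_ne_top, fun s t hs ht => ?_⟩
      have hst := (hV s).real_sub hW (hV t)
      rw [← ofReal_norm]
      refine lintegral_enorm_pow_le_of_variance_le (hst.hasGaussianLaw hW).1
        (hst.hasGaussianLaw hW).2 hK0 (norm_nonneg _) ?_ ?_ hq'
      · exact (norm_sub_le s t).trans (by linarith)
      · rw [hst.integral_sq hW]
        exact hK s t hs ht)
  refine ⟨X, fun x => (hV x).congr (EventuallyEq.refl _ _) ?_⟩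
  filter_upwards [hX x] with ω hω
  rw [hω]

theorem exists_isGAFBF (hW : IsComplexWhiteNoise P W) (hC : GAFBFAssumptions β h C) :
    ∃ X : Ω → C(Plane, ℝ), IsGAFBF P W h C X := by
  obtain ⟨m, M, hm, hM, hMβ, hhm, hhM⟩ := hC.exists_h_bounds
  exact exists_continuous_isWienerIntegral hW (fun x => memLp_harmonizableKernel hC x x)
    (fun x ξ => conj_harmonizableKernel_neg (sqrtDensity_neg hC x) x ξ) hm
    fun R hR => exists_integral_field_increment_le hC hm hM hMβ hhm hhM R hR

lemma exists_isHarmonizableField (hW : IsComplexWhiteNoise P W) (hC : GAFBFAssumptions β h C)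
    (x₀ : Plane) : ∃ Y : Ω → C(Plane, ℝ), IsHarmonizableField P W (sqrtDensity h C x₀) Y := by
  obtain ⟨m, M, hm, hM, -, hhm, hhM⟩ := hC.exists_h_bounds
  refine exists_continuous_isWienerIntegral hW (fun x => memLp_harmonizableKernel hC x₀ x)
    (fun x ξ => conj_harmonizableKernel_neg (sqrtDensity_neg hC x₀) x ξ) hm fun R hR => ?_
  obtain ⟨K, hK0, hK⟩ := exists_integral_increment_le hC hm hM hhm hhM R hR
  exact ⟨K, hK0, hK x₀⟩

lemma isCenteredGaussianField_of_isWienerIntegral (hW : IsComplexWhiteNoise P W)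
    {k : Plane → Plane → ℂ} {X : Ω → C(Plane, ℝ)}
    (hX : ∀ x, IsWienerIntegral P W (k x) fun ω => ((X ω x : ℝ) : ℂ)) :
    IsCenteredGaussianField P X :=
  ⟨isGaussianProcess_of_isWienerIntegral hW hX, fun x => ((hX x).hasGaussianLaw hW).2⟩

/-- Two families of real Wiener integrals whose kernels have the same inner products have the same
finite dimensional distributions. -/
lemma fddEq_of_isWienerIntegral (hW : IsComplexWhiteNoise P W) {f g : Plane → Plane → ℂ}
    {U V : Plane → Ω → ℝ} (hU : ∀ x, IsWienerIntegral P W (f x) fun ω => (U x ω : ℂ))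
    (hV : ∀ x, IsWienerIntegral P W (g x) fun ω => (V x ω : ℂ))
    (hfg : ∀ x y, ∫ ξ, f x ξ * conj (f y ξ) = ∫ ξ, g x ξ * conj (g y ξ)) : FddEq P U V := by
  refine fddEq_of_gaussian (isGaussianProcess_of_isWienerIntegral hW hU)
    (isGaussianProcess_of_isWienerIntegral hW hV) (fun x => ((hU x).hasGaussianLaw hW).2)
    (fun x => ((hV x).hasGaussianLaw hW).2) fun x y => Complex.ofReal_injective ?_
  rw [(hU x).integral_mul hW (hU y), (hV x).integral_mul hW (hV y), hfg]

/-- A translation multiplies the kernel by a function of modulus one, which disappears from the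
covariance: hence the stationarity of the increments. -/
lemma harmonizableKernel_add_sub (g : Plane → ℝ) (x u ξ : Plane) :
    harmonizableKernel g (x + u) ξ - harmonizableKernel g x ξ =
      planeWave x ξ * harmonizableKernel g u ξ := by
  simp only [harmonizableKernel_eq, planeWave_add]; ring

lemma planeWave_mul_mul_conj (x ξ : Plane) (a b : ℂ) :
    planeWave x ξ * a * conj (planeWave x ξ * b) = a * conj b := by
  have h1 : planeWave x ξ * conj (planeWave x ξ) = 1 := by
    rw [Complex.mul_conj, Complex.normSq_eq_norm_sq, norm_planeWave]; simp
  rw [map_mul]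
  linear_combination a * conj b * h1

lemma harmonizableKernel_smul (hC : GAFBFAssumptions β h C) (x₀ : Plane) {c : ℝ} (hc : 0 < c)
    (x ξ : Plane) : harmonizableKernel (sqrtDensity h C x₀) (c • x) ξ =
      ((c ^ (h x₀ + 1) : ℝ) : ℂ) * harmonizableKernel (sqrtDensity h C x₀) x (c • ξ) := by
  have h1 : planeWave (c • x) ξ = planeWave x (c • ξ) := by
    simp only [planeWave, inner_smul_left, inner_smul_right]; simp
  have h2 : sqrtDensity h C x₀ ξ = c ^ (h x₀ + 1) * sqrtDensity h C x₀ (c • ξ) := by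
    have := Real.rpow_pos_of_pos hc (h x₀ + 1)
    rw [sqrtDensity, sqrtDensity, hC.C_homogeneous _ _ _ hc, norm_smul, Real.norm_of_nonneg hc.le,
      Real.mul_rpow hc.le (norm_nonneg _)]
    rw [← mul_div_assoc, mul_div_mul_left _ _ this.ne']
  rw [harmonizableKernel_eq, harmonizableKernel_eq, h1, h2]
  push_cast; ring

/-- Scaling of the covariance of the tangent field. -/
lemma integral_harmonizableKernel_smul (hC : GAFBFAssumptions β h C) (x₀ : Plane) {c : ℝ}
    (hc : 0 < c) (x y : Plane) :
    ∫ ξ, harmonizableKernel (sqrtDensity h C x₀) (c • x) ξ *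
        conj (harmonizableKernel (sqrtDensity h C x₀) (c • y) ξ) =
      ((c ^ h x₀ : ℝ) : ℂ) ^ 2 * ∫ ξ, harmonizableKernel (sqrtDensity h C x₀) x ξ *
        conj (harmonizableKernel (sqrtDensity h C x₀) y ξ) := by
  simp_rw [harmonizableKernel_smul hC x₀ hc, map_mul, Complex.conj_ofReal]
  set F : Plane → ℂ := fun ξ => harmonizableKernel (sqrtDensity h C x₀) x ξ *
    conj (harmonizableKernel (sqrtDensity h C x₀) y ξ) with hF
  have h1 : ∀ ξ, ((c ^ (h x₀ + 1) : ℝ) : ℂ) * harmonizableKernel (sqrtDensity h C x₀) x (c • ξ) *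
      (((c ^ (h x₀ + 1) : ℝ) : ℂ) * conj (harmonizableKernel (sqrtDensity h C x₀) y (c • ξ))) =
      ((c ^ (h x₀ + 1) : ℝ) : ℂ) ^ 2 * F (c • ξ) := fun ξ => by simp only [hF]; ring
  simp_rw [h1]
  rw [integral_const_mul, Measure.integral_comp_smul_of_nonneg _ _ _ (hR := hc.le),
    finrank_euclideanSpace, Fintype.card_fin, Complex.real_smul, ← mul_assoc,
    Real.rpow_add_one hc.ne']
  congr 1
  have : (c : ℂ) ≠ 0 := Complex.ofReal_ne_zero.2 hc.ne'
  push_cast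
  field_simp

lemma isSelfSimilar_of_isHarmonizableField (hW : IsComplexWhiteNoise P W)
    (hC : GAFBFAssumptions β h C) {x₀ : Plane} {Y : Ω → C(Plane, ℝ)}
    (hY : IsHarmonizableField P W (sqrtDensity h C x₀) Y) : IsSelfSimilar P (h x₀) Y := by
  intro c hc
  refine fddEq_of_isWienerIntegral hW (fun x => hY (c • x))
    (fun x => (hY x).real_const_mul hW (c ^ h x₀)) fun x y => ?_
  rw [integral_harmonizableKernel_smul hC x₀ hc, ← integral_const_mul]
  refine integral_congr_ae (ae_of_all _ fun ξ => ?_)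
  simp only [map_mul, Complex.conj_ofReal]
  ring

lemma hasStationaryIncrements_of_isHarmonizableField (hW : IsComplexWhiteNoise P W)
    {g : Plane → ℝ} {Y : Ω → C(Plane, ℝ)} (hY : IsHarmonizableField P W g Y) :
    HasStationaryIncrements P Y := by
  intro x
  refine fddEq_of_isWienerIntegral hW (fun u => (hY (x + u)).real_sub hW (hY x)) hY
    fun u v => ?_
  simp_rw [harmonizableKernel_add_sub, planeWave_mul_mul_conj]

lemma rescaledIncrement_apply (x₀ : Plane) (H ρ : ℝ) (φ : C(Plane, ℝ)) (u : Plane) :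
    rescaledIncrement x₀ H ρ φ u = (φ (x₀ + ρ • u) - φ x₀) / ρ ^ H := rfl

lemma measurable_rescaledIncrement (x₀ : Plane) (H ρ : ℝ) :
    Measurable (rescaledIncrement x₀ H ρ) :=
  measurable_paths_iff.2 fun u => by
    simp only [rescaledIncrement_apply]
    exact ((measurable_path_eval _).sub (measurable_path_eval _)).div_const _

/-- By stationarity of the increments and self-similarity, the rescaled increments of the tangent
field have exactly the law of that field, at every scale. -/
lemma map_rescaledIncrement_eq (hW : IsComplexWhiteNoise P W) (hC : GAFBFAssumptions β h C)
    {x₀ : Plane} {Y : Ω → C(Plane, ℝ)} (hY : IsHarmonizableField P W (sqrtDensity h C x₀) Y)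
    {ρ : ℝ} (hρ : 0 < ρ) :
    P.map (fun ω => rescaledIncrement x₀ (h x₀) ρ (Y ω)) = P.map Y := by
  have hYm := aemeasurable_of_isWienerIntegral_paths hY
  refine map_paths_eq_of_fddEq ((measurable_rescaledIncrement _ _ _).comp_aemeasurable hYm) hYm ?_
  have hU : ∀ u, IsWienerIntegral P W
      (fun ξ => (((ρ ^ h x₀)⁻¹ : ℝ) : ℂ) * (harmonizableKernel (sqrtDensity h C x₀) (x₀ + ρ • u) ξ -
        harmonizableKernel (sqrtDensity h C x₀) x₀ ξ))
      fun ω => ((rescaledIncrement x₀ (h x₀) ρ (Y ω) u : ℝ) : ℂ) := by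
    intro u
    have := ((hY (x₀ + ρ • u)).real_sub hW (hY x₀)).real_const_mul hW (ρ ^ h x₀)⁻¹
    simpa only [rescaledIncrement_apply, div_eq_inv_mul] using this
  refine fddEq_of_isWienerIntegral hW hU hY fun u v => ?_
  have h1 : ∀ ξ, (((ρ ^ h x₀)⁻¹ : ℝ) : ℂ) *
      (harmonizableKernel (sqrtDensity h C x₀) (x₀ + ρ • u) ξ -
        harmonizableKernel (sqrtDensity h C x₀) x₀ ξ) * conj ((((ρ ^ h x₀)⁻¹ : ℝ) : ℂ) *
      (harmonizableKernel (sqrtDensity h C x₀) (x₀ + ρ • v) ξ -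
        harmonizableKernel (sqrtDensity h C x₀) x₀ ξ)) = ((((ρ ^ h x₀)⁻¹ : ℝ) : ℂ)) ^ 2 *
      (harmonizableKernel (sqrtDensity h C x₀) (ρ • u) ξ *
        conj (harmonizableKernel (sqrtDensity h C x₀) (ρ • v) ξ)) := by
    intro ξ
    rw [harmonizableKernel_add_sub, harmonizableKernel_add_sub,
      ← planeWave_mul_mul_conj x₀ ξ (harmonizableKernel (sqrtDensity h C x₀) (ρ • u) ξ)]
    simp only [map_mul, Complex.conj_ofReal]
    ring
  simp_rw [h1]
  rw [integral_const_mul, integral_harmonizableKernel_smul hC x₀ hρ, ← mul_assoc, ← mul_pow,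
    ← Complex.ofReal_mul, inv_mul_cancel₀ (Real.rpow_pos_of_pos hρ _).ne']
  simp

lemma isAnisotropyFunction_of_isHarmonizableField (hW : IsComplexWhiteNoise P W)
    (hC : GAFBFAssumptions β h C) {x₀ : Plane} {Y : Ω → C(Plane, ℝ)}
    (hY : IsHarmonizableField P W (sqrtDensity h C x₀) Y) :
    IsAnisotropyFunction P Y (h x₀) fun Θ => C x₀ Θ ^ 2 where
  mem_Ioo := by
    obtain ⟨m, M, hm, hM, -, hhm, hhM⟩ := hC.exists_h_bounds
    exact ⟨hm.trans_le (hhm x₀), (hhM x₀).trans_lt hM⟩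
  gaussian := isCenteredGaussianField_of_isWienerIntegral hW hY
  selfSimilar := isSelfSimilar_of_isHarmonizableField hW hC hY
  stationaryIncrements := hasStationaryIncrements_of_isHarmonizableField hW hY
  density := by
    refine ⟨_, hasSpectralDensity_of_isHarmonizableField hW hC hY, fun r Θ hr => ?_⟩
    have hΘ : ‖(Θ : Plane)‖ = 1 := by simp
    rw [sqrtDensity_eq, hC.C_homogeneous _ _ _ hr, norm_smul, hΘ, mul_one,
      Real.norm_of_nonneg hr.le, mul_pow, ← Real.rpow_mul_natCast hr.le, mul_comm]
    congr 2
    push_cast; ring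

end Fields

/-! ### The tangent field -/

section TangentField

variable {Ω : Type u} [MeasurableSpace Ω] {P : Measure Ω}

/-- Uniform continuity on the path space only involves the values of the paths on a large square. -/
lemma exists_openSquare_of_uniformContinuous {F : C(Plane, ℝ) → ℝ} (hF : UniformContinuous F)
    {ε : ℝ} (hε : 0 < ε) : ∃ (N : ℕ) (δ : ℝ), 0 < δ ∧ ∀ φ ψ : C(Plane, ℝ),
      (∀ x ∈ openSquare N, |φ x - ψ x| < δ) → |F φ - F ψ| < ε := by
  have h1 := hF (Metric.dist_mem_uniformity hε)
  rw [mem_map, ContinuousMap.mem_compactConvergence_entourage_iff] at h1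
  obtain ⟨K, V, hK, hV, hsub⟩ := h1
  obtain ⟨δ, hδ, hδV⟩ := Metric.mem_uniformity_dist.1 hV
  obtain ⟨R, hR⟩ := hK.isBounded.exists_norm_le
  obtain ⟨N, hN⟩ := exists_nat_gt R
  refine ⟨N, δ, hδ, fun φ ψ hφψ => ?_⟩
  have h2 : (φ, ψ) ∈ {p : C(Plane, ℝ) × C(Plane, ℝ) | ∀ x ∈ K, (p.1 x, p.2 x) ∈ V} :=
    fun x hx => hδV (hφψ x (mem_openSquare ((hR x hx).trans_lt hN)))
  exact hsub h2

/-- Slutsky's lemma in the path space: a field that is locally uniformly close in probability to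
fields with a fixed law converges in distribution to that law. -/
lemma tendstoInDistribution_of_close [IsProbabilityMeasure P] {ι : Type*} {l : Filter ι}
    [l.IsCountablyGenerated] {A B : ι → Ω → C(Plane, ℝ)} {Y : Ω → C(Plane, ℝ)}
    (hA : ∀ i, AEMeasurable (A i) P) (hB : ∀ i, AEMeasurable (B i) P) (hY : AEMeasurable Y P)
    (hBY : ∀ᶠ i in l, P.map (B i) = P.map Y)
    (hclose : ∀ (N : ℕ) (ε : ℝ), 0 < ε →
      Tendsto (fun i => P {ω | ∃ x ∈ openSquare N, ε ≤ |A i ω x - B i ω x|}) l (𝓝 0)) :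
    TendstoInDistribution A l Y (fun _ => P) P := by
  refine ⟨hA, hY, ?_⟩
  -- The compact-open topology is metrizable, so it suffices to test bounded Lipschitz functions.
  let _ : PseudoMetricSpace C(Plane, ℝ) := UniformSpace.pseudoMetricSpace C(Plane, ℝ)
  refine tendsto_iff_forall_lipschitz_integral_tendsto.2 ?_
  rintro F ⟨c, hc⟩ ⟨L, hL⟩
  have hFu : UniformContinuous F := hL.uniformContinuous
  have hFm : Measurable F := hFu.continuous.measurable
  have hFi : ∀ {T : Ω → C(Plane, ℝ)}, AEMeasurable T P → Integrable (fun ω => F (T ω)) P := by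
    intro T hT
    refine Integrable.of_bound (C := |F 0| + c)
      (hFm.comp_aemeasurable hT).aestronglyMeasurable (ae_of_all _ fun ω => ?_)
    have h1 := hc (T ω) 0
    rw [Real.dist_eq] at h1
    have h2 := abs_sub_abs_le_abs_sub (F (T ω)) (F 0)
    rw [Real.norm_eq_abs]
    linarith
  have hc0 : 0 ≤ c := dist_nonneg.trans (hc 0 0)
  change Tendsto (fun i => ∫ φ, F φ ∂(P.map (A i))) l (𝓝 (∫ φ, F φ ∂(P.map Y)))
  rw [integral_map hY hFm.aestronglyMeasurable, Metric.tendsto_nhds]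
  intro ε hε
  obtain ⟨N, δ, hδ, hNδ⟩ := exists_openSquare_of_uniformContinuous hFu (half_pos hε)
  have hsmall : ∀ᶠ i in l, P {ω | ∃ x ∈ openSquare N, δ ≤ |A i ω x - B i ω x|} <
      ENNReal.ofReal (ε / (2 * (c + 1))) :=
    (hclose N δ hδ).eventually_lt_const (ENNReal.ofReal_pos.2 (by positivity))
  filter_upwards [hsmall, hBY] with i hi hi2
  rw [integral_map (hA i) hFm.aestronglyMeasurable]
  -- `B i` has the law of `Y` and, unlike `Y`, is close to `A i`.
  have e1 : ∫ ω, F (Y ω) ∂P = ∫ ω, F (B i ω) ∂P := by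
    rw [← integral_map hY hFm.aestronglyMeasurable, ← hi2,
      integral_map (hB i) hFm.aestronglyMeasurable]
  set S := toMeasurable P {ω | ∃ x ∈ openSquare N, δ ≤ |A i ω x - B i ω x|} with hS
  have hSm : MeasurableSet S := measurableSet_toMeasurable _ _
  have hSP : P.real S ≤ ε / (2 * (c + 1)) := by
    rw [Measure.real, hS, measure_toMeasurable]
    exact ENNReal.toReal_le_of_le_ofReal (by positivity) hi.le
  rw [e1, Real.dist_eq, ← integral_sub (hFi (hA i)) (hFi (hB i))]
  have h1 : ‖∫ ω, (F (A i ω) - F (B i ω)) ∂P‖ ≤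
      ∫ ω, (ε / 2 + S.indicator (fun _ => c) ω) ∂P := by
    refine norm_integral_le_of_norm_le
      ((integrable_const _).add ((integrable_const _).indicator hSm)) (ae_of_all _ fun ω => ?_)
    by_cases hω : ω ∈ S
    · rw [Set.indicator_of_mem hω]
      have := hc (A i ω) (B i ω)
      rw [Real.dist_eq] at this
      rw [Real.norm_eq_abs]; linarith
    · rw [Set.indicator_of_notMem hω, add_zero]
      refine (hNδ _ _ fun x hx => ?_).le
      by_contra hcon
      exact hω (subset_toMeasurable _ _ ⟨x, hx, not_lt.1 hcon⟩)
  rw [integral_add (integrable_const _) ((integrable_const _).indicator hSm), integral_const,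
    integral_indicator_const _ hSm] at h1
  simp only [probReal_univ, smul_eq_mul, one_mul] at h1
  rw [← Real.norm_eq_abs]
  refine h1.trans_lt ?_
  calc ε / 2 + P.real S * c ≤ ε / 2 + ε / (2 * (c + 1)) * c := by gcongr
    _ < ε / 2 + ε / (2 * (c + 1)) * (c + 1) := by gcongr; linarith
    _ = ε := by field_simp; ring

/-- Uniform smallness in probability from the moments of the increments, by chaining. -/
lemma tendsto_measure_openSquare {ι : Type*} {l : Filter ι} {D : ι → Ω → C(Plane, ℝ)}
    (hD : ∀ i x, AEMeasurable (fun ω => D i ω x) P) (hD0 : ∀ i ω, D i ω 0 = 0) {p : ℕ}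
    (hp : p ≠ 0) {N : ℕ} {K : ι → ℝ≥0∞} (hK0 : Tendsto K l (𝓝 0))
    (hK : ∀ᶠ i in l, ∀ s t : Plane, ‖s‖ ≤ 2 * N + 2 → ‖t‖ ≤ 2 * N + 2 →
      ∫⁻ ω, ‖D i ω s - D i ω t‖ₑ ^ p ∂P ≤ K i * ‖s - t‖ₑ ^ 4) {ε : ℝ} (hε : 0 < ε) :
    Tendsto (fun i => P {ω | ∃ x ∈ openSquare N, ε ≤ |D i ω x|}) l (𝓝 0) := by
  obtain ⟨r, hr0, hr1, hr⟩ := exists_pow_eq_half hp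
  have hr2 : 0 < (1 - r)⁻¹ := inv_pos.2 (by linarith)
  set τ := ε / (2 * (1 + (1 - r)⁻¹)) with hτ
  have hτ0 : 0 < τ := by positivity
  set c : ℝ≥0∞ := (((2 * N + 1) ^ 2 * ((2 * N) ^ 4 + 288) : ℕ) : ℝ≥0∞) with hc
  have hlim : Tendsto (fun i => K i * c / ENNReal.ofReal (τ ^ p)) l (𝓝 0) := by
    have h1 : Tendsto (fun i => K i * c) l (𝓝 0) := by
      simpa using ENNReal.Tendsto.mul_const hK0 (Or.inr (ENNReal.natCast_ne_top _))
    have h2 := ENNReal.Tendsto.div_const h1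
      (Or.inr (ENNReal.ofReal_pos.2 (by positivity : 0 < τ ^ p)).ne')
    simpa using h2
  refine tendsto_of_tendsto_of_tendsto_of_le_of_le' tendsto_const_nhds hlim
    (Eventually.of_forall fun _ => zero_le) ?_
  filter_upwards [hK] with i hi
  have hsub : {ω | ∃ x ∈ openSquare N, ε ≤ |D i ω x|} ⊆
      {ω | ENNReal.ofReal (τ ^ p) ≤ chainingSum (fun x => D i ω x) p N} := by
    rintro ω ⟨x, hx, hεx⟩
    by_contra hcon
    obtain ⟨h1, h2⟩ := gridBound_of_chainingSum_le hp hτ0.le hr0 hr (not_le.1 hcon).le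
    have h3 := h1.abs_sub_le hτ0.le hr0 hr1 h2 (D i ω).continuous hx
    rw [hD0, sub_zero] at h3
    have h4 : τ * (1 + (1 - r)⁻¹) = ε / 2 := by
      have h5 : 0 < 1 + (1 - r)⁻¹ := by positivity
      rw [hτ, div_mul_eq_mul_div, mul_div_mul_right _ _ h5.ne']
    rw [h4] at h3
    linarith
  refine (measure_mono hsub).trans ((meas_ge_le_lintegral_div ?_ ?_ ENNReal.ofReal_ne_top).trans ?_)
  · have hm : ∀ s t, AEMeasurable (fun ω => ‖D i ω s - D i ω t‖ₑ ^ p) P := fun s t =>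
      ((hD i s).sub (hD i t)).enorm.pow_const p
    exact (Finset.aemeasurable_fun_sum _ fun k _ => hm _ _).add
      (AEMeasurable.tsum fun n => (Finset.aemeasurable_fun_sum _ fun k _ =>
        Finset.aemeasurable_fun_sum _ fun e _ => hm _ _).const_mul _)
  · exact (ENNReal.ofReal_pos.2 (by positivity : 0 < τ ^ p)).ne'
  · gcongr
    exact lintegral_chainingSum_le (V := fun x ω => D i ω x) (hD i) hi

lemma le_rpow_mul_rpow {v a b θ : ℝ} (hv : 0 ≤ v) (hva : v ≤ a) (hvb : v ≤ b) (hθ0 : 0 ≤ θ)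
    (hθ1 : θ ≤ 1) : v ≤ a ^ θ * b ^ (1 - θ) := by
  calc v = v ^ θ * v ^ (1 - θ) := by
        rw [← Real.rpow_add' hv (by norm_num), add_sub_cancel, Real.rpow_one]
    _ ≤ a ^ θ * b ^ (1 - θ) := by
        have : 0 ≤ a := hv.trans hva
        gcongr

variable {W : Set Plane → Ω → ℂ} {β : ℝ} {h : Plane → ℝ} {C : Plane → Plane → ℝ}

/-- The variance of the increments of `(X - Y) - (X - Y)(x₀)` near `x₀` at scale `ρ`, divided by
`ρ ^ (2 h(x₀))`. It is obtained by interpolating between the Hölder bound with exponent `m`, which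
is too weak in `ρ`, and the pointwise bound of order `ρ ^ (2β)`, in which `β > h(x₀)`. -/
lemma exists_integral_difference_le (hW : IsComplexWhiteNoise P W)
    (hC : GAFBFAssumptions β h C) {X Y : Ω → C(Plane, ℝ)} {x₀ : Plane}
    (hX : IsGAFBF P W h C X) (hY : IsHarmonizableField P W (sqrtDensity h C x₀) Y) :
    ∃ α γ : ℝ, 0 < α ∧ 0 < γ ∧ ∀ R : ℝ, 0 ≤ R → ∃ κ : ℝ, 0 ≤ κ ∧ ∀ ρ : ℝ, 0 < ρ → ρ ≤ 1 →
      ∀ u v : Plane, ‖u‖ ≤ R → ‖v‖ ≤ R → ∃ k : Plane → ℂ,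
        IsWienerIntegral P W k (fun ω =>
          (((rescaledIncrement x₀ (h x₀) ρ (X ω) u - rescaledIncrement x₀ (h x₀) ρ (Y ω) u) -
            (rescaledIncrement x₀ (h x₀) ρ (X ω) v - rescaledIncrement x₀ (h x₀) ρ (Y ω) v) : ℝ) :
              ℂ)) ∧
        ∫ ξ, ‖k ξ‖ ^ 2 ≤ κ * ρ ^ γ * ‖u - v‖ ^ α := by
  obtain ⟨m, M, hm, hM, hMβ, hhm, hhM⟩ := hC.exists_h_bounds
  have hH1 := hhm x₀
  have hH2 := hhM x₀
  set H := h x₀ with hH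
  -- This weight makes the exponent `m θ + 2 β (1 - θ) - 2 H` of `ρ` equal to `β - H > 0`.
  set θ := (β - H) / (2 * β - m) with hθ
  have h2β : 0 < 2 * β - m := by linarith
  have hθ0 : 0 < θ := div_pos (by linarith) h2β
  have hθ1 : θ ≤ 1 := (div_le_one h2β).2 (by linarith)
  have hexp : m * θ + 2 * β * (1 - θ) - 2 * H = β - H := by
    have : θ * (2 * β - m) = β - H := div_mul_cancel₀ _ h2β.ne'
    linear_combination -this
  refine ⟨m * θ, β - H, by positivity, by linarith, fun R hR => ?_⟩
  set R' := ‖x₀‖ + R with hR'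
  have hR'0 : 0 ≤ R' := by positivity
  obtain ⟨K₁, hK₁, h1⟩ := exists_integral_increment_le hC hm hM hhm hhM R' hR'0
  obtain ⟨K₂, hK₂, h2⟩ := exists_integral_density_le hC hm hM hhm hhM R' hR'0
  obtain ⟨K₃, hK₃, h3⟩ := exists_integral_field_increment_le hC hm hM hMβ hhm hhM R' hR'0
  refine ⟨(2 * K₃ + 2 * K₁) ^ θ * (4 * K₂ * R ^ (2 * β)) ^ (1 - θ), by positivity,
    fun ρ hρ hρ1 u v hu hv => ?_⟩
  have hball : ∀ w : Plane, ‖w‖ ≤ R → ‖x₀ + ρ • w‖ ≤ R' := by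
    intro w hw
    refine (norm_add_le _ _).trans ?_
    rw [norm_smul, Real.norm_of_nonneg hρ.le, hR']
    have := mul_le_of_le_one_left (norm_nonneg w) hρ1
    linarith
  have hx₀ : ‖x₀‖ ≤ R' := by rw [hR']; linarith
  -- The kernel of `X(x) - Y(x)`, which vanishes at `x = x₀`.
  set d : Plane → Plane → ℂ := fun x ξ => harmonizableKernel (sqrtDensity h C x) x ξ -
    harmonizableKernel (sqrtDensity h C x₀) x ξ with hd
  have hdm : ∀ x, MemLp (d x) 2 (volume : Measure Plane) := fun x =>
    (memLp_harmonizableKernel hC x x).sub (memLp_harmonizableKernel hC x₀ x)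
  have hd0 : ∀ w : Plane, ‖w‖ ≤ R →
      ∫ ξ, ‖d (x₀ + ρ • w) ξ‖ ^ 2 ≤ K₂ * (ρ ^ (2 * β) * R ^ (2 * β)) := by
    intro w hw
    refine (h2 _ _ _ (hball w hw) (hball w hw) hx₀).trans ?_
    rw [add_sub_cancel_left, norm_smul, Real.norm_of_nonneg hρ.le, ← Real.mul_rpow hρ.le hR]
    gcongr
    linarith
  have hneg : ∀ x, ∫ ξ, ‖-d x ξ‖ ^ 2 = ∫ ξ, ‖d x ξ‖ ^ 2 := fun x => by simp_rw [norm_neg]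
  set x := x₀ + ρ • u with hx
  set y := x₀ + ρ • v with hy
  have hxy : ‖x - y‖ = ρ * ‖u - v‖ := by
    rw [hx, hy, add_sub_add_left_eq_sub, ← smul_sub, norm_smul, Real.norm_of_nonneg hρ.le]
  have hva : ∫ ξ, ‖d x ξ - d y ξ‖ ^ 2 ≤ (2 * K₃ + 2 * K₁) * (ρ ^ m * ‖u - v‖ ^ m) := by
    have e := integral_norm_add_sq_le
      ((memLp_harmonizableKernel hC x x).sub (memLp_harmonizableKernel hC y y))
      ((memLp_harmonizableKernel hC x₀ y).sub (memLp_harmonizableKernel hC x₀ x))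
    have e1 := h3 x y (hball u hu) (hball v hv)
    have e2 := h1 x₀ y x (hball v hv) (hball u hu)
    rw [norm_sub_rev y x] at e2
    rw [← Real.mul_rpow hρ.le (norm_nonneg _), ← hxy]
    refine le_trans (le_of_eq ?_) (e.trans ?_)
    · refine integral_congr_ae (ae_of_all _ fun ξ => ?_)
      simp only [hd, Pi.sub_apply]
      congr 2
      ring
    · simp only [Pi.sub_apply]
      linarith
  have hvb : ∫ ξ, ‖d x ξ - d y ξ‖ ^ 2 ≤ 4 * K₂ * R ^ (2 * β) * ρ ^ (2 * β) := by
    have e := integral_norm_add_sq_le (hdm x) (hdm y).neg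
    simp only [Pi.neg_apply, ← sub_eq_add_neg, hneg] at e
    linarith [hd0 u hu, hd0 v hv]
  have hρH : 0 < ρ ^ H := Real.rpow_pos_of_pos hρ _
  refine ⟨fun ξ => (((ρ ^ H)⁻¹ : ℝ) : ℂ) * (d x ξ - d y ξ), ?_, ?_⟩
  · have e := ((((hX x).real_sub hW (hY x)).real_sub hW ((hX y).real_sub hW (hY y)))).real_const_mul
      hW (ρ ^ H)⁻¹
    refine e.congr (EventuallyEq.refl _ _) (ae_of_all _ fun ω => ?_)
    simp only [rescaledIncrement_apply]
    congr 1
    rw [← hx, ← hy]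
    field_simp
    ring
  · have e : ∀ ξ, ‖(((ρ ^ H)⁻¹ : ℝ) : ℂ) * (d x ξ - d y ξ)‖ ^ 2 =
        ((ρ ^ H)⁻¹) ^ 2 * ‖d x ξ - d y ξ‖ ^ 2 := by
      intro ξ
      rw [norm_mul, mul_pow, Complex.norm_real, Real.norm_of_nonneg (inv_pos.2 hρH).le]
    simp_rw [e]
    rw [integral_const_mul]
    have hint := le_rpow_mul_rpow (integral_nonneg fun ξ => by positivity) hva hvb hθ0.le hθ1
    have hpow : ((ρ ^ H)⁻¹) ^ 2 * (ρ ^ (m * θ) * ρ ^ (2 * β * (1 - θ))) = ρ ^ (β - H) := by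
      rw [← Real.rpow_neg hρ.le, ← Real.rpow_mul_natCast hρ.le, ← Real.rpow_add hρ,
        ← Real.rpow_add hρ, ← hexp]
      congr 1; push_cast; ring
    calc _ ≤ ((ρ ^ H)⁻¹) ^ 2 * (((2 * K₃ + 2 * K₁) * (ρ ^ m * ‖u - v‖ ^ m)) ^ θ *
          (4 * K₂ * R ^ (2 * β) * ρ ^ (2 * β)) ^ (1 - θ)) := by gcongr
      _ = (2 * K₃ + 2 * K₁) ^ θ * (4 * K₂ * R ^ (2 * β)) ^ (1 - θ) *
          (((ρ ^ H)⁻¹) ^ 2 * (ρ ^ (m * θ) * ρ ^ (2 * β * (1 - θ)))) * ‖u - v‖ ^ (m * θ) := by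
        rw [Real.mul_rpow (by positivity) (by positivity),
          Real.mul_rpow (by positivity) (by positivity),
          Real.mul_rpow (x := 4 * K₂ * R ^ (2 * β)) (by positivity) (by positivity),
          ← Real.rpow_mul hρ.le, ← Real.rpow_mul (norm_nonneg _), ← Real.rpow_mul hρ.le]
        ring
      _ = _ := by rw [hpow]

theorem hasTangentField_of_isGAFBF [IsProbabilityMeasure P] (hW : IsComplexWhiteNoise P W)
    (hC : GAFBFAssumptions β h C) {X Y : Ω → C(Plane, ℝ)} {x₀ : Plane}
    (hX : IsGAFBF P W h C X) (hY : IsHarmonizableField P W (sqrtDensity h C x₀) Y) :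
    HasTangentField P X x₀ (h x₀) P Y := by
  refine ⟨(isAnisotropyFunction_of_isHarmonizableField hW hC hY).mem_Ioo, ?_⟩
  have hXm : AEMeasurable X P := aemeasurable_of_isWienerIntegral_paths hX
  have hYm : AEMeasurable Y P := aemeasurable_of_isWienerIntegral_paths hY
  have hA : ∀ ρ : ℝ, AEMeasurable (fun ω => rescaledIncrement x₀ (h x₀) ρ (X ω)) P := fun ρ =>
    (measurable_rescaledIncrement _ _ _).comp_aemeasurable hXm
  have hB : ∀ ρ : ℝ, AEMeasurable (fun ω => rescaledIncrement x₀ (h x₀) ρ (Y ω)) P := fun ρ =>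
    (measurable_rescaledIncrement _ _ _).comp_aemeasurable hYm
  refine tendstoInDistribution_of_close hA hB hYm ?_ fun N ε hε => ?_
  · filter_upwards [self_mem_nhdsWithin] with ρ hρ
    exact map_rescaledIncrement_eq hW hC hY hρ
  obtain ⟨α, γ, hα, hγ, hvar⟩ := exists_integral_difference_le hW hC hX hY
  obtain ⟨q, hq⟩ := exists_nat_gt (4 / α)
  have hq' : 4 < α * q := by rwa [div_lt_iff₀ hα, mul_comm] at hq
  have hq0 : q ≠ 0 := by rintro rfl; norm_num at hq'
  obtain ⟨κ, hκ, hvar⟩ := hvar (2 * N + 2) (by positivity)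
  set c : ℝ := (2 * (2 * N + 2)) ^ (α * q - 4) with hc
  let D : ℝ → Ω → C(Plane, ℝ) := fun ρ ω =>
    rescaledIncrement x₀ (h x₀) ρ (X ω) - rescaledIncrement x₀ (h x₀) ρ (Y ω)
  refine tendsto_measure_openSquare (D := D) (p := 2 * q)
    (K := fun ρ => gaussMoment q * ENNReal.ofReal ((κ * ρ ^ γ) ^ q * c)) (fun ρ x => ?_)
    (fun ρ ω => ?_) (by omega) ?_ ?_ hε
  · exact ((measurable_path_eval x).comp_aemeasurable (hA ρ)).sub
      ((measurable_path_eval x).comp_aemeasurable (hB ρ))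
  · simp [D, rescaledIncrement_apply]
  · have h1 : Tendsto (fun ρ : ℝ => (κ * ρ ^ γ) ^ q * c) (𝓝[>] 0) (𝓝 ((κ * 0 ^ γ) ^ q * c)) := by
      refine (((tendsto_nhdsWithin_of_tendsto_nhds ?_).const_mul κ).pow q).mul_const c
      exact (Real.continuousAt_rpow_const 0 γ (Or.inr hγ.le)).tendsto
    rw [Real.zero_rpow hγ.ne', mul_zero, zero_pow hq0, zero_mul] at h1
    have h2 := ENNReal.Tendsto.const_mul (a := gaussMoment q) (ENNReal.tendsto_ofReal h1)
      (Or.inr (gaussMoment_ne_top q))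
    simpa using h2
  · filter_upwards [Ioc_mem_nhdsGT (zero_lt_one' ℝ)] with ρ hρ s t hs ht
    have hρ0 : (0 : ℝ) < ρ := hρ.1
    obtain ⟨k, hk, hk2⟩ := hvar ρ hρ.1 hρ.2 s t hs ht
    rw [← ofReal_norm]
    refine lintegral_enorm_pow_le_of_variance_le (hk.hasGaussianLaw hW).1 (hk.hasGaussianLaw hW).2
      (by positivity) (norm_nonneg _) ?_ ?_ hq'
    · exact (norm_sub_le s t).trans (by linarith)
    · rw [hk.integral_sq hW]; exact hk2

end TangentField

theorem mainTheorem2 {Ω : Type u} [MeasurableSpace Ω] (P : Measure Ω) [IsProbabilityMeasure P]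
    (W : Set Plane → Ω → ℂ) (hW : IsComplexWhiteNoise P W)
    (β : ℝ) (h : Plane → ℝ) (C : Plane → Plane → ℝ) (hC : GAFBFAssumptions β h C) :
    (∃ X : Ω → C(Plane, ℝ), IsGAFBF P W h C X) ∧
    ∀ X : Ω → C(Plane, ℝ), IsGAFBF P W h C X → ∀ x₀ : Plane,
      (∃ Y : Ω → C(Plane, ℝ), IsHarmonizableField P W (sqrtDensity h C x₀) Y) ∧
      (∀ Y : Ω → C(Plane, ℝ), IsHarmonizableField P W (sqrtDensity h C x₀) Y →
        HasTangentField P X x₀ (h x₀) P Y ∧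
        IsAnisotropyFunction P Y (h x₀) (fun Θ => C x₀ Θ ^ 2)) ∧
      IsLocalAnisotropyFunction P X x₀ (fun Θ => C x₀ Θ ^ 2) := by
  refine ⟨exists_isGAFBF hW hC, fun X hX x₀ => ?_⟩
  obtain ⟨Y, hY⟩ := exists_isHarmonizableField hW hC x₀
  exact ⟨⟨Y, hY⟩, fun Y hY => ⟨hasTangentField_of_isGAFBF hW hC hX hY,
    isAnisotropyFunction_of_isHarmonizableField hW hC hY⟩,
    isCenteredGaussianField_of_isWienerIntegral hW hX, h x₀, Ω, _, P, _, Y,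
    hasTangentField_of_isGAFBF hW hC hX hY, isAnisotropyFunction_of_isHarmonizableField hW hC hY⟩
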